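/- Say that a (non-degenerate) triangle $ABC$ in the Euclidean plane is $N$-tiled by a triangle $T$ (the tile) if $ABC$ is the union of $N$ triangles, each congruent to $T$ (reflections allowed), whose interiors are pairwise disjoint. Call $T$ admissible if its angles, in some order, are $(\alpha,\beta,\pi/3)$ with $\alpha$ not a rational multiple of $\pi$. (1) For every natural number $N$ and every equilateral triangle $ABC$ there is a finite set $S$ of at most $\sqrt{3N}$ triangles such that every admissible tile $T$ that $N$-tiles $ABC$ is congruent to a member of $S$ (which therefore also $N$-tiles $ABC$). (2) It is decidable, given $N$, whether an equilateral triangle can be $N$-tiled by some admissible tile: there is a computable predicate $p$ on the natural numbers such that, for every $N$ and every equilateral triangle $ABC$, $p(N)$ holds if and only if some admissible tile $N$-tiles $ABC$. -/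

import Mathlib

open EuclideanGeometry

namespace Tiling

/-- The Euclidean plane. -/
abbrev Plane := EuclideanSpace ℝ (Fin 2)

/-- A non-degenerate triangle in the plane, given by its three (labelled) vertices. -/
abbrev Triangle := Affine.Triangle ℝ Plane

/-- Two triangles are congruent (reflections allowed): after a suitable relabelling of the
vertices of the first, corresponding sides have equal length. -/
def TriCongruent (T T' : Triangle) : Prop :=
  ∃ σ : Equiv.Perm (Fin 3), Congruent (T.points ∘ σ) T'.points

/-- `ABC` is `N`-tiled by the tile `T`: the closed triangle `ABC` is the union of `N` closed
triangles congruent to `T` whose interiors are pairwise disjoint. -/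
def NTiles (N : ℕ) (T ABC : Triangle) : Prop :=
  ∃ t : Fin N → Triangle,
    (∀ i, TriCongruent (t i) T) ∧
    (⋃ i, (t i).closedInterior) = ABC.closedInterior ∧
    Pairwise fun i j => Disjoint (t i).interior (t j).interior

/-- `T` has angles `(α, β, π/3)`, in some order, with `α` not a rational multiple of `π`. -/
def HasIrrationalSixtyAngles (T : Triangle) : Prop :=
  ∃ A B C : Fin 3, A ≠ B ∧ B ≠ C ∧ C ≠ A ∧
    ∠ (T.points A) (T.points C) (T.points B) = Real.pi / 3 ∧
    Irrational (∠ (T.points B) (T.points A) (T.points C) / Real.pi)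

end Tiling

/-!
Let an equilateral triangle of side one be dissected into `N` copies of a tile with an angle
`π / 3` between the sides `a`, `b`, the third side being `c`, and let another angle `α` be
an irrational multiple of `π`.

*The invariants.* The indicator functions of the tiles add up to the one of the big triangle.
Comparing their jumps across an oriented line shows that the signed lengths of the edges on that
line add up to the signed length of the boundary of the big triangle there
(`IsTiling.sum_edgeSide`). Hence, for every odd function `F` of oriented lines, the sum of
`length * F` over oriented boundaries is additive (`IsTiling.sum_odd`). Three choices of `F` are
used. The signed distance from the origin gives the area: `N * a * b = 1` (`card_mul_area`).
The distance, restricted to lines whose direction is outside the group `G` generated by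
`ω = exp (i π / 3)` and `ζ = exp (i α)`, shows that no tile has a direction outside `G`, since
such tiles would have area zero together (`inDirGroup_of_tiling`). Finally, as `ζ` is not a root
of unity, `ζ ^ k * ω ^ m ↦ (-1) ^ (k + m)` is a well-defined odd function on `G`. The edges of
a positively oriented tile have directions `g`, `ω * ζ * g`, `-ω * g` for some `g`, on which this
function takes the same value, and likewise for mirror images; so every tile contributes its
perimeter with a sign, and `M * (a + b + c) = 3` for an integer `M` (`exists_int_mul_perimeter`).

*Finitely many tiles.* The equations `N * a * b = 1`, `m * (a + b + c) = 3` and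
`c ^ 2 = a ^ 2 + b ^ 2 - a * b` have at most one solution with `b ≤ a`, and only for `m ^ 2 ≤ N`
(`sides_eq`). So there are at most `√N` tiles, and their sides lie in a field `ℚ(√R)` with an
explicit `R`. Whether `α` is an irrational multiple of `π` can be checked, since a root of unity
of degree at most four over `ℚ` is a `120`-th root of unity (`rot_side_root_iff`).

*Decidability.* It remains to decide, for given `N` and `m`, whether `N` copies of the tile can
be placed in the triangle. Because the areas fit, it is enough to ask for a packing, in which any
two tiles are separated by the line of an edge of one of them (`isTiling_iff_isPacking`, by
Helly's theorem). If there is a packing, the directions of its edges are in `G`, thus have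
coordinates in `ℚ(√R)`; the translations are subject to linear inequalities over `ℚ(√R)` and can
also be chosen there, by elimination of variables (`exists_packing_mem_of_tiling`). So a packing is
witnessed by a finite code that can be checked by rational arithmetic. If there is no packing, then
by compactness there are no approximate packings of some precision (`exists_packing_of_approx`),
which is witnessed by a search of a finite grid. One of the two witnesses is always found
(`computablePred_tileable`).

The plane is treated as `ℂ`, with the coordinates of the basis `1`, `ω`; a `Frame` of an
equilateral triangle is a similarity that takes the unit triangle to it.
-/

/-! ### Oriented edges of a triangle -/

namespace Tiling

open Filter Topology MeasureTheory

/-- The cross product of two complex numbers, seen as plane vectors. -/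
def cross (z w : ℂ) : ℝ := z.re * w.im - z.im * w.re

/-- Twice the signed area of the triangle with vertices `V`. -/
def area₂ (V : Fin 3 → ℂ) : ℝ := cross (V 1 - V 0) (V 2 - V 0)

/-- The affine function that vanishes on the line of the edge from `V j` to `V (j + 1)`. -/
def edgeForm (V : Fin 3 → ℂ) (j : Fin 3) (x : ℂ) : ℝ := cross (V (j + 1) - V j) (x - V j)

/-- The open triangle with vertices `V` (empty if the vertices are collinear). -/
def openTri (V : Fin 3 → ℂ) : Set ℂ := {x | ∀ j, 0 < area₂ V * edgeForm V j x}

/-- The closed triangle with vertices `V`; only meaningful if the vertices are not collinear. -/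
def closedTri (V : Fin 3 → ℂ) : Set ℂ := {x | ∀ j, 0 ≤ area₂ V * edgeForm V j x}

/-- The triangle `W` is dissected into the triangles `V i`, all non-degenerate. -/
structure IsTiling {ι : Type*} (W : Fin 3 → ℂ) (V : ι → Fin 3 → ℂ) : Prop where
  area_ne : area₂ W ≠ 0
  area_ne' : ∀ i, area₂ (V i) ≠ 0
  cover : ⋃ i, closedTri (V i) = closedTri W
  disj : Pairwise fun i j => Disjoint (openTri (V i)) (openTri (V j))

/-- The length of the `j`-th edge. -/
noncomputable def edgeLen (V : Fin 3 → ℂ) (j : Fin 3) : ℝ := ‖V (j + 1) - V j‖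

/-- The unit vector along the `j`-th edge, traversed with the triangle on the left. -/
noncomputable def edgeDir (V : Fin 3 → ℂ) (j : Fin 3) : ℂ :=
  ((SignType.sign (area₂ V) : ℝ) / edgeLen V j : ℝ) * (V (j + 1) - V j)

/-- The signed distance of the line of the `j`-th edge from the origin. -/
noncomputable def edgeOff (V : Fin 3 → ℂ) (j : Fin 3) : ℝ := cross (edgeDir V j) (V j)

lemma cross_add_right (z w w' : ℂ) : cross z (w + w') = cross z w + cross z w' := by
  simp [cross]; ring

lemma cross_sub_right (z w w' : ℂ) : cross z (w - w') = cross z w - cross z w' := by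
  simp [cross]; ring

lemma cross_smul_left (r : ℝ) (z w : ℂ) : cross (r * z) w = r * cross z w := by
  simp [cross]; ring

lemma cross_smul_right (r : ℝ) (z w : ℂ) : cross z (r * w) = r * cross z w := by
  simp [cross]; ring

lemma cross_neg_left (z w : ℂ) : cross (-z) w = -cross z w := by
  simp [cross]; ring

lemma cross_neg_right (z w : ℂ) : cross z (-w) = -cross z w := by
  simp [cross]; ring

lemma area₂_rotate (V : Fin 3 → ℂ) (j : Fin 3) :
    cross (V (j + 1) - V j) (V (j + 2) - V j) = area₂ V := by
  fin_cases j <;> simp [area₂, cross] <;> ring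

lemma edgeForm_on_edge_one (V : Fin 3 → ℂ) (j : Fin 3) (t : ℝ) :
    edgeForm V (j + 1) (V j + t * (V (j + 1) - V j)) = (1 - t) * area₂ V := by
  fin_cases j <;> simp [edgeForm, area₂, cross] <;> ring

lemma edgeForm_on_edge_two (V : Fin 3 → ℂ) (j : Fin 3) (t : ℝ) :
    edgeForm V (j + 2) (V j + t * (V (j + 1) - V j)) = t * area₂ V := by
  fin_cases j <;> simp [edgeForm, area₂, cross] <;> ring

lemma edgeLen_pos {V : Fin 3 → ℂ} (hV : area₂ V ≠ 0) (j : Fin 3) : 0 < edgeLen V j := by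
  rw [edgeLen, norm_pos_iff]
  intro h
  apply hV
  rw [← area₂_rotate V j, h]
  simp [cross]

lemma norm_edgeDir {V : Fin 3 → ℂ} (hV : area₂ V ≠ 0) (j : Fin 3) : ‖edgeDir V j‖ = 1 := by
  have h := edgeLen_pos hV j
  rw [edgeDir, norm_mul, Complex.norm_real, norm_div, Real.norm_eq_abs, Real.norm_eq_abs,
    abs_of_pos h, ← edgeLen]
  rcases lt_or_gt_of_ne hV with h' | h' <;> simp [h', h.ne']

lemma area_mul_edgeForm {V : Fin 3 → ℂ} (hV : area₂ V ≠ 0) (j : Fin 3) (x : ℂ) :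
    area₂ V * edgeForm V j x =
      |area₂ V| * edgeLen V j * (cross (edgeDir V j) x - edgeOff V j) := by
  have h := edgeLen_pos hV j
  rw [edgeOff, ← cross_sub_right, edgeDir, cross_smul_left, ← edgeForm]
  have : (SignType.sign (area₂ V) : ℝ) * |area₂ V| = area₂ V := sign_mul_abs _
  field_simp
  linear_combination (-edgeForm V j x) * this

lemma mem_openTri {V : Fin 3 → ℂ} (hV : area₂ V ≠ 0) (x : ℂ) :
    x ∈ openTri V ↔ ∀ j, 0 < cross (edgeDir V j) x - edgeOff V j := by
  simp only [openTri, Set.mem_ofPred_eq]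
  refine forall_congr' fun j => ?_
  rw [area_mul_edgeForm hV, mul_pos_iff_of_pos_left]
  exact mul_pos (abs_pos.2 hV) (edgeLen_pos hV j)

lemma mem_closedTri {V : Fin 3 → ℂ} (hV : area₂ V ≠ 0) (x : ℂ) :
    x ∈ closedTri V ↔ ∀ j, 0 ≤ cross (edgeDir V j) x - edgeOff V j := by
  simp only [closedTri, Set.mem_ofPred_eq]
  refine forall_congr' fun j => ?_
  rw [area_mul_edgeForm hV, mul_nonneg_iff_of_pos_left]
  exact mul_pos (abs_pos.2 hV) (edgeLen_pos hV j)

lemma openTri_subset_closedTri (V : Fin 3 → ℂ) : openTri V ⊆ closedTri V :=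
  fun _ hx j => (hx j).le

/-- Unit vectors with vanishing cross product are equal or opposite. -/
lemma eq_or_eq_neg_of_cross_eq_zero {z w : ℂ} (hz : ‖z‖ = 1) (hw : ‖w‖ = 1)
    (h : cross z w = 0) : z = w ∨ z = -w := by
  have h1 : z.re ^ 2 + z.im ^ 2 = 1 := by
    have := Complex.sq_norm z; rw [hz, Complex.normSq_apply] at this; linarith
  have h2 : w.re ^ 2 + w.im ^ 2 = 1 := by
    have := Complex.sq_norm w; rw [hw, Complex.normSq_apply] at this; linarith
  unfold cross at h
  have h3 : (z.re * w.re + z.im * w.im) ^ 2 = 1 := by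
    have : (z.re * w.re + z.im * w.im) ^ 2 + (z.re * w.im - z.im * w.re) ^ 2 = 1 := by
      calc _ = (z.re ^ 2 + z.im ^ 2) * (w.re ^ 2 + w.im ^ 2) := by ring
        _ = 1 := by rw [h1, h2]; ring
    rw [h] at this; linarith
  rcases sq_eq_one_iff.1 h3 with h4 | h4
  · left
    have : (z.re - w.re) ^ 2 + (z.im - w.im) ^ 2 = 0 := by nlinarith
    apply Complex.ext <;> nlinarith [sq_nonneg (z.re - w.re), sq_nonneg (z.im - w.im)]
  · right
    have : (z.re + w.re) ^ 2 + (z.im + w.im) ^ 2 = 0 := by nlinarith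
    apply Complex.ext <;> simp <;>
      nlinarith [sq_nonneg (z.re + w.re), sq_nonneg (z.im + w.im)]

/-- Different edges of a triangle are not parallel. -/
lemma cross_edgeDir_ne_zero {V : Fin 3 → ℂ} (hV : area₂ V ≠ 0) {j k : Fin 3} (hjk : j ≠ k) :
    cross (edgeDir V j) (edgeDir V k) ≠ 0 := by
  have key : ∀ j k : Fin 3, j ≠ k → cross (V (j + 1) - V j) (V (k + 1) - V k) ≠ 0 := by
    intro j k hjk h
    apply hV
    fin_cases j <;> fin_cases k <;> simp [area₂, cross] at hjk h ⊢ <;> linarith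
  rw [edgeDir, edgeDir, cross_smul_left, cross_smul_right]
  have hs : (SignType.sign (area₂ V) : ℝ) ≠ 0 := by
    rcases lt_or_gt_of_ne hV with h' | h' <;> simp [h']
  exact mul_ne_zero (div_ne_zero hs (edgeLen_pos hV j).ne')
    (mul_ne_zero (div_ne_zero hs (edgeLen_pos hV k).ne') (key j k hjk))

/-- Coordinates adapted to the oriented line `{x | cross u x = s}`: `τ` is the position along the
line and `ε` the signed distance from it. -/
noncomputable def linePt (u : ℂ) (s τ ε : ℝ) : ℂ := τ * u + ((s + ε : ℝ) : ℂ) * (Complex.I * u)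

lemma linePt_neg (u : ℂ) (s τ ε : ℝ) : linePt (-u) (-s) (-τ) ε = linePt u s τ (-ε) := by
  simp only [linePt]; push_cast; ring

lemma cross_linePt (d u : ℂ) (s τ ε : ℝ) :
    cross d (linePt u s τ ε) = τ * cross d u + (s + ε) * cross d (Complex.I * u) := by
  rw [linePt, cross_add_right, cross_smul_right, cross_smul_right]

lemma cross_self (u : ℂ) : cross u u = 0 := by simp [cross]; ring

lemma cross_I_mul {u : ℂ} (hu : ‖u‖ = 1) : cross u (Complex.I * u) = 1 := by
  have := Complex.sq_norm u; rw [hu, Complex.normSq_apply] at this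
  simp [cross]; linarith

/-- The position along the `j`-th edge of a point of the line of that edge. -/
noncomputable def edgePos (V : Fin 3 → ℂ) (j : Fin 3) (x : ℂ) : ℝ :=
  ((starRingEnd ℂ) (edgeDir V j) * (x - V j)).re

lemma eq_add_edgePos {V : Fin 3 → ℂ} (hV : area₂ V ≠ 0) (j : Fin 3) {x : ℂ}
    (hx : cross (edgeDir V j) x = edgeOff V j) :
    x = V j + edgePos V j x * edgeDir V j := by
  have h1 := Complex.sq_norm (edgeDir V j)
  rw [norm_edgeDir hV, Complex.normSq_apply] at h1
  have h2 : cross (edgeDir V j) (x - V j) = 0 := by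
    rw [cross_sub_right, hx, edgeOff, sub_self]
  simp only [cross] at h2
  simp only [edgePos]
  generalize edgeDir V j = d at *
  obtain ⟨y, rfl⟩ : ∃ y, x = V j + y := ⟨x - V j, by ring⟩
  simp only [add_sub_cancel_left] at *
  congr 1
  apply Complex.ext <;> simp
  · linear_combination y.re * h1 - d.im * h2
  · linear_combination y.im * h1 + d.re * h2

/-- On the line of an edge, the other two edge conditions cut out exactly the edge. -/
lemma pos_others_iff {V : Fin 3 → ℂ} (hV : area₂ V ≠ 0) (j : Fin 3) {x : ℂ}
    (hx : cross (edgeDir V j) x = edgeOff V j) :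
    (∀ k, k ≠ j → 0 < cross (edgeDir V k) x - edgeOff V k) ↔
      (SignType.sign (area₂ V) : ℝ) * edgePos V j x / edgeLen V j ∈ Set.Ioo (0 : ℝ) 1 := by
  have hl := edgeLen_pos hV
  have hk : ∀ k, (0 < cross (edgeDir V k) x - edgeOff V k) ↔ 0 < area₂ V * edgeForm V k x := by
    intro k
    rw [area_mul_edgeForm hV, mul_pos_iff_of_pos_left]
    exact mul_pos (abs_pos.2 hV) (hl k)
  have hx' := eq_add_edgePos hV j hx
  set t := (SignType.sign (area₂ V) : ℝ) * edgePos V j x / edgeLen V j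
  have hx'' : x = V j + t * (V (j + 1) - V j) := by
    rw [hx', edgeDir]
    simp only [t]
    push_cast
    ring
  have h1 := edgeForm_on_edge_one V j t
  have h2 := edgeForm_on_edge_two V j t
  rw [← hx''] at h1 h2
  have hsq : 0 < area₂ V * area₂ V := mul_self_pos.2 hV
  have e1 : (0 < area₂ V * edgeForm V (j + 1) x) ↔ t < 1 := by
    rw [h1, mul_left_comm, mul_pos_iff_of_pos_right hsq, sub_pos]
  have e2 : (0 < area₂ V * edgeForm V (j + 2) x) ↔ 0 < t := by
    rw [h2, mul_left_comm, mul_pos_iff_of_pos_right hsq]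
  constructor
  · intro h
    exact ⟨e2.1 ((hk _).1 (h _ (by fin_cases j <;> decide))),
      e1.1 ((hk _).1 (h _ (by fin_cases j <;> decide)))⟩
  · rintro ⟨h3, h4⟩ k hkj
    rw [hk]
    have : k = j + 1 ∨ k = j + 2 := by
      clear * - hkj; revert k j; decide
    rcases this with rfl | rfl
    · exact e1.2 h4
    · exact e2.2 h3

end Tiling

/-! ### Additivity of odd line functions in a dissection -/

namespace Tiling

open Filter Topology MeasureTheory

/-- The set of positions `τ` on the line `{x | cross u x = s}` belonging to the `j`-th edge,
provided that this edge lies on that line. -/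
noncomputable def edgeSet (V : Fin 3 → ℂ) (j : Fin 3) (u : ℂ) (s : ℝ) : Set ℝ :=
  {τ | (SignType.sign (area₂ V) : ℝ) * edgePos V j (linePt u s τ 0) / edgeLen V j ∈
    Set.Ioo (0 : ℝ) 1}

open Classical in
/-- `1` if the triangle lies along its `j`-th edge to the left of the oriented line
`{x | cross u x = s}`, `-1` if it lies to the right, `0` if the edge is not on this line. -/
noncomputable def edgeSide (V : Fin 3 → ℂ) (j : Fin 3) (u : ℂ) (s : ℝ) : ℝ :=
  (if edgeDir V j = u ∧ edgeOff V j = s then 1 else 0) -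
    (if edgeDir V j = -u ∧ edgeOff V j = -s then 1 else 0)

/-- The jump of the indicator function of a triangle across the line `{x | cross u x = s}` at
position `τ`. -/
noncomputable def jump (V : Fin 3 → ℂ) (u : ℂ) (s τ : ℝ) : ℝ :=
  ∑ j, edgeSide V j u s * (edgeSet V j u s).indicator 1 τ

lemma edgeSide_neg (V : Fin 3 → ℂ) (j : Fin 3) (u : ℂ) (s : ℝ) :
    edgeSide V j (-u) (-s) = -edgeSide V j u s := by
  simp [edgeSide]

lemma edgeSet_neg (V : Fin 3 → ℂ) (j : Fin 3) (u : ℂ) (s τ : ℝ) :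
    -τ ∈ edgeSet V j (-u) (-s) ↔ τ ∈ edgeSet V j u s := by
  simp [edgeSet, linePt_neg]

lemma jump_neg (V : Fin 3 → ℂ) (u : ℂ) (s τ : ℝ) :
    jump V (-u) (-s) (-τ) = - jump V u s τ := by
  simp only [jump, ← Finset.sum_neg_distrib, edgeSide_neg]
  refine Finset.sum_congr rfl fun j _ => ?_
  have := edgeSet_neg V j u s τ
  by_cases h : τ ∈ edgeSet V j u s
  · simp [this.2 h, h]
  · simp [h, mt this.1 h]

lemma edgeSide_eq_zero {V : Fin 3 → ℂ} {j : Fin 3} {u : ℂ} {s : ℝ}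
    (h1 : ¬ (edgeDir V j = u ∧ edgeOff V j = s))
    (h2 : ¬ (edgeDir V j = -u ∧ edgeOff V j = -s)) : edgeSide V j u s = 0 := by
  simp [edgeSide, h1, h2]

/-- The points of a line that lie on an edge not parallel to it. -/
def badSet (V : Fin 3 → ℂ) (u : ℂ) (s : ℝ) : Set ℝ :=
  {τ | ∃ j, cross (edgeDir V j) u ≠ 0 ∧ cross (edgeDir V j) (linePt u s τ 0) = edgeOff V j}

lemma badSet_finite (V : Fin 3 → ℂ) (u : ℂ) (s : ℝ) : (badSet V u s).Finite := by
  have : badSet V u s = ⋃ j, {τ | cross (edgeDir V j) u ≠ 0 ∧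
      cross (edgeDir V j) (linePt u s τ 0) = edgeOff V j} := by
    ext τ; simp [badSet]
  rw [this]
  refine Set.finite_iUnion fun j => Set.Subsingleton.finite ?_
  rintro τ ⟨h1, h2⟩ τ' ⟨_, h3⟩
  rw [cross_linePt] at h2 h3
  have : (τ - τ') * cross (edgeDir V j) u = 0 := by linarith
  rcases mul_eq_zero.1 this with h | h
  · linarith
  · exact absurd h h1

/-- `p` records whether the points of a line directly to the left of position `τ` belong to
the triangle `V`. -/
def LocalSide (V : Fin 3 → ℂ) (u : ℂ) (s τ : ℝ) (p : ℝ) : Prop :=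
  (p = 1 ∧ ∀ᶠ ε in 𝓝[>] (0 : ℝ), linePt u s τ ε ∈ openTri V) ∨
  (p = 0 ∧ ∀ᶠ ε in 𝓝[>] (0 : ℝ), linePt u s τ ε ∉ closedTri V)

lemma continuous_height (d u : ℂ) (s τ o : ℝ) :
    Continuous fun ε => cross d (linePt u s τ ε) - o := by
  simp only [cross_linePt]
  fun_prop

lemma eventually_pos_height {d u : ℂ} {s τ o : ℝ} (h : 0 < cross d (linePt u s τ 0) - o) :
    ∀ᶠ ε in 𝓝 (0 : ℝ), 0 < cross d (linePt u s τ ε) - o :=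
  (continuous_height d u s τ o).continuousAt.eventually (lt_mem_nhds h)

lemma eventually_neg_height {d u : ℂ} {s τ o : ℝ} (h : cross d (linePt u s τ 0) - o < 0) :
    ∀ᶠ ε in 𝓝 (0 : ℝ), cross d (linePt u s τ ε) - o < 0 :=
  (continuous_height d u s τ o).continuousAt.eventually (gt_mem_nhds h)

/-- If `τ` is not on the boundary, both sides of the line are alike near `τ`. -/
lemma localSide_of_no_edge {V : Fin 3 → ℂ} (hV : area₂ V ≠ 0) {u : ℂ} {s τ : ℝ}
    (h : ∀ j, cross (edgeDir V j) (linePt u s τ 0) - edgeOff V j ≠ 0) :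
    ∃ p, LocalSide V u s τ p ∧ LocalSide V (-u) (-s) (-τ) p := by
  have hneg : Tendsto (fun ε : ℝ => -ε) (𝓝[>] 0) (𝓝 0) := by
    have : Tendsto (fun ε : ℝ => -ε) (𝓝 0) (𝓝 (-0)) := continuous_neg.tendsto 0
    rw [neg_zero] at this
    exact this.mono_left nhdsWithin_le_nhds
  by_cases hp : ∀ j, 0 < cross (edgeDir V j) (linePt u s τ 0) - edgeOff V j
  · have h1 : ∀ᶠ ε in 𝓝 (0 : ℝ), linePt u s τ ε ∈ openTri V := by
      simp only [mem_openTri hV]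
      exact eventually_all.2 fun j => eventually_pos_height (hp j)
    refine ⟨1, Or.inl ⟨rfl, h1.filter_mono nhdsWithin_le_nhds⟩, Or.inl ⟨rfl, ?_⟩⟩
    simp only [linePt_neg]
    exact hneg.eventually h1
  · push Not at hp
    obtain ⟨j, hj⟩ := hp
    have h1 : ∀ᶠ ε in 𝓝 (0 : ℝ), linePt u s τ ε ∉ closedTri V := by
      filter_upwards [eventually_neg_height (lt_of_le_of_ne hj (h j))] with ε hε hmem
      exact absurd ((mem_closedTri hV _).1 hmem j) (not_le.2 hε)
    refine ⟨0, Or.inr ⟨rfl, h1.filter_mono nhdsWithin_le_nhds⟩, Or.inr ⟨rfl, ?_⟩⟩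
    simp only [linePt_neg]
    exact hneg.eventually h1

/-- On an edge, the left side is inside the triangle and the right side outside. -/
lemma localSide_of_edge {V : Fin 3 → ℂ} (hV : area₂ V ≠ 0) {u : ℂ} (hu : ‖u‖ = 1) {s τ : ℝ}
    {j : Fin 3} (hd : edgeDir V j = u) (ho : edgeOff V j = s) (hτ : τ ∉ badSet V u s) :
    LocalSide V u s τ (jump V u s τ) ∧ LocalSide V (-u) (-s) (-τ) 0 := by
  have hheight : ∀ ε, cross (edgeDir V j) (linePt u s τ ε) - edgeOff V j = ε := by
    intro ε
    rw [cross_linePt, hd, ho, cross_self, cross_I_mul hu]; ring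
  have hcr : ∀ k, k ≠ j → cross (edgeDir V k) u ≠ 0 := by
    intro k hk
    rw [← hd]; exact cross_edgeDir_ne_zero hV hk
  have hne : ∀ k, k ≠ j → cross (edgeDir V k) (linePt u s τ 0) - edgeOff V k ≠ 0 := by
    intro k hk h
    exact hτ ⟨k, hcr k hk, by linarith⟩
  have hside : ∀ k, k ≠ j → edgeSide V k u s = 0 := by
    intro k hk
    refine edgeSide_eq_zero (fun h => hcr k hk ?_) (fun h => hcr k hk ?_)
    · rw [h.1, cross_self]
    · rw [h.1, cross_neg_left, cross_self, neg_zero]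
  have hsj : edgeSide V j u s = 1 := by
    have hu0 : u ≠ -u := by
      intro h
      have : u = 0 := self_eq_neg.1 h
      rw [this] at hu; simp at hu
    simp [edgeSide, hd, ho, hu0]
  have hjump : jump V u s τ = (edgeSet V j u s).indicator 1 τ := by
    rw [jump, Finset.sum_eq_single j, hsj, one_mul]
    · intro k _ hk; rw [hside k hk, zero_mul]
    · simp
  have hmem : (∀ k, k ≠ j → 0 < cross (edgeDir V k) (linePt u s τ 0) - edgeOff V k) ↔
      τ ∈ edgeSet V j u s :=
    pos_others_iff hV j (by have := hheight 0; linarith)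
  constructor
  · by_cases hp : τ ∈ edgeSet V j u s
    · left
      refine ⟨by rw [hjump]; simp [hp], ?_⟩
      simp only [mem_openTri hV]
      refine eventually_all.2 fun k => ?_
      by_cases hk : k = j
      · subst hk
        simp only [hheight]
        exact eventually_mem_nhdsWithin
      · exact (eventually_pos_height (hmem.2 hp k hk)).filter_mono nhdsWithin_le_nhds
    · right
      refine ⟨by rw [hjump]; simp [hp], ?_⟩
      rw [← hmem] at hp
      push Not at hp
      obtain ⟨k, hk, hk'⟩ := hp
      filter_upwards [(eventually_neg_height (lt_of_le_of_ne hk' (hne k hk))).filter_mono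
        nhdsWithin_le_nhds] with ε hε hm
      exact absurd ((mem_closedTri hV _).1 hm k) (not_le.2 hε)
  · right
    refine ⟨rfl, ?_⟩
    filter_upwards [eventually_mem_nhdsWithin] with ε hε hm
    have := (mem_closedTri hV _).1 hm j
    rw [linePt_neg, hheight] at this
    have hε' : 0 < ε := hε
    linarith

/-- Away from finitely many points, the indicator function of a triangle has one-sided limits at
a line, and their difference is `jump`. -/
lemma exists_localSide {V : Fin 3 → ℂ} (hV : area₂ V ≠ 0) {u : ℂ} (hu : ‖u‖ = 1) {s τ : ℝ}
    (hτ : τ ∉ badSet V u s) :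
    ∃ p m, LocalSide V u s τ p ∧ LocalSide V (-u) (-s) (-τ) m ∧ p - m = jump V u s τ := by
  by_cases h1 : ∃ j, edgeDir V j = u ∧ edgeOff V j = s
  · obtain ⟨j, hd, ho⟩ := h1
    obtain ⟨hp, hm⟩ := localSide_of_edge hV hu hd ho hτ
    exact ⟨_, _, hp, hm, sub_zero _⟩
  by_cases h2 : ∃ j, edgeDir V j = -u ∧ edgeOff V j = -s
  · obtain ⟨j, hd, ho⟩ := h2
    have hτ' : -τ ∉ badSet V (-u) (-s) := by
      rintro ⟨k, hk, hk'⟩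
      refine hτ ⟨k, ?_, ?_⟩
      · simpa [cross_neg_right] using hk
      · rwa [linePt_neg, neg_zero] at hk'
    obtain ⟨hp, hm⟩ := localSide_of_edge hV (by rwa [norm_neg]) hd ho hτ'
    rw [jump_neg] at hp
    simp only [neg_neg] at hm
    exact ⟨_, _, hm, hp, by ring⟩
  push Not at h1 h2
  have hj : jump V u s τ = 0 := by
    refine Finset.sum_eq_zero fun j _ => ?_
    rw [edgeSide_eq_zero (by simpa using h1 j) (by simpa using h2 j), zero_mul]
  have hne : ∀ j, cross (edgeDir V j) (linePt u s τ 0) - edgeOff V j ≠ 0 := by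
    intro j h
    by_cases hc : cross (edgeDir V j) u = 0
    · rcases eq_or_eq_neg_of_cross_eq_zero (norm_edgeDir hV j) hu hc with hd | hd
      · apply h1 j hd
        rw [hd, cross_linePt, cross_self, cross_I_mul hu] at h; linarith
      · apply h2 j hd
        rw [hd, cross_linePt, cross_neg_left, cross_neg_left, cross_self, cross_I_mul hu] at h
        linarith
    · exact hτ ⟨j, hc, by linarith⟩
  obtain ⟨p, hp, hm⟩ := localSide_of_no_edge hV hne
  exact ⟨p, p, hp, hm, by rw [hj, sub_self]⟩

/-- Near a point, exactly one tile lies on a given side if the big triangle does, and none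
otherwise. -/
lemma sum_localSide {ι : Type*} [Fintype ι] {W : Fin 3 → ℂ} {V : ι → Fin 3 → ℂ}
    (h : IsTiling W V) {u : ℂ} {s τ : ℝ} {p : ι → ℝ} {q : ℝ}
    (hp : ∀ i, LocalSide (V i) u s τ (p i)) (hq : LocalSide W u s τ q) : ∑ i, p i = q := by
  have hsub : ∀ i, closedTri (V i) ⊆ closedTri W := fun i =>
    h.cover ▸ Set.subset_iUnion (fun i => closedTri (V i)) i
  rcases hq with ⟨rfl, hq⟩ | ⟨rfl, hq⟩
  · have hall : ∀ᶠ ε in 𝓝[>] (0 : ℝ), ∀ i, (p i = 1 ∧ linePt u s τ ε ∈ openTri (V i)) ∨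
        (p i = 0 ∧ linePt u s τ ε ∉ closedTri (V i)) := by
      refine eventually_all.2 fun i => ?_
      rcases hp i with ⟨h1, h2⟩ | ⟨h1, h2⟩
      · exact h2.mono fun ε hε => Or.inl ⟨h1, hε⟩
      · exact h2.mono fun ε hε => Or.inr ⟨h1, hε⟩
    obtain ⟨ε, hε, hεq⟩ := (hall.and hq).exists
    have : linePt u s τ ε ∈ ⋃ i, closedTri (V i) := by
      rw [h.cover]; exact openTri_subset_closedTri _ hεq
    obtain ⟨i, hi⟩ := Set.mem_iUnion.1 this
    have hi1 : p i = 1 ∧ linePt u s τ ε ∈ openTri (V i) := by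
      rcases hε i with h1 | h1
      · exact h1
      · exact absurd hi h1.2
    rw [Finset.sum_eq_single i, hi1.1]
    · intro k _ hk
      rcases hε k with h1 | h1
      · exact absurd h1.2 (Set.disjoint_right.1 (h.disj hk) hi1.2)
      · exact h1.1
    · simp
  · refine Finset.sum_eq_zero fun i _ => ?_
    rcases hp i with ⟨_, h2⟩ | ⟨h1, _⟩
    · obtain ⟨ε, hε, hεq⟩ := (h2.and hq).exists
      exact absurd (hsub i (openTri_subset_closedTri _ hε)) hεq
    · exact h1

lemma sum_jump {ι : Type*} [Fintype ι] {W : Fin 3 → ℂ} {V : ι → Fin 3 → ℂ}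
    (h : IsTiling W V) {u : ℂ} (hu : ‖u‖ = 1) {s τ : ℝ}
    (hV : ∀ i, τ ∉ badSet (V i) u s) (hW : τ ∉ badSet W u s) :
    ∑ i, jump (V i) u s τ = jump W u s τ := by
  choose p m hp hm hpm using fun i => exists_localSide (h.area_ne' i) hu (hV i)
  obtain ⟨q, q', hq, hq', hqq⟩ := exists_localSide h.area_ne hu hW
  rw [← hqq, ← sum_localSide h hp hq, ← sum_localSide h hm hq', ← Finset.sum_sub_distrib]
  exact Finset.sum_congr rfl fun i _ => (hpm i).symm

lemma edgeSet_eq_Ioo {V : Fin 3 → ℂ} (hV : area₂ V ≠ 0) {j : Fin 3} {u : ℂ} (hu : ‖u‖ = 1) {s : ℝ}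
    (h : edgeSide V j u s ≠ 0) : ∃ x, edgeSet V j u s = Set.Ioo x (x + edgeLen V j) := by
  have hl := edgeLen_pos hV j
  have h1 : u.re ^ 2 + u.im ^ 2 = 1 := by
    have := Complex.sq_norm u; rw [hu, Complex.normSq_apply] at this; linarith
  have hd : ∃ σ : ℝ, (σ = 1 ∨ σ = -1) ∧ edgeDir V j = σ * u := by
    by_contra hcon
    push Not at hcon
    refine h (edgeSide_eq_zero (fun h => hcon 1 (Or.inl rfl) ?_)
      (fun h => hcon (-1) (Or.inr rfl) ?_))
    · simp [h.1]
    · simp [h.1]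
  obtain ⟨σ, hσ, hd⟩ := hd
  obtain ⟨c, hc⟩ : ∃ c, ∀ τ, edgePos V j (linePt u s τ 0) = σ * (τ - c) := by
    refine ⟨u.re * (V j).re + u.im * (V j).im, fun τ => ?_⟩
    rw [edgePos, hd]
    simp [linePt]
    linear_combination σ * τ * h1
  have hs : (SignType.sign (area₂ V) : ℝ) = 1 ∨ (SignType.sign (area₂ V) : ℝ) = -1 := by
    rcases lt_or_gt_of_ne hV with h' | h' <;> simp [h']
  obtain ⟨σ', hσ', hc'⟩ : ∃ σ' : ℝ, (σ' = 1 ∨ σ' = -1) ∧ ∀ τ,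
      (SignType.sign (area₂ V) : ℝ) * edgePos V j (linePt u s τ 0) = σ' * (τ - c) := by
    refine ⟨SignType.sign (area₂ V) * σ, ?_, fun τ => by rw [hc]; ring⟩
    rcases hs with h | h <;> rcases hσ with h' | h' <;> simp [h, h']
  simp only [edgeSet, hc', Set.mem_Ioo, div_pos_iff_of_pos_right hl, div_lt_one hl]
  rcases hσ' with rfl | rfl
  · refine ⟨c, Set.ext fun τ => ?_⟩
    simp only [Set.mem_ofPred_eq, Set.mem_Ioo]
    constructor <;> rintro ⟨h1, h2⟩ <;> constructor <;> linarith
  · refine ⟨c - edgeLen V j, Set.ext fun τ => ?_⟩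
    simp only [Set.mem_ofPred_eq, Set.mem_Ioo]
    constructor <;> rintro ⟨h1, h2⟩ <;> constructor <;> linarith

lemma integrable_edge {V : Fin 3 → ℂ} (hV : area₂ V ≠ 0) (j : Fin 3) {u : ℂ} (hu : ‖u‖ = 1)
    (s : ℝ) : Integrable (fun τ => edgeSide V j u s * (edgeSet V j u s).indicator 1 τ) ∧
      ∫ τ, edgeSide V j u s * (edgeSet V j u s).indicator 1 τ = edgeSide V j u s * edgeLen V j := by
  by_cases h : edgeSide V j u s = 0
  · simp [h]
  · obtain ⟨x, hx⟩ := edgeSet_eq_Ioo hV hu h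
    rw [hx]
    constructor
    · refine Integrable.const_mul ?_ _
      exact (integrable_indicator_iff measurableSet_Ioo).2 (integrableOn_const (by simp))
    · rw [integral_const_mul, integral_indicator_one measurableSet_Ioo]
      simp [(edgeLen_pos hV j).le]

lemma integral_jump {V : Fin 3 → ℂ} (hV : area₂ V ≠ 0) {u : ℂ} (hu : ‖u‖ = 1) (s : ℝ) :
    Integrable (jump V u s) ∧ ∫ τ, jump V u s τ = ∑ j, edgeSide V j u s * edgeLen V j := by
  constructor
  · exact integrable_finsetSum _ fun j _ => (integrable_edge hV j hu s).1
  · simp only [jump]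
    rw [integral_finsetSum _ fun j _ => (integrable_edge hV j hu s).1]
    exact Finset.sum_congr rfl fun j _ => (integrable_edge hV j hu s).2

/-- In a tiling, the signed lengths of the edges lying on a fixed line add up to the signed length
of the part of the boundary of the big triangle on that line: whatever is inside cancels. -/
theorem IsTiling.sum_edgeSide {ι : Type*} [Fintype ι] {W : Fin 3 → ℂ} {V : ι → Fin 3 → ℂ}
    (h : IsTiling W V) {u : ℂ} (hu : ‖u‖ = 1) (s : ℝ) :
    ∑ i, ∑ j, edgeSide (V i) j u s * edgeLen (V i) j = ∑ j, edgeSide W j u s * edgeLen W j := by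
  rw [← (integral_jump h.area_ne hu s).2]
  simp only [← fun i => (integral_jump (h.area_ne' i) hu s).2]
  rw [← integral_finsetSum _ fun i _ => (integral_jump (h.area_ne' i) hu s).1]
  refine integral_congr_ae ?_
  have hfin : ((⋃ i, badSet (V i) u s) ∪ badSet W u s).Finite :=
    (Set.finite_iUnion fun i => badSet_finite _ _ _).union (badSet_finite _ _ _)
  have := hfin.measure_zero (volume : Measure ℝ)
  filter_upwards [measure_eq_zero_iff_ae_notMem.1 this] with τ hτ
  simp only [Set.mem_union, Set.mem_iUnion, not_or, not_exists] at hτ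
  exact sum_jump h hu hτ.1 hτ.2

/-- In a sum over oriented lines, every edge occurs once with each orientation. -/
lemma sum_lines_edgeSide (V : Fin 3 → ℂ) (j : Fin 3) (E : Finset (ℂ × ℝ))
    (F : ℂ → ℝ → ℝ) (hF : ∀ u s, F (-u) (-s) = -F u s)
    (h1 : (edgeDir V j, edgeOff V j) ∈ E) (h2 : (-edgeDir V j, -edgeOff V j) ∈ E) :
    ∑ x ∈ E, F x.1 x.2 * edgeSide V j x.1 x.2 = 2 * F (edgeDir V j) (edgeOff V j) := by
  classical
  have e : ∀ x : ℂ × ℝ, edgeSide V j x.1 x.2 =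
      (if x = (edgeDir V j, edgeOff V j) then 1 else 0) -
        (if x = (-edgeDir V j, -edgeOff V j) then 1 else 0) := by
    rintro ⟨u, s⟩
    simp only [edgeSide, Prod.mk.injEq]
    congr 1
    · simp only [eq_comm]
    · simp only [eq_comm (a := u), eq_comm (a := s), neg_eq_iff_eq_neg]
  simp only [e, mul_sub, Finset.sum_sub_distrib, mul_ite, mul_one, mul_zero,
    Finset.sum_ite_eq', h1, h2, if_true, hF]
  ring

/-- The invariants of a tiling: for every function `F` of oriented lines that changes sign when
the orientation is reversed, the sum of `length * F` over the oriented boundary is additive. -/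
theorem IsTiling.sum_odd {ι : Type*} [Fintype ι] {W : Fin 3 → ℂ} {V : ι → Fin 3 → ℂ}
    (h : IsTiling W V) (F : ℂ → ℝ → ℝ) (hF : ∀ u s, F (-u) (-s) = -F u s) :
    ∑ i, ∑ j, edgeLen (V i) j * F (edgeDir (V i) j) (edgeOff (V i) j) =
      ∑ j, edgeLen W j * F (edgeDir W j) (edgeOff W j) := by
  classical
  let T : Option ι → Fin 3 → ℂ := fun o => o.elim W V
  let E₀ : Finset (ℂ × ℝ) :=
    Finset.univ.image fun x : Option ι × Fin 3 => (edgeDir (T x.1) x.2, edgeOff (T x.1) x.2)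
  let E : Finset (ℂ × ℝ) := E₀ ∪ E₀.image fun x => -x
  have hT : ∀ o j, (edgeDir (T o) j, edgeOff (T o) j) ∈ E₀ := fun o j =>
    Finset.mem_image.2 ⟨(o, j), Finset.mem_univ _, rfl⟩
  have hT' : ∀ o j, (-edgeDir (T o) j, -edgeOff (T o) j) ∈ E := fun o j =>
    Finset.mem_union_right _ (Finset.mem_image.2 ⟨_, hT o j, rfl⟩)
  have hne : ∀ o, area₂ (T o) ≠ 0 := by
    intro o; cases o
    · exact h.area_ne
    · exact h.area_ne' _
  have hnorm : ∀ x ∈ E, ‖x.1‖ = 1 := by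
    intro x hx
    have h0 : ∀ x ∈ E₀, ‖x.1‖ = 1 := by
      intro x hx
      obtain ⟨y, _, rfl⟩ := Finset.mem_image.1 hx
      exact norm_edgeDir (hne y.1) y.2
    rcases Finset.mem_union.1 hx with hx | hx
    · exact h0 x hx
    · obtain ⟨y, hy, rfl⟩ := Finset.mem_image.1 hx
      simpa using h0 y hy
  have hone : ∀ o, ∑ x ∈ E, F x.1 x.2 * ∑ j, edgeSide (T o) j x.1 x.2 * edgeLen (T o) j =
      2 * ∑ j, edgeLen (T o) j * F (edgeDir (T o) j) (edgeOff (T o) j) := by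
    intro o
    simp only [Finset.mul_sum]
    rw [Finset.sum_comm]
    refine Finset.sum_congr rfl fun j _ => ?_
    simp only [← mul_assoc]
    rw [← Finset.sum_mul, sum_lines_edgeSide (T o) j E F hF
      (Finset.mem_union_left _ (hT o j)) (hT' o j)]
    ring
  have hsum : ∑ i, ∑ x ∈ E, F x.1 x.2 * ∑ j, edgeSide (V i) j x.1 x.2 * edgeLen (V i) j =
      ∑ x ∈ E, F x.1 x.2 * ∑ j, edgeSide W j x.1 x.2 * edgeLen W j := by
    rw [Finset.sum_comm]
    refine Finset.sum_congr rfl fun x hx => ?_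
    rw [← Finset.mul_sum, h.sum_edgeSide (hnorm x hx)]
  have hW : ∑ x ∈ E, F x.1 x.2 * ∑ j, edgeSide W j x.1 x.2 * edgeLen W j =
      2 * ∑ j, edgeLen W j * F (edgeDir W j) (edgeOff W j) := hone none
  have hV : ∀ i, ∑ x ∈ E, F x.1 x.2 * ∑ j, edgeSide (V i) j x.1 x.2 * edgeLen (V i) j =
      2 * ∑ j, edgeLen (V i) j * F (edgeDir (V i) j) (edgeOff (V i) j) := fun i => hone (some i)
  rw [hW, Finset.sum_congr rfl (fun i _ => hV i), ← Finset.mul_sum] at hsum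
  linarith

end Tiling

/-! ### Edge directions of the tiles: area and perimeter -/

namespace Tiling

open Filter Topology MeasureTheory

/-- The primitive sixth root of unity `exp (i π / 3)`. -/
noncomputable def ω : ℂ := ⟨1 / 2, √3 / 2⟩

/-- The equilateral triangle of side one, with vertices `0`, `1` and `ω`. -/
noncomputable def unitTri : Fin 3 → ℂ := ![0, 1, ω]

/-- `a`, `b`, `c` are the sides of a triangle with an angle `π / 3` between `a` and `b`. -/
structure IsShape (a b c : ℝ) : Prop where
  pos_a : 0 < a
  pos_b : 0 < b
  pos_c : 0 < c
  law : c ^ 2 = a ^ 2 + b ^ 2 - a * b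

/-- The triangle `V` has sides `a`, `b`, `c`, the first two being those at the vertex `V 0`. -/
structure IsTile (a b c : ℝ) (V : Fin 3 → ℂ) : Prop where
  len_a : ‖V 1 - V 0‖ = a
  len_b : ‖V 2 - V 0‖ = b
  len_c : ‖V 2 - V 1‖ = c

/-- The unit complex number whose argument is the angle of the triangle between the
sides `b` and `c`. -/
noncomputable def rot (a b c : ℝ) : ℂ := (b - a * (starRingEnd ℂ) ω) / c

lemma sqrt3_sq : √3 * √3 = 3 := Real.mul_self_sqrt (by norm_num)

lemma ω_sq : ω ^ 2 = ω - 1 := by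
  have := sqrt3_sq
  apply Complex.ext <;> simp [ω, pow_two] <;> linarith

lemma ω_cube : ω ^ 3 = -1 := by
  linear_combination (ω + 1) * ω_sq

lemma ω_ne_zero : ω ≠ 0 := by
  intro h
  have := ω_cube
  rw [h] at this
  norm_num at this

lemma conj_ω : (starRingEnd ℂ) ω = 1 - ω := by
  apply Complex.ext <;> simp [ω]; norm_num

lemma conj_ω_eq_inv : (starRingEnd ℂ) ω = ω⁻¹ := by
  rw [conj_ω]
  field_simp [ω_ne_zero]
  linear_combination -ω_sq

lemma conj_rot (a b c : ℝ) : (starRingEnd ℂ) (rot a b c) = (b - a * ω) / c := by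
  simp [rot]

lemma normSq_rot {a b c : ℝ} (h : IsShape a b c) :
    rot a b c * (starRingEnd ℂ) (rot a b c) = 1 := by
  have hc : (c : ℂ) ≠ 0 := by exact_mod_cast h.pos_c.ne'
  have hl : (c : ℂ) ^ 2 = a ^ 2 + b ^ 2 - a * b := by exact_mod_cast h.law
  rw [conj_rot, rot, conj_ω]
  field_simp
  linear_combination -hl - (a : ℂ) ^ 2 * ω_sq

lemma rot_ne_zero {a b c : ℝ} (h : IsShape a b c) : rot a b c ≠ 0 := by
  intro h0
  have := normSq_rot h
  rw [h0] at this
  simp at this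

lemma conj_rot_eq_inv {a b c : ℝ} (h : IsShape a b c) :
    (starRingEnd ℂ) (rot a b c) = (rot a b c)⁻¹ :=
  eq_inv_of_mul_eq_one_right (normSq_rot h)

/-- A tile is determined by its `π / 3` vertex, a direction `g` and its orientation. -/
lemma IsTile.exists_dir {a b c : ℝ} (h : IsShape a b c) {V : Fin 3 → ℂ} (hV : IsTile a b c V) :
    ∃ g : ℂ, ‖g‖ = 1 ∧ V 1 = V 0 + a * g ∧
      (V 2 = V 0 + b * (g * ω) ∨ V 2 = V 0 + b * (g * (starRingEnd ℂ) ω)) := by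
  have ha := h.pos_a
  have hb := h.pos_b
  have hac : (a : ℂ) ≠ 0 := by exact_mod_cast ha.ne'
  have hbc : (b : ℂ) ≠ 0 := by exact_mod_cast hb.ne'
  set g : ℂ := (V 1 - V 0) / a with hg
  have hgn : ‖g‖ = 1 := by
    rw [hg, norm_div, hV.len_a, Complex.norm_real, Real.norm_eq_abs, abs_of_pos ha, div_self ha.ne']
  have hg0 : g ≠ 0 := by
    intro h; rw [h] at hgn; simp at hgn
  have h1 : V 1 = V 0 + a * g := by rw [hg]; field_simp; ring
  set z : ℂ := (V 2 - V 0) / (b * g) with hz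
  have h2 : V 2 = V 0 + b * (g * z) := by rw [hz]; field_simp; ring
  have hzn : ‖z‖ = 1 := by
    rw [hz, norm_div, norm_mul, hV.len_b, hgn, Complex.norm_real, Real.norm_eq_abs, abs_of_pos hb,
      mul_one, div_self hb.ne']
  have h3 : ‖(b : ℂ) * z - a‖ = c := by
    have : V 2 - V 1 = g * (b * z - a) := by rw [h1, h2]; ring
    rw [← hV.len_c, this, norm_mul, hgn, one_mul]
  have e1 : z.re ^ 2 + z.im ^ 2 = 1 := by
    have := Complex.sq_norm z; rw [hzn, Complex.normSq_apply] at this; linarith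
  have e2 : (b * z.re - a) ^ 2 + (b * z.im) ^ 2 = c ^ 2 := by
    have := Complex.sq_norm ((b : ℂ) * z - a); rw [h3, Complex.normSq_apply] at this
    simp at this; linarith
  have e3 : z.re = 1 / 2 := by
    have : (a * b) * (z.re - 1 / 2) = 0 := by
      rw [h.law] at e2; linear_combination (-1 / 2) * e2 + b ^ 2 / 2 * e1
    rcases mul_eq_zero.1 this with h | h
    · exact absurd h (mul_pos ha hb).ne'
    · linarith
  have e4 : (z.im - √3 / 2) * (z.im + √3 / 2) = 0 := by
    rw [e3] at e1; linear_combination e1 - sqrt3_sq / 4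
  refine ⟨g, hgn, h1, ?_⟩
  rcases mul_eq_zero.1 e4 with h | h
  · left
    rw [h2]; congr 3
    apply Complex.ext <;> simp [ω] <;> linarith
  · right
    rw [h2]; congr 3
    apply Complex.ext <;> simp [ω] <;> linarith

/-- The numbers `ζ ^ k * ω ^ m` with `k + m` even (`e = 0`) or odd (`e = 1`). -/
def ParityClass (ζ : ℂ) (e : ℤ) (z : ℂ) : Prop :=
  ∃ k m : ℤ, z = ζ ^ k * ω ^ m ∧ Even (k + m + e)

/-- The subgroup generated by `ζ` and `ω`. -/
def InDirGroup (ζ z : ℂ) : Prop := ∃ k m : ℤ, z = ζ ^ k * ω ^ m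

open Classical in
/-- The character `ζ ^ k * ω ^ m ↦ (-1) ^ (k + m)`, extended by zero. If `ζ` is a root of unity, the
parity classes may overlap, and then the value is zero. -/
noncomputable def dirSign (ζ z : ℂ) : ℤ :=
  (if ParityClass ζ 0 z then 1 else 0) - (if ParityClass ζ 1 z then 1 else 0)

lemma parityClass_add_two {ζ : ℂ} {e : ℤ} {z : ℂ} :
    ParityClass ζ (e + 2) z ↔ ParityClass ζ e z := by
  have : ∀ k m : ℤ, Even (k + m + (e + 2)) ↔ Even (k + m + e) := by
    intro k m; rw [← add_assoc, Int.even_add]; simp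
  simp only [ParityClass, this]

lemma parityClass_ω_mul {ζ : ℂ} {e : ℤ} {z : ℂ} :
    ParityClass ζ e (ω * z) ↔ ParityClass ζ (e + 1) z := by
  constructor
  · rintro ⟨k, m, h, h'⟩
    refine ⟨k, m - 1, ?_, by convert h' using 1; ring⟩
    rw [zpow_sub_one₀ ω_ne_zero, ← mul_assoc, ← h]
    field_simp [ω_ne_zero]
  · rintro ⟨k, m, h, h'⟩
    refine ⟨k, m + 1, ?_, by convert h' using 1; ring⟩
    rw [zpow_add_one₀ ω_ne_zero, h]; ring

lemma parityClass_ζ_mul {ζ : ℂ} (hζ : ζ ≠ 0) {e : ℤ} {z : ℂ} :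
    ParityClass ζ e (ζ * z) ↔ ParityClass ζ (e + 1) z := by
  constructor
  · rintro ⟨k, m, h, h'⟩
    refine ⟨k - 1, m, ?_, by convert h' using 1; ring⟩
    rw [zpow_sub_one₀ hζ, mul_right_comm, ← h]
    field_simp
  · rintro ⟨k, m, h, h'⟩
    refine ⟨k + 1, m, ?_, by convert h' using 1; ring⟩
    rw [zpow_add_one₀ hζ, h]; ring

lemma dirSign_ω_mul (ζ z : ℂ) : dirSign ζ (ω * z) = -dirSign ζ z := by
  have h0 : ParityClass ζ 0 (ω * z) ↔ ParityClass ζ 1 z := parityClass_ω_mul (e := 0)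
  have h1 : ParityClass ζ 1 (ω * z) ↔ ParityClass ζ 0 z :=
    parityClass_ω_mul.trans (parityClass_add_two (e := 0))
  by_cases p : ParityClass ζ 0 z <;> by_cases q : ParityClass ζ 1 z <;> simp [dirSign, h0, h1, p, q]

lemma dirSign_ζ_mul {ζ : ℂ} (hζ : ζ ≠ 0) (z : ℂ) : dirSign ζ (ζ * z) = -dirSign ζ z := by
  have h0 : ParityClass ζ 0 (ζ * z) ↔ ParityClass ζ 1 z := parityClass_ζ_mul hζ (e := 0)
  have h1 : ParityClass ζ 1 (ζ * z) ↔ ParityClass ζ 0 z :=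
    (parityClass_ζ_mul hζ).trans (parityClass_add_two (e := 0))
  by_cases p : ParityClass ζ 0 z <;> by_cases q : ParityClass ζ 1 z <;> simp [dirSign, h0, h1, p, q]

lemma dirSign_neg (ζ z : ℂ) : dirSign ζ (-z) = -dirSign ζ z := by
  have : -z = ω * (ω * (ω * z)) := by linear_combination -z * ω_cube
  rw [this, dirSign_ω_mul, dirSign_ω_mul, dirSign_ω_mul]; ring

lemma dirSign_ω_inv_mul (ζ z : ℂ) : dirSign ζ (ω⁻¹ * z) = -dirSign ζ z := by
  have := dirSign_ω_mul ζ (ω⁻¹ * z)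
  rw [mul_inv_cancel_left₀ ω_ne_zero] at this
  rw [this, neg_neg]

lemma dirSign_ζ_inv_mul {ζ : ℂ} (hζ : ζ ≠ 0) (z : ℂ) : dirSign ζ (ζ⁻¹ * z) = -dirSign ζ z := by
  have := dirSign_ζ_mul hζ (ζ⁻¹ * z)
  rw [mul_inv_cancel_left₀ hζ] at this
  rw [this, neg_neg]

/-- If `ζ` is not a root of unity, the two parity classes are disjoint. -/
lemma dirSign_one {ζ : ℂ} (hroot : ∀ n : ℕ, 0 < n → ζ ^ n ≠ 1) :
    dirSign ζ 1 = 1 := by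
  have h0 : ParityClass ζ 0 1 := ⟨0, 0, by simp, by simp⟩
  have h1 : ¬ ParityClass ζ 1 1 := by
    rintro ⟨k, m, h, h'⟩
    have hω6 : ω ^ 6 = 1 := by
      have := ω_cube
      linear_combination (ω ^ 3 - 1) * this
    have e : ζ ^ (6 * k) = 1 := by
      have : (ζ ^ k * ω ^ m) ^ (6 : ℤ) = 1 := by rw [← h]; simp
      rw [mul_zpow, ← zpow_mul, ← zpow_mul, mul_comm m 6, zpow_mul ω] at this
      rw [show ω ^ (6 : ℤ) = 1 by exact_mod_cast hω6, one_zpow, mul_one] at this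
      rwa [mul_comm 6 k]
    have hk : k = 0 := by
      by_contra hk
      have h6 : 0 < (6 * k).natAbs := Int.natAbs_pos.2 (by omega)
      apply hroot _ h6
      rcases Int.natAbs_eq (6 * k) with h7 | h7
      · rw [h7] at e; exact_mod_cast e
      · rw [h7, zpow_neg, inv_eq_one] at e; exact_mod_cast e
    subst hk
    rw [zpow_zero, one_mul] at h
    have hm : Odd m := by
      rw [zero_add] at h'
      rcases Int.even_or_odd m with h2 | h2
      · obtain ⟨x, hx⟩ := h2; obtain ⟨y, hy⟩ := h'; omega
      · exact h2
    have : (ω ^ (3 : ℤ)) ^ m = 1 := by rw [← zpow_mul, mul_comm, zpow_mul, ← h, one_zpow]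
    rw [show ω ^ (3 : ℤ) = -1 by exact_mod_cast ω_cube, hm.neg_one_zpow] at this
    norm_num at this
  simp [dirSign, h0, h1]

lemma inDirGroup_ω_mul {ζ z : ℂ} : InDirGroup ζ (ω * z) ↔ InDirGroup ζ z := by
  constructor
  · rintro ⟨k, m, h⟩
    refine ⟨k, m - 1, ?_⟩
    rw [zpow_sub_one₀ ω_ne_zero, ← mul_assoc, ← h]
    field_simp [ω_ne_zero]
  · rintro ⟨k, m, h⟩
    refine ⟨k, m + 1, ?_⟩
    rw [zpow_add_one₀ ω_ne_zero, h]; ring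

lemma inDirGroup_ζ_mul {ζ z : ℂ} (hζ : ζ ≠ 0) : InDirGroup ζ (ζ * z) ↔ InDirGroup ζ z := by
  constructor
  · rintro ⟨k, m, h⟩
    refine ⟨k - 1, m, ?_⟩
    rw [zpow_sub_one₀ hζ, mul_right_comm, ← h]
    field_simp
  · rintro ⟨k, m, h⟩
    refine ⟨k + 1, m, ?_⟩
    rw [zpow_add_one₀ hζ, h]; ring

lemma inDirGroup_neg {ζ z : ℂ} : InDirGroup ζ (-z) ↔ InDirGroup ζ z := by
  have : -z = ω * (ω * (ω * z)) := by linear_combination -z * ω_cube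
  rw [this, inDirGroup_ω_mul, inDirGroup_ω_mul, inDirGroup_ω_mul]

lemma inDirGroup_ω_inv_mul {ζ z : ℂ} : InDirGroup ζ (ω⁻¹ * z) ↔ InDirGroup ζ z := by
  rw [← inDirGroup_ω_mul, mul_inv_cancel_left₀ ω_ne_zero]

lemma inDirGroup_ζ_inv_mul {ζ z : ℂ} (hζ : ζ ≠ 0) :
    InDirGroup ζ (ζ⁻¹ * z) ↔ InDirGroup ζ z := by
  rw [← inDirGroup_ζ_mul hζ, mul_inv_cancel_left₀ hζ]

lemma cross_mul_left {g : ℂ} (hg : ‖g‖ = 1) (z w : ℂ) : cross (g * z) (g * w) = cross z w := by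
  have := Complex.sq_norm g; rw [hg, Complex.normSq_apply] at this
  simp [cross]
  linear_combination (z.im * w.re - z.re * w.im) * this

lemma area₂_direct {a b : ℝ} {V : Fin 3 → ℂ} {g : ℂ} (hg : ‖g‖ = 1) (h1 : V 1 = V 0 + a * g)
    (h2 : V 2 = V 0 + b * (g * ω)) : area₂ V = a * b * (√3 / 2) := by
  rw [area₂, h1, h2, add_sub_cancel_left, add_sub_cancel_left, cross_smul_left, cross_smul_right,
    ← mul_one g, mul_assoc, cross_mul_left hg]
  simp [cross, ω]; ring

lemma area₂_mirror {a b : ℝ} {V : Fin 3 → ℂ} {g : ℂ} (hg : ‖g‖ = 1) (h1 : V 1 = V 0 + a * g)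
    (h2 : V 2 = V 0 + b * (g * (starRingEnd ℂ) ω)) : area₂ V = -(a * b * (√3 / 2)) := by
  rw [area₂, h1, h2, add_sub_cancel_left, add_sub_cancel_left, cross_smul_left, cross_smul_right,
    ← mul_one g, mul_assoc, cross_mul_left hg]
  simp [cross, ω]; ring

lemma IsTile.abs_area₂ {a b c : ℝ} (h : IsShape a b c) {V : Fin 3 → ℂ} (hV : IsTile a b c V) :
    |area₂ V| = a * b * (√3 / 2) := by
  have hp : 0 < a * b * (√3 / 2) := mul_pos (mul_pos h.pos_a h.pos_b) (by positivity)
  obtain ⟨g, hg, h1, h2 | h2⟩ := hV.exists_dir h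
  · rw [area₂_direct hg h1 h2, abs_of_pos hp]
  · rw [area₂_mirror hg h1 h2, abs_neg, abs_of_pos hp]

lemma IsTile.edgeLen {a b c : ℝ} {V : Fin 3 → ℂ} (hV : IsTile a b c V) :
    edgeLen V 0 = a ∧ edgeLen V 1 = c ∧ edgeLen V 2 = b := by
  refine ⟨hV.len_a, hV.len_c, ?_⟩
  rw [← hV.len_b, norm_sub_rev]; rfl

/-- The three edge directions of a tile, up to sign, differ by elements of the group generated by
`ω` and `rot a b c` which lie in the same parity class. -/
lemma IsTile.edgeDir {a b c : ℝ} (h : IsShape a b c) {V : Fin 3 → ℂ} (hV : IsTile a b c V)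
    {g : ℂ} (hg : ‖g‖ = 1) (h1 : V 1 = V 0 + a * g)
    (h2 : V 2 = V 0 + b * (g * ω) ∨ V 2 = V 0 + b * (g * (starRingEnd ℂ) ω)) :
    (edgeDir V 0 = g ∧ edgeDir V 1 = ω * (rot a b c * g) ∧ edgeDir V 2 = -(ω * g)) ∨
      (edgeDir V 0 = -g ∧ edgeDir V 1 = -(ω⁻¹ * ((rot a b c)⁻¹ * g)) ∧
        edgeDir V 2 = ω⁻¹ * g) := by
  have hp : 0 < a * b * (√3 / 2) := mul_pos (mul_pos h.pos_a h.pos_b) (by positivity)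
  have ha : (a : ℂ) ≠ 0 := by exact_mod_cast h.pos_a.ne'
  have hb : (b : ℂ) ≠ 0 := by exact_mod_cast h.pos_b.ne'
  have hc : (c : ℂ) ≠ 0 := by exact_mod_cast h.pos_c.ne'
  obtain ⟨l0, l1, l2⟩ := hV.edgeLen
  simp only [Tiling.edgeDir, l0, l1, l2, Fin.isValue, zero_add, Fin.reduceAdd]
  rcases h2 with h2 | h2
  · left
    rw [area₂_direct hg h1 h2, sign_pos hp, h1, h2, rot, conj_ω]
    refine ⟨?_, ?_, ?_⟩ <;> simp only [SignType.coe_one] <;> push_cast <;> field_simp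
    · ring
    · linear_combination -(a : ℂ) * g * ω_sq
    · ring
  · right
    rw [area₂_mirror hg h1 h2, Left.sign_neg, sign_pos hp, h1, h2, ← conj_rot_eq_inv h, conj_rot,
      ← conj_ω_eq_inv, conj_ω]
    refine ⟨?_, ?_, ?_⟩ <;> simp only [SignType.coe_neg_one] <;> push_cast <;> field_simp
    · ring
    · linear_combination (a : ℂ) * g * ω_sq
    · ring

lemma isTile_unitTri : IsTile 1 1 1 unitTri := by
  have h : ‖ω‖ = 1 := by
    have h2 : ‖ω‖ ^ 2 = 1 := by
      rw [Complex.sq_norm, Complex.normSq_apply]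
      simp [ω]; linarith [sqrt3_sq]
    nlinarith [norm_nonneg ω]
  refine ⟨by simp [unitTri], by simp [unitTri, h], ?_⟩
  simp [unitTri, ← ω_sq, h]

lemma isShape_one : IsShape 1 1 1 := ⟨one_pos, one_pos, one_pos, by norm_num⟩

lemma edgeDir_unitTri : edgeDir unitTri 0 = 1 ∧ edgeDir unitTri 1 = ω * (ω * 1) ∧
    edgeDir unitTri 2 = -(ω * 1) := by
  have h1 : unitTri 1 = unitTri 0 + (1 : ℝ) * 1 := by simp [unitTri]
  have h2 : unitTri 2 = unitTri 0 + (1 : ℝ) * (1 * ω) := by simp [unitTri]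
  obtain ⟨l0, l1, l2⟩ := isTile_unitTri.edgeLen
  simp only [Tiling.edgeDir, l0, l1, l2, Fin.isValue, zero_add, Fin.reduceAdd]
  rw [area₂_direct (by simp) h1 h2, sign_pos (by positivity)]
  refine ⟨by simp [unitTri], ?_, by simp [unitTri]⟩
  simp [unitTri]
  linear_combination -ω_sq

lemma area₂_unitTri : area₂ unitTri = √3 / 2 := by
  simp [area₂, unitTri, cross, ω]

lemma sum_edgeLen_mul_edgeOff {V : Fin 3 → ℂ} (hV : area₂ V ≠ 0) :
    ∑ j, edgeLen V j * edgeOff V j = -|area₂ V| := by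
  have h : ∀ j, edgeLen V j * edgeOff V j =
      SignType.sign (area₂ V) * cross (V (j + 1) - V j) (V j) := by
    intro j
    have := (edgeLen_pos hV j).ne'
    rw [edgeOff, edgeDir, cross_smul_left]
    field_simp
  simp only [h, Fin.sum_univ_three, ← mul_add]
  rw [← sign_mul_self, ← mul_neg]
  congr 1
  simp [cross, area₂]; ring

section Tiles

variable {ι : Type*} [Fintype ι] {a b c : ℝ} {V : ι → Fin 3 → ℂ}

/-- The total area of the tiles, from the signed distance of a line from the origin as odd
function. -/
theorem card_mul_area (hs : IsShape a b c) (hV : ∀ i, IsTile a b c (V i))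
    (h : IsTiling unitTri V) : (Fintype.card ι : ℝ) * (a * b) = 1 := by
  have := h.sum_odd (fun _ s => s) (fun _ _ => rfl)
  simp only [sum_edgeLen_mul_edgeOff h.area_ne, fun i => sum_edgeLen_mul_edgeOff (h.area_ne' i),
    fun i => (hV i).abs_area₂ hs, isTile_unitTri.abs_area₂ isShape_one, Finset.sum_const,
    Finset.card_univ, nsmul_eq_mul] at this
  have h3 : √3 ≠ 0 := by positivity
  apply mul_right_cancel₀ (b := √3 / 2) (by positivity)
  linarith

/-- The weighted perimeter of the tiles. Every tile has all its edge directions in one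
parity class, so that its perimeter is counted as a whole, with sign `1` or `-1` (or not at all). -/
theorem exists_int_mul_perimeter (hs : IsShape a b c) (hV : ∀ i, IsTile a b c (V i))
    (h : IsTiling unitTri V) (hroot : ∀ n : ℕ, 0 < n → rot a b c ^ n ≠ 1) :
    ∃ M : ℤ, (M : ℝ) * (a + b + c) = 3 := by
  have hζ := rot_ne_zero hs
  have key := h.sum_odd (fun u _ => (dirSign (rot a b c) u : ℝ))
    (fun u _ => by rw [dirSign_neg]; push_cast; ring)
  have h1 : ∀ i, ∃ m : ℤ, ∑ j, edgeLen (V i) j * (dirSign (rot a b c) (edgeDir (V i) j) : ℝ) =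
      m * (a + b + c) := by
    intro i
    obtain ⟨g, hg, h1, h2⟩ := (hV i).exists_dir hs
    obtain ⟨l0, l1, l2⟩ := (hV i).edgeLen
    rcases (hV i).edgeDir hs hg h1 h2 with ⟨d0, d1, d2⟩ | ⟨d0, d1, d2⟩
    · refine ⟨dirSign (rot a b c) g, ?_⟩
      rw [Fin.sum_univ_three, l0, l1, l2, d0, d1, d2, dirSign_neg, dirSign_ω_mul, dirSign_ω_mul,
        dirSign_ζ_mul hζ]
      push_cast; ring
    · refine ⟨-dirSign (rot a b c) g, ?_⟩
      rw [Fin.sum_univ_three, l0, l1, l2, d0, d1, d2, dirSign_neg, dirSign_neg, dirSign_ω_inv_mul,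
        dirSign_ω_inv_mul, dirSign_ζ_inv_mul hζ]
      push_cast; ring
  choose m hm using h1
  obtain ⟨l0, l1, l2⟩ := isTile_unitTri.edgeLen
  obtain ⟨d0, d1, d2⟩ := edgeDir_unitTri
  refine ⟨∑ i, m i, ?_⟩
  simp only [hm, ← Finset.sum_mul] at key
  push_cast
  rw [key, Fin.sum_univ_three, l0, l1, l2, d0, d1, d2, dirSign_neg, dirSign_ω_mul, dirSign_ω_mul,
    dirSign_one hroot]
  norm_num

/-- All tiles have their directions in the group generated by `ω` and `rot a b c`: the others
together have no area. -/
theorem inDirGroup_of_tiling (hs : IsShape a b c) (hV : ∀ i, IsTile a b c (V i))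
    (h : IsTiling unitTri V) {g : ι → ℂ} (hg : ∀ i, ‖g i‖ = 1)
    (h1 : ∀ i, V i 1 = V i 0 + a * g i) (h2 : ∀ i, V i 2 = V i 0 + b * (g i * ω) ∨
      V i 2 = V i 0 + b * (g i * (starRingEnd ℂ) ω)) (i : ι) :
    InDirGroup (rot a b c) (g i) := by
  classical
  have hζ := rot_ne_zero hs
  have key := h.sum_odd (fun u s => if InDirGroup (rot a b c) u then 0 else s)
    (fun u s => by simp only [inDirGroup_neg]; split_ifs <;> simp)
  have hdir : ∀ i j, InDirGroup (rot a b c) (edgeDir (V i) j) ↔ InDirGroup (rot a b c) (g i) := by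
    intro i j
    rcases (hV i).edgeDir hs (hg i) (h1 i) (h2 i) with ⟨d0, d1, d2⟩ | ⟨d0, d1, d2⟩
    · fin_cases j
      · simp [d0]
      · simp [d1, inDirGroup_ω_mul, inDirGroup_ζ_mul hζ]
      · simp [d2, inDirGroup_ω_mul, inDirGroup_neg]
    · fin_cases j
      · simp [d0, inDirGroup_neg]
      · simp [d1, inDirGroup_ω_inv_mul, inDirGroup_ζ_inv_mul hζ, inDirGroup_neg]
      · simp [d2, inDirGroup_ω_inv_mul]
  have hW : ∀ j, InDirGroup (rot a b c) (edgeDir unitTri j) := by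
    have h1 : InDirGroup (rot a b c) 1 := ⟨0, 0, by simp⟩
    obtain ⟨d0, d1, d2⟩ := edgeDir_unitTri
    intro j; fin_cases j
    · simp [d0, h1]
    · simp only [Fin.mk_one, d1, inDirGroup_ω_mul, h1]
    · simp only [Fin.reduceFinMk, d2, inDirGroup_ω_mul, inDirGroup_neg, h1]
  simp only [hdir, hW, if_true, mul_zero, Finset.sum_const_zero, mul_ite] at key
  have hnn : ∀ i, ∑ j, (if InDirGroup (rot a b c) (g i) then 0
      else edgeLen (V i) j * edgeOff (V i) j) =
      if InDirGroup (rot a b c) (g i) then 0 else -(a * b * (√3 / 2)) := by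
    intro i
    split_ifs
    · simp
    · rw [sum_edgeLen_mul_edgeOff (h.area_ne' i), (hV i).abs_area₂ hs]
  simp only [hnn] at key
  have hp : 0 < a * b * (√3 / 2) := mul_pos (mul_pos hs.pos_a hs.pos_b) (by positivity)
  have := (Finset.sum_eq_zero_iff_of_nonpos (fun i _ => by split_ifs <;> linarith)).1 key i
    (Finset.mem_univ _)
  by_contra hcon
  rw [if_neg hcon] at this
  linarith

end Tiles

end Tiling

/-! ### The tiles given by area and perimeter, and their angles -/

namespace Tiling

/-- The quantity whose square root generates the field of the sides of a tile. -/
def rad (N m : ℕ) : ℕ := (9 * N - m ^ 2) * (N - m ^ 2)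

/-- The longer of the sides adjacent to the angle `π / 3` of the tile with parameters `N`, `m`. -/
noncomputable def sideA (N m : ℕ) : ℝ := (3 * N + m ^ 2 + √(rad N m)) / (4 * m * N)

/-- The shorter of the sides adjacent to the angle `π / 3` of the tile with parameters `N`, `m`. -/
noncomputable def sideB (N m : ℕ) : ℝ := (3 * N + m ^ 2 - √(rad N m)) / (4 * m * N)

/-- The side opposite to the angle `π / 3` of the tile with parameters `N`, `m`. -/
noncomputable def sideC (N m : ℕ) : ℝ := (3 * N - m ^ 2) / (2 * m * N)

lemma rad_cast {N m : ℕ} (h : m ^ 2 ≤ N) : (rad N m : ℝ) = (9 * N - m ^ 2) * (N - m ^ 2) := by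
  rw [rad, Nat.cast_mul, Nat.cast_sub h, Nat.cast_sub (by omega)]
  push_cast; ring

/-- The perimeter and the area determine the tile. -/
theorem sides_eq {a b c : ℝ} (h : IsShape a b c) (hab : b ≤ a) {N m : ℕ}
    (hN : (N : ℝ) * (a * b) = 1) (hm : (m : ℝ) * (a + b + c) = 3) :
    m ^ 2 ≤ N ∧ a = sideA N m ∧ b = sideB N m ∧ c = sideC N m := by
  have ha := h.pos_a
  have hb := h.pos_b
  have hc := h.pos_c
  have hl := h.law
  have hm0 : (0 : ℝ) < m := by
    rcases (Nat.cast_nonneg m : (0 : ℝ) ≤ m).eq_or_lt with h0 | h0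
    · rw [← h0] at hm; norm_num at hm
    · exact h0
  have hN0 : (0 : ℝ) < N := by
    rcases (Nat.cast_nonneg N : (0 : ℝ) ≤ N).eq_or_lt with h0 | h0
    · rw [← h0] at hN; norm_num at hN
    · exact h0
  -- the inequality between perimeter and area, sharp for the equilateral triangle
  have hle : m ^ 2 ≤ N := by
    have h1 : a * b ≤ c ^ 2 := by nlinarith [sq_nonneg (a - b)]
    have h2 : 9 * (a * b) ≤ (a + b + c) ^ 2 := by
      have h3 : 4 * (a * b) ≤ (a + b) ^ 2 := by nlinarith [sq_nonneg (a - b)]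
      have h4 : (2 * (a * b)) ^ 2 ≤ ((a + b) * c) ^ 2 := by
        rw [mul_pow (a + b)]
        nlinarith [mul_le_mul h3 h1 (mul_pos ha hb).le (sq_nonneg (a + b))]
      have h5 : 2 * (a * b) ≤ (a + b) * c :=
        (sq_le_sq₀ (by positivity) (by positivity)).1 h4
      nlinarith
    have h6 : (m : ℝ) ^ 2 * 9 ≤ N * 9 := by
      calc (m : ℝ) ^ 2 * 9 = m ^ 2 * N * (9 * (a * b)) := by
            linear_combination (-9 * (m : ℝ) ^ 2) * hN
        _ ≤ m ^ 2 * N * (a + b + c) ^ 2 := by gcongr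
        _ = N * 9 := by linear_combination (N : ℝ) * (m * (a + b + c) + 3) * hm
    have h7 : (m : ℝ) ^ 2 ≤ N := by linarith
    exact_mod_cast h7
  have hs : 2 * m * N * (a + b) = 3 * N + m ^ 2 := by
    have h1 : 3 * (2 * m * N * (a + b)) = 3 * (3 * N + m ^ 2) := by
      linear_combination (-(m : ℝ) ^ 2 * N) * hl + 3 * (m : ℝ) ^ 2 * hN +
        N * (m * c - m * (a + b) + 3) * hm
    linarith
  have hd : 2 * m * N * (a - b) = √(rad N m) := by
    rw [eq_comm, Real.sqrt_eq_iff_mul_self_eq (Nat.cast_nonneg _)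
      (mul_nonneg (by positivity) (by linarith)), rad_cast hle]
    linear_combination -(2 * m * N * (a + b) + (3 * N + m ^ 2)) * hs + 16 * (m : ℝ) ^ 2 * N * hN
  refine ⟨hle, ?_, ?_, ?_⟩
  · rw [sideA, eq_div_iff (by positivity)]; linarith
  · rw [sideB, eq_div_iff (by positivity)]; linarith
  · rw [sideC, eq_div_iff (by positivity)]
    linear_combination 2 * N * hm - hs

theorem isShape_side {N m : ℕ} (hm : 0 < m) (h : m ^ 2 ≤ N) :
    IsShape (sideA N m) (sideB N m) (sideC N m) ∧ (N : ℝ) * (sideA N m * sideB N m) = 1 := by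
  have hm0 : (0 : ℝ) < m := by exact_mod_cast hm
  have hN : 0 < N := lt_of_lt_of_le (pow_pos hm 2) h
  have hN0 : (0 : ℝ) < N := by exact_mod_cast hN
  have h' : (m : ℝ) ^ 2 ≤ N := by exact_mod_cast h
  have hr : √(rad N m) * √(rad N m) = (9 * N - m ^ 2) * (N - m ^ 2) := by
    rw [Real.mul_self_sqrt (Nat.cast_nonneg _), rad_cast h]
  have hr0 : 0 ≤ √(rad N m) := Real.sqrt_nonneg _
  have hlt : √(rad N m) < 3 * N + m ^ 2 := by
    by_contra hcon
    have := mul_self_le_mul_self (by positivity) (not_lt.1 hcon)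
    rw [hr] at this
    nlinarith [mul_pos (pow_pos hm0 2) hN0]
  have hAB : (N : ℝ) * (sideA N m * sideB N m) = 1 := by
    rw [sideA, sideB]
    field_simp
    linear_combination -hr
  refine ⟨⟨?_, ?_, ?_, ?_⟩, hAB⟩
  · exact div_pos (by positivity) (by positivity)
  · exact div_pos (by linarith) (by positivity)
  · exact div_pos (by nlinarith) (by positivity)
  · rw [sideA, sideB, sideC]
    field_simp
    linear_combination (-12 : ℝ) * hr

section RootsOfUnity

lemma dvd_120_of_totient_le {n : ℕ} (hn : 0 < n) (h : n.totient ≤ 4) : n ∣ 120 := by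
  have hpp : ∀ p k : ℕ, p.Prime → p ^ k ∣ n → p ^ k ∣ 120 := by
    intro p k hp hk
    rcases k.eq_zero_or_pos with rfl | hk0
    · simp
    have h1 : (p ^ k).totient ≤ 4 :=
      (Nat.le_of_dvd (Nat.totient_pos.2 hn) (Nat.totient_dvd_of_dvd hk)).trans h
    rw [Nat.totient_prime_pow hp hk0] at h1
    have hp2 := hp.two_le
    have hp5 : p ≤ 5 := by
      have : 1 * (p - 1) ≤ p ^ (k - 1) * (p - 1) :=
        Nat.mul_le_mul_right _ (Nat.one_le_pow _ _ (by omega))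
      omega
    have hk3 : k ≤ 3 := by
      by_contra hcon
      have h2 : 2 ^ 3 ≤ p ^ (k - 1) :=
        (Nat.pow_le_pow_left hp2 3).trans (Nat.pow_le_pow_right (by omega) (by omega))
      have : 2 ^ 3 * 1 ≤ p ^ (k - 1) * (p - 1) := Nat.mul_le_mul h2 (by omega)
      omega
    interval_cases p <;> interval_cases k <;> simp_all
  rw [Nat.dvd_iff_prime_pow_dvd_dvd]
  exact hpp

open Polynomial in
/-- A root of unity of degree at most four over `ℚ` is a `120`-th root of unity. The equation is
the one satisfied by a number `ζ` for which `ζ + ζ⁻¹ - p` is a square root of `q`. -/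
theorem pow_120_eq_one {ζ : ℂ} {n : ℕ} (hn : 0 < n) (h : ζ ^ n = 1) {p q : ℚ}
    (hquad : (ζ ^ 2 - p * ζ + 1) ^ 2 = q * ζ ^ 2) : ζ ^ 120 = 1 := by
  have hord : 0 < orderOf ζ := orderOf_pos_iff.2 (isOfFinOrder_iff_pow_eq_one.2 ⟨n, hn, h⟩)
  have hprim := IsPrimitiveRoot.orderOf ζ
  let P : ℚ[X] := (X ^ 2 - C p * X + 1) ^ 2 - C q * X ^ 2
  have hP : P.natDegree = 4 := by
    have : P = X ^ 4 + C (-2 * p) * X ^ 3 + C (2 + p ^ 2 - q) * X ^ 2 + C (-2 * p) * X + C 1 := by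
      simp only [P, map_mul, map_add, map_sub, map_neg, map_pow, C_ofNat, map_one]; ring
    rw [this]; compute_degree!
  have hP0 : P ≠ 0 := by
    intro h0; rw [h0] at hP; simp at hP
  have hroot : aeval ζ P = 0 := by
    simp [P, hquad]
  have h1 : (minpoly ℚ ζ).natDegree ≤ 4 := by
    rw [← hP]; exact natDegree_le_of_dvd (minpoly.dvd ℚ ζ hroot) hP0
  rw [← cyclotomic_eq_minpoly_rat hprim hord, natDegree_cyclotomic] at h1
  exact orderOf_dvd_iff_pow_eq_one.1 (dvd_120_of_totient_le hord h1)

end RootsOfUnity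

/-- Irrationality of the angle, in terms of roots of unity. -/
theorem irrational_iff_rot {a b c : ℝ} (h : IsShape a b c) :
    Irrational (Real.arccos ((2 * b - a) / (2 * c)) / Real.pi) ↔
      ∀ n : ℕ, 0 < n → rot a b c ^ n ≠ 1 := by
  have hc := h.pos_c
  have ha := h.pos_a
  set α := Real.arccos ((2 * b - a) / (2 * c)) with hα
  have hsq : ((2 * b - a) / (2 * c)) ^ 2 = 1 - (a * (√3 / 2) / c) ^ 2 := by
    have := h.law
    have h3 := sqrt3_sq
    field_simp
    linear_combination -4 * this + a ^ 2 * h3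
  have hcos : Real.cos α = (2 * b - a) / (2 * c) := by
    rw [hα, Real.cos_arccos]
    · nlinarith [sq_nonneg (a * (√3 / 2) / c)]
    · nlinarith [sq_nonneg (a * (√3 / 2) / c)]
  have hsin : Real.sin α = a * (√3 / 2) / c := by
    rw [hα, Real.sin_arccos, hsq, sub_sub_cancel, Real.sqrt_sq (by positivity)]
  have hrot : rot a b c = Complex.exp (α * Complex.I) := by
    rw [Complex.exp_mul_I, ← Complex.ofReal_cos, ← Complex.ofReal_sin, hcos, hsin, rot]
    have : (c : ℂ) ≠ 0 := by exact_mod_cast hc.ne'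
    have hω : (starRingEnd ℂ) ω = 1 / 2 - √3 / 2 * Complex.I := by
      apply Complex.ext <;> simp [ω]
    rw [hω]
    push_cast
    field_simp
    ring
  have hpow : ∀ n : ℕ, rot a b c ^ n = 1 ↔ ∃ k : ℤ, n * α = k * (2 * Real.pi) := by
    intro n
    rw [hrot, ← Complex.exp_nat_mul, Complex.exp_eq_one_iff]
    refine exists_congr fun k => ?_
    rw [← mul_assoc, ← mul_assoc, mul_left_inj' Complex.I_ne_zero]
    norm_cast
  have hπ := Real.pi_ne_zero
  constructor
  · intro hirr n hn hone
    obtain ⟨k, hk⟩ := (hpow n).1 hone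
    apply hirr
    refine ⟨(2 * k : ℚ) / n, ?_⟩
    have hn' : (n : ℝ) ≠ 0 := by exact_mod_cast hn.ne'
    push_cast
    field_simp
    linarith
  · rintro hroot ⟨x, hx⟩
    refine hroot (2 * x.den) (by have := x.den_pos; omega) ((hpow _).2 ⟨x.num, ?_⟩)
    have hd : (x.den : ℝ) ≠ 0 := by exact_mod_cast x.den_nz
    rw [Rat.cast_def, div_eq_div_iff hd hπ] at hx
    push_cast
    linarith

/-- For the tiles with parameters `N`, `m`, irrationality of the angle can be read off from a
single power. -/
theorem rot_side_root_iff {N m : ℕ} (hm : 0 < m) (h : m ^ 2 ≤ N) :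
    (∀ n : ℕ, 0 < n → rot (sideA N m) (sideB N m) (sideC N m) ^ n ≠ 1) ↔
      rot (sideA N m) (sideB N m) (sideC N m) ^ 120 ≠ 1 := by
  refine ⟨fun h => h 120 (by norm_num), fun h1 n hn h2 => h1 ?_⟩
  obtain ⟨hs, -⟩ := isShape_side hm h
  have hm0 : (m : ℂ) ≠ 0 := by exact_mod_cast hm.ne'
  have hN : 0 < N := lt_of_lt_of_le (pow_pos hm 2) h
  have hN0 : (N : ℂ) ≠ 0 := by exact_mod_cast hN.ne'
  set ζ := rot (sideA N m) (sideB N m) (sideC N m) with hζ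
  have hr : (√(rad N m) : ℂ) * √(rad N m) = rad N m := by
    exact_mod_cast Real.mul_self_sqrt (Nat.cast_nonneg (rad N m))
  have hc0 : ((sideC N m : ℝ) : ℂ) ≠ 0 := by exact_mod_cast hs.pos_c.ne'
  have hden : (3 * (N : ℂ) - m ^ 2) ≠ 0 := by
    intro h0
    apply hc0
    rw [sideC]; push_cast; rw [h0, zero_div]
  -- `ζ + ζ⁻¹ = p + s √rad` with rational `p`, `s`
  have htr : ζ ^ 2 - (((3 * N + m ^ 2) / (2 * (3 * N - m ^ 2)) : ℚ) : ℂ) * ζ + 1 =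
      -(3 / (2 * (3 * N - m ^ 2))) * √(rad N m) * ζ := by
    have e1 : ζ + (starRingEnd ℂ) ζ = (3 * N + m ^ 2) / (2 * (3 * N - m ^ 2)) -
        (3 / (2 * (3 * N - m ^ 2))) * √(rad N m) := by
      rw [hζ, conj_rot, rot, conj_ω, sideA, sideB, sideC]
      push_cast
      field_simp
      ring
    have e2 := normSq_rot hs
    rw [← hζ] at e2
    push_cast
    linear_combination -e2 + ζ * e1
  refine pow_120_eq_one hn h2 (p := (3 * N + m ^ 2) / (2 * (3 * N - m ^ 2)))
    (q := (3 / (2 * (3 * N - m ^ 2))) ^ 2 * rad N m) ?_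
  rw [htr]
  push_cast
  linear_combination ((3 / (2 * (3 * (N : ℂ) - m ^ 2))) ^ 2 * ζ ^ 2) * hr

end Tiling

/-! ### Dissections and packings -/

namespace Tiling

open MeasureTheory

/-- Some edge of `V` separates `V` from `W`. -/
def Separates (V W : Fin 3 → ℂ) : Prop := ∃ j, ∀ k, area₂ V * edgeForm V j (W k) ≤ 0

lemma edgeForm_affine (V : Fin 3 → ℂ) (j : Fin 3) (w : Fin 3 → ℝ) (hw : ∑ k, w k = 1)
    (x : Fin 3 → ℂ) : edgeForm V j (∑ k, (w k : ℂ) * x k) = ∑ k, w k * edgeForm V j (x k) := by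
  rw [Fin.sum_univ_three] at hw
  simp only [Fin.sum_univ_three, edgeForm, cross]
  have : w 0 = 1 - w 1 - w 2 := by linarith
  simp [this]
  ring

/-- The barycentric coordinates of `x` with respect to the triangle `V`. -/
noncomputable def bary (V : Fin 3 → ℂ) (x : ℂ) (k : Fin 3) : ℝ := edgeForm V (k + 1) x / area₂ V

lemma sum_bary {V : Fin 3 → ℂ} (hV : area₂ V ≠ 0) (x : ℂ) : ∑ k, bary V x k = 1 := by
  simp only [bary, ← Finset.sum_div]
  rw [div_eq_one_iff_eq hV, Fin.sum_univ_three]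
  simp [edgeForm, cross, area₂]; ring

lemma sum_bary_mul {V : Fin 3 → ℂ} (hV : area₂ V ≠ 0) (x : ℂ) :
    ∑ k, (bary V x k : ℂ) * V k = x := by
  have hV' : (area₂ V : ℂ) ≠ 0 := by exact_mod_cast hV
  have : (area₂ V : ℂ) * ∑ k, (bary V x k : ℂ) * V k = area₂ V * x := by
    rw [Finset.mul_sum]
    have : ∀ k, (area₂ V : ℂ) * ((bary V x k : ℂ) * V k) = edgeForm V (k + 1) x * V k := by
      intro k; rw [bary]; push_cast; field_simp
    simp only [this, Fin.sum_univ_three]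
    apply Complex.ext <;> simp [edgeForm, cross, area₂] <;> ring
  exact mul_left_cancel₀ hV' this

lemma edgeForm_vertex (V : Fin 3 → ℂ) (j k : Fin 3) :
    edgeForm V (j + 1) (V k) = if k = j then area₂ V else 0 := by
  fin_cases j <;> fin_cases k <;> simp [edgeForm, area₂, cross] <;> ring

lemma bary_sum {V : Fin 3 → ℂ} (hV : area₂ V ≠ 0) (w : Fin 3 → ℝ) (hw : ∑ k, w k = 1) :
    bary V (∑ k, (w k : ℂ) * V k) = w := by
  ext j
  rw [bary, edgeForm_affine _ _ _ hw]
  simp only [edgeForm_vertex]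
  rw [Finset.sum_eq_single j (by intro k _ hk; simp [hk]) (by simp)]
  simp [hV]

lemma mem_openTri_iff_bary {V : Fin 3 → ℂ} (hV : area₂ V ≠ 0) (x : ℂ) :
    x ∈ openTri V ↔ ∀ k, 0 < bary V x k := by
  have h : ∀ k, 0 < bary V x k ↔ 0 < area₂ V * edgeForm V (k + 1) x := by
    intro k
    rw [bary, div_eq_mul_inv, ← mul_pos_iff_of_pos_left (mul_self_pos.2 hV)]
    field_simp
  simp only [h]
  exact ⟨fun hx k => hx _, fun hx k => by simpa using hx (k - 1)⟩

lemma mem_closedTri_iff_bary {V : Fin 3 → ℂ} (hV : area₂ V ≠ 0) (x : ℂ) :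
    x ∈ closedTri V ↔ ∀ k, 0 ≤ bary V x k := by
  have h : ∀ k, 0 ≤ bary V x k ↔ 0 ≤ area₂ V * edgeForm V (k + 1) x := by
    intro k
    rw [bary, div_eq_mul_inv, ← mul_nonneg_iff_of_pos_left (mul_self_pos.2 hV)]
    field_simp
  simp only [h]
  exact ⟨fun hx k => hx _, fun hx k => by simpa using hx (k - 1)⟩

lemma convexComb_mem_openTri {V : Fin 3 → ℂ} (hV : area₂ V ≠ 0) (w : Fin 3 → ℝ)
    (hw : ∑ k, w k = 1) (h : ∀ k, 0 < w k) : ∑ k, (w k : ℂ) * V k ∈ openTri V := by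
  rw [mem_openTri_iff_bary hV, bary_sum hV w hw]; exact h

lemma vertex_mem_closedTri (V : Fin 3 → ℂ) (k : Fin 3) : V k ∈ closedTri V := by
  intro j
  have := edgeForm_vertex V (j - 1) k
  rw [sub_add_cancel] at this
  rw [this]
  split_ifs
  · exact mul_self_nonneg _
  · simp

/-- Points of a triangle can be approached along segments from points of the open triangle. -/
lemma segment_mem_openTri {V : Fin 3 → ℂ} {x y : ℂ} (hx : x ∈ closedTri V)
    (hy : y ∈ openTri V) {t : ℝ} (ht : 0 < t) (ht1 : t ≤ 1) :
    x + t * (y - x) ∈ openTri V := by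
  intro j
  have h1 := hx j
  have h2 := hy j
  have : area₂ V * edgeForm V j (x + t * (y - x)) =
      (1 - t) * (area₂ V * edgeForm V j x) + t * (area₂ V * edgeForm V j y) := by
    simp [edgeForm, cross]; ring
  rw [this]
  have := mul_nonneg (sub_nonneg.2 ht1) h1
  have := mul_pos ht h2
  linarith

lemma openTri_nonempty {V : Fin 3 → ℂ} (hV : area₂ V ≠ 0) : (openTri V).Nonempty :=
  ⟨_, convexComb_mem_openTri hV (fun _ => 1 / 3) (by simp) (by simp)⟩

lemma continuous_edgeForm (V : Fin 3 → ℂ) (j : Fin 3) : Continuous (edgeForm V j) := by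
  unfold edgeForm cross; fun_prop

lemma isOpen_openTri (V : Fin 3 → ℂ) : IsOpen (openTri V) := by
  have : openTri V = ⋂ j, {x | 0 < area₂ V * edgeForm V j x} := by
    ext; simp [openTri]
  rw [this]
  exact isOpen_iInter_of_finite fun j =>
    isOpen_lt continuous_const (continuous_const.mul (continuous_edgeForm V j))

lemma isClosed_closedTri (V : Fin 3 → ℂ) : IsClosed (closedTri V) := by
  have : closedTri V = ⋂ j, {x | 0 ≤ area₂ V * edgeForm V j x} := by
    ext; simp [closedTri]
  rw [this]
  exact isClosed_iInter fun j =>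
    isClosed_le continuous_const (continuous_const.mul (continuous_edgeForm V j))

lemma closedTri_subset_closure {V : Fin 3 → ℂ} (hV : area₂ V ≠ 0) :
    closedTri V ⊆ closure (openTri V) := by
  intro x hx
  obtain ⟨y, hy⟩ := openTri_nonempty hV
  have hc : Continuous fun t : ℝ => x + t * (y - x) := by fun_prop
  have h0 : (0 : ℝ) ∈ closure (Set.Ioc (0 : ℝ) 1) := by
    rw [closure_Ioc (by norm_num)]; simp
  have := map_mem_closure hc h0 (t := openTri V)
    (fun t ht => segment_mem_openTri hx hy ht.1 ht.2)
  simpa using this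

lemma convex_halfPlane (V : Fin 3 → ℂ) (j : Fin 3) :
    Convex ℝ {x | 0 < area₂ V * edgeForm V j x} := by
  intro x hx y hy s t hs ht hst
  simp only [Set.mem_ofPred_eq] at *
  have : area₂ V * edgeForm V j (s • x + t • y) =
      s * (area₂ V * edgeForm V j x) + t * (area₂ V * edgeForm V j y) := by
    have : s = 1 - t := by linarith
    subst this
    simp [edgeForm, cross]; ring
  rw [this]
  rcases hs.eq_or_lt with rfl | hs
  · have : t = 1 := by linarith
    subst this; simpa using hy
  · have := mul_pos hs hx
    have := mul_nonneg ht hy.le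
    linarith

/-- If the open half-plane of an edge of `V` misses the open triangle `W`, the edge separates. -/
lemma separates_of_disjoint_halfPlane {V W : Fin 3 → ℂ} (hW : area₂ W ≠ 0) (j : Fin 3)
    (h : ∀ x ∈ openTri W, ¬ 0 < area₂ V * edgeForm V j x) : Separates V W := by
  refine ⟨j, fun k => ?_⟩
  have hcl : IsClosed {x | area₂ V * edgeForm V j x ≤ 0} :=
    isClosed_le (continuous_const.mul (continuous_edgeForm V j)) continuous_const
  have hsub : openTri W ⊆ {x | area₂ V * edgeForm V j x ≤ 0} := fun x hx => not_lt.1 (h x hx)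
  exact closure_minimal hsub hcl (closedTri_subset_closure hW (vertex_mem_closedTri W k))

/-- Two triangles without common interior points are separated by the line of one of their edges:
by Helly's theorem, already three of the six open half-planes have no common point, and at most
one of them belongs to one of the two triangles. -/
theorem separates_of_disjoint {V W : Fin 3 → ℂ} (hV : area₂ V ≠ 0) (hW : area₂ W ≠ 0)
    (h : Disjoint (openTri V) (openTri W)) : Separates V W ∨ Separates W V := by
  classical
  let T : Bool → Fin 3 → ℂ := fun b => if b then W else V
  let F : Bool × Fin 3 → Set ℂ := fun i => {x | 0 < area₂ (T i.1) * edgeForm (T i.1) i.2 x}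
  have hconv : ∀ i ∈ (Finset.univ : Finset (Bool × Fin 3)), Convex ℝ (F i) :=
    fun i _ => convex_halfPlane _ _
  have hempty : ¬ (⋂ i ∈ (Finset.univ : Finset (Bool × Fin 3)), F i).Nonempty := by
    rintro ⟨x, hx⟩
    simp only [Finset.mem_univ, Set.iInter_true, Set.mem_iInter] at hx
    exact Set.disjoint_left.1 h (show x ∈ openTri V from fun j => hx (false, j))
      (show x ∈ openTri W from fun j => hx (true, j))
  have hex : ∃ I : Finset (Bool × Fin 3), I.card ≤ 3 ∧ ¬ (⋂ i ∈ I, F i).Nonempty := by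
    by_contra hcon
    push Not at hcon
    refine hempty (Convex.helly_theorem' hconv fun I _ hI => ?_)
    rw [Complex.finrank_real_complex] at hI
    exact hcon I hI
  obtain ⟨I, hI, hIe⟩ := hex
  have hsplit : ∃ b, (I.filter fun i => i.1 = b).card ≤ 1 := by
    by_contra hcon
    push Not at hcon
    have h1 := hcon true
    have h2 := hcon false
    have h3 := Finset.card_filter_add_card_filter_not (s := I) (p := fun i => i.1 = true)
    simp only [Bool.not_eq_true] at h3
    omega
  obtain ⟨b, hb⟩ := hsplit
  obtain ⟨j, hj⟩ : ∃ j, ∀ i ∈ I, i.1 = b → i.2 = j := by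
    rcases (I.filter fun i => i.1 = b).eq_empty_or_nonempty with h0 | ⟨i, hi⟩
    · refine ⟨0, fun i hi hib => ?_⟩
      have : i ∈ I.filter fun i => i.1 = b := Finset.mem_filter.2 ⟨hi, hib⟩
      rw [h0] at this; simp at this
    · refine ⟨i.2, fun i' hi' hib => ?_⟩
      rw [Finset.card_le_one.1 hb i' (Finset.mem_filter.2 ⟨hi', hib⟩) i hi]
  have key : ∀ x ∈ openTri (T !b), ¬ 0 < area₂ (T b) * edgeForm (T b) j x := by
    intro x hx hpos
    refine hIe ⟨x, ?_⟩
    simp only [Set.mem_iInter]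
    intro i hi
    by_cases hib : i.1 = b
    · simp only [F, hib, hj i hi hib]; exact hpos
    · have : i.1 = !b := by cases b <;> simpa using hib
      simp only [F, this]; exact hx i.2
  cases b
  · exact Or.inl (separates_of_disjoint_halfPlane hW j key)
  · exact Or.inr (separates_of_disjoint_halfPlane hV j key)

lemma Separates.disjoint {V W : Fin 3 → ℂ} (hW : area₂ W ≠ 0) (h : Separates V W) :
    Disjoint (openTri V) (openTri W) := by
  obtain ⟨j, hj⟩ := h
  refine Set.disjoint_left.2 fun x hxV hxW => ?_
  have h1 := hxV j
  rw [← sum_bary_mul hW x, edgeForm_affine _ _ _ (sum_bary hW x), Finset.mul_sum] at h1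
  refine absurd h1 (not_lt.2 (Finset.sum_nonpos fun k _ => ?_))
  rw [mul_left_comm]
  exact mul_nonpos_of_nonneg_of_nonpos ((mem_openTri_iff_bary hW x).1 hxW k).le (hj k)

lemma closedTri_subset {V W : Fin 3 → ℂ} (hV : area₂ V ≠ 0) (h : ∀ k, V k ∈ closedTri W) :
    closedTri V ⊆ closedTri W := by
  intro x hx j
  rw [← sum_bary_mul hV x, edgeForm_affine _ _ _ (sum_bary hV x), Finset.mul_sum]
  refine Finset.sum_nonneg fun k _ => ?_
  rw [mul_left_comm]
  exact mul_nonneg ((mem_closedTri_iff_bary hV x).1 hx k) (h k j)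

lemma openTri_subset {V W : Fin 3 → ℂ} (hV : area₂ V ≠ 0) (hW : area₂ W ≠ 0)
    (h : ∀ k, V k ∈ closedTri W) : openTri V ⊆ openTri W := by
  intro x hx j
  have hpos := (mem_openTri_iff_bary hV x).1 hx
  have hnn : ∀ k ∈ Finset.univ, 0 ≤ bary V x k * (area₂ W * edgeForm W j (V k)) :=
    fun k _ => mul_nonneg (hpos k).le (h k j)
  rw [← sum_bary_mul hV x, edgeForm_affine _ _ _ (sum_bary hV x), Finset.mul_sum]
  simp only [mul_left_comm (area₂ W)]
  refine lt_of_le_of_ne (Finset.sum_nonneg hnn) fun h0 => ?_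
  -- otherwise `V` is contained in the line of an edge of `W`
  have hz : ∀ k, edgeForm W j (V k) = 0 := by
    intro k
    have := (Finset.sum_eq_zero_iff_of_nonneg hnn).1 h0.symm k (Finset.mem_univ k)
    rcases mul_eq_zero.1 this with h1 | h1
    · exact absurd h1 (hpos k).ne'
    · exact (mul_eq_zero.1 h1).resolve_left hW
  have hy : ∀ y, edgeForm W j y = 0 := by
    intro y
    rw [← sum_bary_mul hV y, edgeForm_affine _ _ _ (sum_bary hV y)]
    simp [hz]
  have := hy (W (j + 2))
  have h2 := area₂_rotate W j
  rw [edgeForm, h2] at this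
  exact hW this

/-- The linear map taking `1` and `I` to the two sides of a triangle at its first vertex. -/
noncomputable def frameMap (V : Fin 3 → ℂ) : ℂ →ₗ[ℝ] ℂ where
  toFun z := z.re * (V 1 - V 0) + z.im * (V 2 - V 0)
  map_add' z w := by simp; ring
  map_smul' r z := by simp; ring

lemma det_frameMap (V : Fin 3 → ℂ) : LinearMap.det (frameMap V) = area₂ V := by
  rw [← LinearMap.det_toMatrix Complex.basisOneI, Matrix.det_fin_two]
  simp [LinearMap.toMatrix_apply, frameMap, area₂, cross]
  ring

/-- The measure of an open triangle is proportional to the cross product of two sides. -/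
lemma volume_openTri {V : Fin 3 → ℂ} (hV : area₂ V ≠ 0) :
    volume (openTri V) = ENNReal.ofReal |area₂ V| * volume (openTri ![0, 1, Complex.I]) := by
  set S : Fin 3 → ℂ := ![0, 1, Complex.I]
  have hform : ∀ j z, edgeForm V j (V 0 + frameMap V z) = area₂ V * edgeForm S j z := by
    intro j z
    fin_cases j <;> simp [edgeForm, cross, area₂, frameMap, S] <;> ring
  have hS : area₂ S = 1 := by simp [area₂, cross, S]
  have hmem : ∀ z, V 0 + frameMap V z ∈ openTri V ↔ z ∈ openTri S := by
    intro z
    simp only [openTri, Set.mem_ofPred_eq, hform, hS, one_mul, ← mul_assoc,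
      mul_pos_iff_of_pos_left (mul_self_pos.2 hV)]
  have hsurj : Function.Surjective (frameMap V) := by
    exact ((frameMap V).equivOfDetNeZero (by rw [det_frameMap]; exact hV)).surjective
  have himg : openTri V = (fun z => V 0 + z) '' (frameMap V '' openTri S) := by
    ext x
    constructor
    · intro hx
      obtain ⟨z, hz⟩ := hsurj (x - V 0)
      refine ⟨_, ⟨z, ?_, rfl⟩, by simp [hz]⟩
      rw [← hmem, hz]; simpa using hx
    · rintro ⟨_, ⟨z, hz, rfl⟩, rfl⟩
      exact (hmem z).2 hz
  rw [himg, Set.image_add_left, measure_preimage_add, Measure.addHaar_image_linearMap,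
    det_frameMap]

lemma volume_stdTri : volume (openTri ![0, 1, Complex.I]) ≠ ⊤ := by
  refine ne_top_of_le_ne_top (b := volume (Metric.ball (0 : ℂ) 2)) (measure_ball_lt_top.ne) ?_
  refine measure_mono fun z hz => ?_
  have h0 := hz 0
  have h1 := hz 1
  have h2 := hz 2
  simp [area₂, edgeForm, cross] at h0 h1 h2
  rw [mem_ball_zero_iff]
  calc ‖z‖ ≤ |z.re| + |z.im| := Complex.norm_le_abs_re_add_abs_im z
    _ < 2 := by rw [abs_of_pos h2, abs_of_pos h0]; linarith

/-- Non-overlapping triangles inside `W` of the right total area cover `W`. -/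
theorem isTiling_of_area {ι : Type*} [Fintype ι] {W : Fin 3 → ℂ} {V : ι → Fin 3 → ℂ}
    (hW : area₂ W ≠ 0) (hV : ∀ i, area₂ (V i) ≠ 0) (hsub : ∀ i k, V i k ∈ closedTri W)
    (hdisj : Pairwise fun i j => Disjoint (openTri (V i)) (openTri (V j)))
    (harea : ∑ i, |area₂ (V i)| = |area₂ W|) : IsTiling W V := by
  refine ⟨hW, hV, ?_, hdisj⟩
  refine Set.Subset.antisymm (Set.iUnion_subset fun i => closedTri_subset (hV i) (hsub i)) ?_
  intro x hx
  by_contra hcon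
  set K := ⋃ i, closedTri (V i)
  have hK : IsClosed K := isClosed_iUnion_of_finite fun i => isClosed_closedTri _
  have hO : (openTri W ∩ Kᶜ).Nonempty := by
    obtain ⟨y, hy1, hy2⟩ :=
      mem_closure_iff.1 (closedTri_subset_closure hW hx) Kᶜ hK.isOpen_compl hcon
    exact ⟨y, hy2, hy1⟩
  have hOo : IsOpen (openTri W ∩ Kᶜ) := (isOpen_openTri W).inter hK.isOpen_compl
  have hOpos := hOo.measure_pos volume hO
  have hU : volume (⋃ i, openTri (V i)) = volume (openTri W) := by
    rw [measure_iUnion hdisj fun i => (isOpen_openTri _).measurableSet, tsum_fintype,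
      volume_openTri hW, ← harea, ENNReal.ofReal_sum_of_nonneg fun i _ => abs_nonneg _,
      Finset.sum_mul]
    exact Finset.sum_congr rfl fun i _ => volume_openTri (hV i)
  have hd : Disjoint (⋃ i, openTri (V i)) (openTri W ∩ Kᶜ) := by
    refine Set.disjoint_left.2 fun y hy hy' => hy'.2 ?_
    obtain ⟨i, hi⟩ := Set.mem_iUnion.1 hy
    exact Set.mem_iUnion.2 ⟨i, openTri_subset_closedTri _ hi⟩
  have hle : volume ((⋃ i, openTri (V i)) ∪ (openTri W ∩ Kᶜ)) ≤ volume (openTri W) :=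
    measure_mono (Set.union_subset
      (Set.iUnion_subset fun i => openTri_subset (hV i) hW (hsub i)) Set.inter_subset_left)
  rw [measure_union hd hOo.measurableSet, hU] at hle
  have hfin : volume (openTri W) ≠ ⊤ := by
    rw [volume_openTri hW]; exact ENNReal.mul_ne_top ENNReal.ofReal_ne_top volume_stdTri
  have : volume (openTri W) + volume (openTri W ∩ Kᶜ) ≤ volume (openTri W) + 0 := by simpa using hle
  exact absurd (ENNReal.le_of_add_le_add_left hfin this) (not_le.2 hOpos)

/-- Tiles inside the unit triangle, any two of which are separated by an edge. -/
structure IsPacking {ι : Type*} (a b c : ℝ) (V : ι → Fin 3 → ℂ) : Prop where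
  tile : ∀ i, IsTile a b c (V i)
  mem : ∀ i k, V i k ∈ closedTri unitTri
  sep : ∀ i j, i ≠ j → Separates (V i) (V j) ∨ Separates (V j) (V i)

lemma IsTile.area₂_ne_zero {a b c : ℝ} (h : IsShape a b c) {V : Fin 3 → ℂ}
    (hV : IsTile a b c V) : area₂ V ≠ 0 := by
  rw [← abs_pos, hV.abs_area₂ h]
  have := h.pos_a
  have := h.pos_b
  positivity

lemma area₂_unitTri_ne_zero : area₂ unitTri ≠ 0 := by
  rw [area₂_unitTri]; positivity

/-- For tiles of the right size, tilings are the same as packings. -/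
theorem isTiling_iff_isPacking {ι : Type*} [Fintype ι] {a b c : ℝ} (h : IsShape a b c)
    (hcard : (Fintype.card ι : ℝ) * (a * b) = 1) {V : ι → Fin 3 → ℂ} :
    (IsTiling unitTri V ∧ ∀ i, IsTile a b c (V i)) ↔ IsPacking a b c V := by
  constructor
  · rintro ⟨ht, htile⟩
    refine ⟨htile, fun i k => ?_, fun i j hij => ?_⟩
    · rw [← ht.cover]
      exact Set.mem_iUnion.2 ⟨i, vertex_mem_closedTri _ k⟩
    · exact separates_of_disjoint (ht.area_ne' i) (ht.area_ne' j) (ht.disj hij)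
  · rintro ⟨htile, hmem, hsep⟩
    have hne := fun i => (htile i).area₂_ne_zero h
    refine ⟨isTiling_of_area area₂_unitTri_ne_zero hne hmem ?_ ?_, htile⟩
    · intro i j hij
      rcases hsep i j hij with h1 | h1
      · exact h1.disjoint (hne j)
      · exact (h1.disjoint (hne i)).symm
    · simp only [fun i => (htile i).abs_area₂ h, Finset.sum_const, Finset.card_univ, nsmul_eq_mul]
      rw [area₂_unitTri, abs_of_pos (by positivity), ← mul_assoc, hcard, one_mul]

end Tiling

/-! ### Packings in coordinates -/

namespace Tiling

/-- The complex number with coordinates `p` in the basis `1`, `ω`. -/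
noncomputable def ofCoord (p : ℝ × ℝ) : ℂ := p.1 + p.2 * ω

/-- The coordinates of a complex number in the basis `1`, `ω`. -/
noncomputable def coord (z : ℂ) : ℝ × ℝ := (z.re - z.im / √3, 2 * z.im / √3)

lemma ofCoord_coord (z : ℂ) : ofCoord (coord z) = z := by
  have : √3 ≠ 0 := by positivity
  apply Complex.ext <;> simp [ofCoord, coord, ω] <;> field_simp
  ring

lemma ofCoord_sub (p q : ℝ × ℝ) : ofCoord (p - q) = ofCoord p - ofCoord q := by
  simp [ofCoord]; ring

/-- The square of the Euclidean norm in the coordinates with respect to `1`, `ω`. -/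
def normForm (p : ℝ × ℝ) : ℝ := p.1 * p.1 + p.1 * p.2 + p.2 * p.2

/-- The determinant of two vectors in the coordinates with respect to `1`, `ω`. -/
def detForm (p q : ℝ × ℝ) : ℝ := p.1 * q.2 - p.2 * q.1

lemma norm_ofCoord_sq (p : ℝ × ℝ) : ‖ofCoord p‖ ^ 2 = normForm p := by
  rw [Complex.sq_norm, Complex.normSq_apply]
  have := sqrt3_sq
  simp [ofCoord, ω, normForm]
  linear_combination p.2 ^ 2 / 4 * this

lemma cross_ofCoord (p q : ℝ × ℝ) : cross (ofCoord p) (ofCoord q) = √3 / 2 * detForm p q := by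
  simp [cross, ofCoord, ω, detForm]; ring

/-- The signed area of a triangle, in units of the area of the unit triangle. -/
def areaForm (u : Fin 3 → ℝ × ℝ) : ℝ := detForm (u 1 - u 0) (u 2 - u 0)

/-- The form `edgeForm` in coordinates, multiplied with the signed area, so that it is positive on
the side of the triangle. -/
def sideForm (u : Fin 3 → ℝ × ℝ) (j : Fin 3) (p : ℝ × ℝ) : ℝ :=
  areaForm u * detForm (u (j + 1) - u j) (p - u j)

/-- The sides of the triangle are `a`, `b`, `c` up to an error of `e` in the squares. -/
structure ApproxTile (a b c e : ℝ) (u : Fin 3 → ℝ × ℝ) : Prop where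
  a_le : normForm (u 1 - u 0) - a * a ≤ e
  le_a : a * a - normForm (u 1 - u 0) ≤ e
  b_le : normForm (u 2 - u 0) - b * b ≤ e
  le_b : b * b - normForm (u 2 - u 0) ≤ e
  c_le : normForm (u 2 - u 1) - c * c ≤ e
  le_c : c * c - normForm (u 2 - u 1) ≤ e

/-- The point is in the unit triangle up to an error `e`. -/
structure ApproxMem (e : ℝ) (p : ℝ × ℝ) : Prop where
  fst_nonneg : -p.1 ≤ e
  snd_nonneg : -p.2 ≤ e
  add_le : p.1 + p.2 - 1 ≤ e

/-- An edge of `u` separates `u` from `v` up to an error `e`. -/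
def ApproxSep (e : ℝ) (u v : Fin 3 → ℝ × ℝ) : Prop := ∃ j, ∀ k, sideForm u j (v k) ≤ e

/-- Packings of the unit triangle in coordinates, up to an error `e` in all conditions. -/
structure ApproxPacking {ι : Type*} (a b c e : ℝ) (U : ι → Fin 3 → ℝ × ℝ) : Prop where
  tile : ∀ i, ApproxTile a b c e (U i)
  mem : ∀ i k, ApproxMem e (U i k)
  sep : ∀ i j, i ≠ j → ApproxSep e (U i) (U j) ∨ ApproxSep e (U j) (U i)

lemma norm_eq_iff_normForm {p q : ℝ × ℝ} {a : ℝ} (ha : 0 < a) :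
    ‖ofCoord p - ofCoord q‖ = a ↔ normForm (p - q) = a * a := by
  rw [← ofCoord_sub, ← norm_ofCoord_sq, ← pow_two, sq_eq_sq₀ (norm_nonneg _) ha.le]

lemma isTile_iff {a b c : ℝ} (h : IsShape a b c) (u : Fin 3 → ℝ × ℝ) :
    IsTile a b c (fun k => ofCoord (u k)) ↔ ApproxTile a b c 0 u := by
  constructor
  · rintro ⟨h1, h2, h3⟩
    rw [norm_eq_iff_normForm h.pos_a] at h1
    rw [norm_eq_iff_normForm h.pos_b] at h2
    rw [norm_eq_iff_normForm h.pos_c] at h3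
    constructor <;> linarith
  · rintro ⟨h1, h2, h3, h4, h5, h6⟩
    refine ⟨(norm_eq_iff_normForm h.pos_a).2 ?_, (norm_eq_iff_normForm h.pos_b).2 ?_,
      (norm_eq_iff_normForm h.pos_c).2 ?_⟩ <;> linarith

lemma area₂_ofCoord (u : Fin 3 → ℝ × ℝ) :
    area₂ (fun k => ofCoord (u k)) = √3 / 2 * areaForm u := by
  rw [area₂, ← ofCoord_sub, ← ofCoord_sub, cross_ofCoord, areaForm]

lemma area₂_mul_edgeForm_ofCoord (u : Fin 3 → ℝ × ℝ) (j : Fin 3) (p : ℝ × ℝ) :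
    area₂ (fun k => ofCoord (u k)) * edgeForm (fun k => ofCoord (u k)) j (ofCoord p) =
      3 / 4 * sideForm u j p := by
  rw [area₂_ofCoord, edgeForm, ← ofCoord_sub, ← ofCoord_sub, cross_ofCoord, sideForm]
  linear_combination (areaForm u * detForm (u (j + 1) - u j) (p - u j)) / 4 * sqrt3_sq

lemma separates_iff (u v : Fin 3 → ℝ × ℝ) :
    Separates (fun k => ofCoord (u k)) (fun k => ofCoord (v k)) ↔ ApproxSep 0 u v := by
  simp only [Separates, ApproxSep, area₂_mul_edgeForm_ofCoord]
  refine exists_congr fun j => forall_congr' fun k => ?_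
  constructor <;> intro h <;> linarith

lemma mem_closedTri_unitTri (p : ℝ × ℝ) : ofCoord p ∈ closedTri unitTri ↔ ApproxMem 0 p := by
  have hU : unitTri = fun k => ofCoord ((![(0, 0), (1, 0), (0, 1)] : Fin 3 → ℝ × ℝ) k) := by
    ext k; fin_cases k <;> simp [unitTri, ofCoord]
  simp only [hU, closedTri, Set.mem_ofPred_eq, area₂_mul_edgeForm_ofCoord, Fin.forall_fin_succ]
  simp [sideForm, areaForm, detForm]
  constructor
  · rintro ⟨h1, h2, h3⟩
    constructor <;> linarith
  · rintro ⟨h1, h2, h3⟩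
    refine ⟨?_, ?_, ?_⟩ <;> linarith

/-- Packings in coordinates. -/
theorem isPacking_iff {ι : Type*} {a b c : ℝ} (h : IsShape a b c) (U : ι → Fin 3 → ℝ × ℝ) :
    IsPacking a b c (fun i k => ofCoord (U i k)) ↔ ApproxPacking a b c 0 U := by
  constructor
  · rintro ⟨h1, h2, h3⟩
    exact ⟨fun i => (isTile_iff h _).1 (h1 i), fun i k => (mem_closedTri_unitTri _).1 (h2 i k),
      fun i j hij => (h3 i j hij).imp (separates_iff _ _).1 (separates_iff _ _).1⟩
  · rintro ⟨h1, h2, h3⟩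
    exact ⟨fun i => (isTile_iff h _).2 (h1 i), fun i k => (mem_closedTri_unitTri _).2 (h2 i k),
      fun i j hij => (h3 i j hij).imp (separates_iff _ _).2 (separates_iff _ _).2⟩

end Tiling

/-! ### Linear inequalities over a subfield of the real numbers -/

namespace Tiling

/-- Between finitely many lower and upper bounds in a subfield there is an element of
the subfield. -/
lemma exists_mem_between {F : Subfield ℝ} {κ : Type*} [Finite κ] (l u : Set κ) (f : κ → ℝ)
    (hf : ∀ k, f k ∈ F) (h : ∀ i ∈ l, ∀ j ∈ u, f i ≤ f j) :
    ∃ y ∈ F, (∀ i ∈ l, f i ≤ y) ∧ ∀ j ∈ u, y ≤ f j := by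
  rcases l.eq_empty_or_nonempty with rfl | hl
  · rcases u.eq_empty_or_nonempty with rfl | hu
    · exact ⟨0, F.zero_mem, by simp, by simp⟩
    · obtain ⟨j, hj, hmin⟩ := Set.exists_min_image u f u.toFinite hu
      exact ⟨f j, hf j, by simp, hmin⟩
  · obtain ⟨i, hi, hmax⟩ := Set.exists_max_image l f l.toFinite hl
    exact ⟨f i, hf i, hmax, fun j hj => h i hi j hj⟩

/-- A finite system of linear inequalities with coefficients in a subfield of `ℝ` which has
a real solution has a solution in the subfield. The proof eliminates the variables one by one. -/
theorem exists_solution_mem (F : Subfield ℝ) : ∀ (n : ℕ) {κ : Type} [Finite κ]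
    (A : κ → Fin n → ℝ) (b : κ → ℝ), (∀ k j, A k j ∈ F) → (∀ k, b k ∈ F) →
    ∀ x : Fin n → ℝ, (∀ k, ∑ j, A k j * x j ≤ b k) →
    ∃ y : Fin n → ℝ, (∀ j, y j ∈ F) ∧ ∀ k, ∑ j, A k j * y j ≤ b k := by
  intro n
  induction n with
  | zero => exact fun A b _ _ x hx => ⟨x, fun j => j.elim0, hx⟩
  | succ n ih =>
    intro κ _ A b hA hb x hx
    classical
    simp only [Fin.sum_univ_succ] at hx ⊢
    -- the inequality for a pair `p` is `c₁ p` times the first plus `c₂ p` times the second one: it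
    -- keeps an inequality without the variable `0`, combines an upper with a lower bound for this
    -- variable, and is trivial for other pairs
    let c₁ : κ × κ → ℝ := fun p =>
      if A p.1 0 = 0 then 1 else if 0 < A p.1 0 ∧ A p.2 0 < 0 then -A p.2 0 else 0
    let c₂ : κ × κ → ℝ := fun p =>
      if A p.1 0 = 0 then 0 else if 0 < A p.1 0 ∧ A p.2 0 < 0 then A p.1 0 else 0
    have hc₁ : ∀ p, 0 ≤ c₁ p := by
      intro p; simp only [c₁]; split_ifs with h1 h2
      · exact zero_le_one
      · linarith [h2.2]
      · exact le_rfl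
    have hc₂ : ∀ p, 0 ≤ c₂ p := by
      intro p; simp only [c₂]; split_ifs with h1 h2
      · exact le_rfl
      · exact h2.1.le
      · exact le_rfl
    have hc : ∀ p, c₁ p * A p.1 0 + c₂ p * A p.2 0 = 0 := by
      intro p; simp only [c₁, c₂]; split_ifs with h1 h2
      · rw [h1]; ring
      · ring
      · ring
    have hcF : ∀ p, c₁ p ∈ F ∧ c₂ p ∈ F := by
      intro p; simp only [c₁, c₂]; split_ifs with h1 h2
      · exact ⟨F.one_mem, F.zero_mem⟩
      · exact ⟨F.neg_mem (hA _ _), hA _ _⟩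
      · exact ⟨F.zero_mem, F.zero_mem⟩
    have hsum : ∀ (p : κ × κ) (z : Fin n → ℝ),
        ∑ j, (c₁ p * A p.1 j.succ + c₂ p * A p.2 j.succ) * z j =
          c₁ p * (∑ j, A p.1 j.succ * z j) + c₂ p * ∑ j, A p.2 j.succ * z j := by
      intro p z
      rw [Finset.mul_sum, Finset.mul_sum, ← Finset.sum_add_distrib]
      exact Finset.sum_congr rfl fun j _ => by ring
    obtain ⟨y, hyF, hy⟩ := ih (κ := κ × κ)
      (fun p j => c₁ p * A p.1 j.succ + c₂ p * A p.2 j.succ)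
      (fun p => c₁ p * b p.1 + c₂ p * b p.2)
      (fun p j => F.add_mem (F.mul_mem (hcF p).1 (hA _ _)) (F.mul_mem (hcF p).2 (hA _ _)))
      (fun p => F.add_mem (F.mul_mem (hcF p).1 (hb _)) (F.mul_mem (hcF p).2 (hb _)))
      (fun j => x j.succ) (fun p => by
        rw [hsum]
        have h1 := mul_le_mul_of_nonneg_left (hx p.1) (hc₁ p)
        have h2 := mul_le_mul_of_nonneg_left (hx p.2) (hc₂ p)
        have h3 := hc p
        linear_combination h1 + h2 - x 0 * h3)
    simp only [hsum] at hy
    let r : κ → ℝ := fun k => (b k - ∑ j, A k j.succ * y j) / A k 0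
    have hr : ∀ k, r k ∈ F := fun k => F.div_mem
      (F.sub_mem (hb k) (F.sum_mem fun j _ => F.mul_mem (hA _ _) (hyF j))) (hA _ _)
    obtain ⟨t, htF, htl, htu⟩ :=
      exists_mem_between (F := F) {k | A k 0 < 0} {k | 0 < A k 0} r hr (by
      intro i hi j hj
      simp only [Set.mem_ofPred_eq] at hi hj
      have := hy (j, i)
      simp only [c₁, c₂, hj.ne', if_false, hj, hi, and_self, if_true] at this
      simp only [r]
      rw [div_le_iff_of_neg hi, div_mul_eq_mul_div, div_le_iff₀ hj]
      linarith)
    refine ⟨Fin.cons t y, fun j => ?_, fun k => ?_⟩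
    · refine Fin.cases ?_ (fun j => ?_) j
      · simpa using htF
      · simpa using hyF j
    · simp only [Fin.cons_zero, Fin.cons_succ]
      rcases lt_trichotomy (A k 0) 0 with h | h | h
      · have := htl k h
        simp only [r] at this
        rw [div_le_iff_of_neg h] at this
        linarith
      · have := hy (k, k)
        simp only [c₁, c₂, h, if_true] at this
        rw [h]; linarith
      · have := htu k h
        simp only [r] at this
        rw [le_div_iff₀ h] at this
        linarith

/-- Affine functions of finitely many real variables with coefficients in `F`. -/
def IsAffineOver (F : Subfield ℝ) {ι : Type} [Fintype ι] (Q : (ι → ℝ) → ℝ) : Prop :=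
  ∃ (A : ι → ℝ) (b : ℝ), (∀ j, A j ∈ F) ∧ b ∈ F ∧ ∀ x, Q x = ∑ j, A j * x j + b

section AffineOver

variable {F : Subfield ℝ} {ι : Type} [Fintype ι] {Q R : (ι → ℝ) → ℝ}

lemma isAffineOver_const {c : ℝ} (hc : c ∈ F) : IsAffineOver F fun _ : ι → ℝ => c :=
  ⟨0, c, fun _ => F.zero_mem, hc, by simp⟩

lemma isAffineOver_coord (j : ι) : IsAffineOver F fun x : ι → ℝ => x j := by
  classical
  refine ⟨Pi.single j 1, 0, fun k => ?_, F.zero_mem, fun x => ?_⟩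
  · by_cases h : k = j
    · subst h; simp [F.one_mem]
    · simp [h, F.zero_mem]
  · simp [Pi.single_apply]

lemma IsAffineOver.add (hQ : IsAffineOver F Q) (hR : IsAffineOver F R) :
    IsAffineOver F fun x => Q x + R x := by
  obtain ⟨A, b, hA, hb, h⟩ := hQ
  obtain ⟨A', b', hA', hb', h'⟩ := hR
  refine ⟨A + A', b + b', fun j => F.add_mem (hA j) (hA' j), F.add_mem hb hb', fun x => ?_⟩
  simp only [h, h', Pi.add_apply, add_mul, Finset.sum_add_distrib]; ring

lemma IsAffineOver.const_mul {c : ℝ} (hc : c ∈ F) (hQ : IsAffineOver F Q) :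
    IsAffineOver F fun x => c * Q x := by
  obtain ⟨A, b, hA, hb, h⟩ := hQ
  refine ⟨fun j => c * A j, c * b, fun j => F.mul_mem hc (hA j), F.mul_mem hc hb, fun x => ?_⟩
  simp only [h, mul_assoc, ← Finset.mul_sum]; ring

lemma IsAffineOver.neg (hQ : IsAffineOver F Q) : IsAffineOver F fun x => -Q x := by
  simpa using hQ.const_mul (F.neg_mem F.one_mem)

lemma IsAffineOver.sub (hQ : IsAffineOver F Q) (hR : IsAffineOver F R) :
    IsAffineOver F fun x => Q x - R x := by
  simpa only [sub_eq_add_neg] using hQ.add hR.neg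

/-- The solvability transfer for affine inequalities in variables indexed by any finite type. -/
theorem exists_affine_solution_mem {κ : Type} [Finite κ] (Q : κ → (ι → ℝ) → ℝ)
    (hQ : ∀ k, IsAffineOver F (Q k)) (x : ι → ℝ) (hx : ∀ k, Q k x ≤ 0) :
    ∃ y : ι → ℝ, (∀ j, y j ∈ F) ∧ ∀ k, Q k y ≤ 0 := by
  choose A b hA hb h using hQ
  let e := Fintype.equivFin ι
  have hsum : ∀ k (z : ι → ℝ), ∑ j, A k (e.symm j) * z (e.symm j) = ∑ j, A k j * z j :=
    fun k z => e.symm.sum_comp fun j => A k j * z j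
  obtain ⟨y, hyF, hy⟩ := exists_solution_mem F (Fintype.card ι)
    (fun k j => A k (e.symm j)) (fun k => -b k) (fun k j => hA k _) (fun k => F.neg_mem (hb k))
    (fun j => x (e.symm j)) (fun k => by
      rw [hsum]
      have := hx k
      rw [h] at this
      linarith)
  refine ⟨fun j => y (e j), fun j => hyF _, fun k => ?_⟩
  have h1 := hsum k fun j => y (e j)
  simp only [Equiv.apply_symm_apply] at h1
  rw [h, ← h1]
  have := hy k
  linarith

end AffineOver

/-- The pairs of coordinates from `F`. -/
def CoordMem (F : Subfield ℝ) (p : ℝ × ℝ) : Prop := p.1 ∈ F ∧ p.2 ∈ F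

lemma CoordMem.detForm {F : Subfield ℝ} {p q : ℝ × ℝ} (hp : CoordMem F p) (hq : CoordMem F q) :
    detForm p q ∈ F :=
  F.sub_mem (F.mul_mem hp.1 hq.2) (F.mul_mem hp.2 hq.1)

lemma CoordMem.sub {F : Subfield ℝ} {p q : ℝ × ℝ} (hp : CoordMem F p) (hq : CoordMem F q) :
    CoordMem F (p - q) := ⟨F.sub_mem hp.1 hq.1, F.sub_mem hp.2 hq.2⟩

/-- A packing in which every tile is a translate of a triangle with coordinates in `F` can be
replaced by a packing with all coordinates in `F`: the conditions on the translations are linear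
inequalities. -/
theorem exists_packing_mem {ι : Type} [Finite ι] {F : Subfield ℝ} {a b c : ℝ}
    {U : ι → Fin 3 → ℝ × ℝ} (hU : ApproxPacking a b c 0 U)
    (hF : ∀ i k, CoordMem F (U i k - U i 0)) :
    ∃ U' : ι → Fin 3 → ℝ × ℝ, ApproxPacking a b c 0 U' ∧ ∀ i k, CoordMem F (U' i k) := by
  classical
  have := Fintype.ofFinite ι
  -- translation vectors are given by the variables `x (i, false)` and `x (i, true)`
  let w : ι → Fin 3 → ℝ × ℝ := fun i k => U i k - U i 0
  let T : (ι × Bool → ℝ) → ι → Fin 3 → ℝ × ℝ := fun x i k => (x (i, false), x (i, true)) + w i k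
  have hT1 : ∀ i k, IsAffineOver F fun x => (T x i k).1 := fun i k =>
    (isAffineOver_coord (i, false)).add (isAffineOver_const (hF i k).1)
  have hT2 : ∀ i k, IsAffineOver F fun x => (T x i k).2 := fun i k =>
    (isAffineOver_coord (i, true)).add (isAffineOver_const (hF i k).2)
  have hdiff : ∀ x i k l, T x i k - T x i l = U i k - U i l := by
    intro x i k l; simp only [T, w]; abel
  have hside : ∀ x i j p, sideForm (T x i) j p =
      areaForm (U i) * detForm (U i (j + 1) - U i j) (p - T x i j) := by
    intro x i j p; simp only [sideForm, areaForm, hdiff]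
  have hdd : ∀ i k l, CoordMem F (U i k - U i l) := by
    intro i k l
    have := (hF i k).sub (hF i l)
    rwa [sub_sub_sub_cancel_right] at this
  have hsideF : ∀ i j i' k, IsAffineOver F fun x => sideForm (T x i) j (T x i' k) := by
    intro i j i' k
    simp only [hside]
    refine IsAffineOver.const_mul ((hdd i 1 0).detForm (hdd i 2 0)) ?_
    simp only [detForm, Prod.fst_sub, Prod.snd_sub]
    exact (((hT2 i' k).sub (hT2 i j)).const_mul (hdd i (j + 1) j).1).sub
      (((hT1 i' k).sub (hT1 i j)).const_mul (hdd i (j + 1) j).2)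
  have hsep : ∀ p : {p : ι × ι // p.1 ≠ p.2}, ∃ (o : Bool) (j : Fin 3), ∀ k,
      if o then sideForm (U p.1.1) j (U p.1.2 k) ≤ 0 else sideForm (U p.1.2) j (U p.1.1 k) ≤ 0 := by
    rintro ⟨⟨i, j⟩, hij⟩
    rcases hU.sep i j hij with ⟨l, hl⟩ | ⟨l, hl⟩
    · exact ⟨true, l, by simpa using hl⟩
    · exact ⟨false, l, by simpa using hl⟩
  choose o e he using hsep
  let Q : (ι × Fin 3 × Fin 3) ⊕ ({p : ι × ι // p.1 ≠ p.2} × Fin 3) →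
      (ι × Bool → ℝ) → ℝ := fun s x =>
    match s with
    | .inl (i, k, 0) => -(T x i k).1
    | .inl (i, k, 1) => -(T x i k).2
    | .inl (i, k, 2) => (T x i k).1 + (T x i k).2 - 1
    | .inr (p, k) => if o p then sideForm (T x p.1.1) (e p) (T x p.1.2 k)
        else sideForm (T x p.1.2) (e p) (T x p.1.1 k)
  have hQ : ∀ s, IsAffineOver F (Q s) := by
    rintro (⟨i, k, l⟩ | ⟨p, k⟩)
    · fin_cases l
      · exact (hT1 i k).neg
      · exact (hT2 i k).neg
      · exact ((hT1 i k).add (hT2 i k)).sub (isAffineOver_const F.one_mem)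
    · cases ho : o p
      · simp only [Q, ho]; exact hsideF _ _ _ _
      · simp only [Q, ho]; exact hsideF _ _ _ _
  let x₀ : ι × Bool → ℝ := fun s => if s.2 then (U s.1 0).2 else (U s.1 0).1
  have hT0 : ∀ i k, T x₀ i k = U i k := by
    intro i k
    ext <;> simp [T, x₀, w]
  have hT0' : ∀ i, T x₀ i = U i := fun i => funext (hT0 i)
  obtain ⟨y, hyF, hy⟩ := exists_affine_solution_mem Q hQ x₀ (by
    rintro (⟨i, k, l⟩ | ⟨p, k⟩)
    · have := hU.mem i k
      fin_cases l
      · simp only [Q, hT0]; exact this.1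
      · simp only [Q, hT0]; exact this.2
      · simp only [Q, hT0]; exact this.3
    · have := he p k
      simp only [Q, hT0']
      split_ifs at this ⊢ <;> exact this)
  refine ⟨T y, ⟨fun i => ?_, fun i k => ?_, fun i j hij => ?_⟩, fun i k => ?_⟩
  · obtain ⟨h1, h2, h3, h4, h5, h6⟩ := hU.tile i
    constructor <;> simpa only [hdiff]
  · exact ⟨hy (.inl (i, k, 0)), hy (.inl (i, k, 1)), hy (.inl (i, k, 2))⟩
  · have h1 := fun k => hy (.inr (⟨(i, j), hij⟩, k))
    cases ho : o ⟨(i, j), hij⟩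
    · right
      refine ⟨e ⟨(i, j), hij⟩, fun k => ?_⟩
      have := h1 k
      simp only [Q, ho, Bool.false_eq_true, if_false] at this
      exact this
    · left
      refine ⟨e ⟨(i, j), hij⟩, fun k => ?_⟩
      have := h1 k
      simp only [Q, ho, if_true] at this
      exact this
  · exact ⟨F.add_mem (hyF _) (hF i k).1, F.add_mem (hyF _) (hF i k).2⟩

end Tiling

/-! ### Packings with coordinates in a quadratic field -/

namespace Tiling

/-- The field `ℚ(√R)`. -/
noncomputable def quadField (R : ℕ) : Subfield ℝ where
  carrier := {x | ∃ p q : ℚ, x = p + q * √R}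
  zero_mem' := ⟨0, 0, by simp⟩
  one_mem' := ⟨1, 0, by simp⟩
  add_mem' := by
    rintro _ _ ⟨p, q, rfl⟩ ⟨p', q', rfl⟩
    exact ⟨p + p', q + q', by push_cast; ring⟩
  mul_mem' := by
    rintro _ _ ⟨p, q, rfl⟩ ⟨p', q', rfl⟩
    refine ⟨p * p' + q * q' * R, p * q' + q * p', ?_⟩
    have := Real.mul_self_sqrt (Nat.cast_nonneg (α := ℝ) R)
    push_cast
    linear_combination (q : ℝ) * q' * this
  neg_mem' := by
    rintro _ ⟨p, q, rfl⟩
    exact ⟨-p, -q, by push_cast; ring⟩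
  inv_mem' := by
    rintro _ ⟨p, q, rfl⟩
    have hr := Real.mul_self_sqrt (Nat.cast_nonneg (α := ℝ) R)
    by_cases h0 : (p : ℝ) + q * √R = 0
    · exact ⟨0, 0, by simp [h0]⟩
    by_cases h1 : (p : ℝ) - q * √R = 0
    -- here `√R` is rational or `q = 0`
    · refine ⟨1 / (2 * p), 0, ?_⟩
      have : (p : ℝ) + q * √R = 2 * p := by linarith
      rw [this]; push_cast; simp
    · refine ⟨p / (p ^ 2 - q ^ 2 * R), -q / (p ^ 2 - q ^ 2 * R), ?_⟩
      have h2 : (p : ℝ) ^ 2 - q ^ 2 * R = (p + q * √R) * (p - q * √R) := by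
        linear_combination (q : ℝ) ^ 2 * hr
      push_cast
      rw [h2]
      field_simp
      ring

lemma side_mem_quadField (N m : ℕ) : sideA N m ∈ quadField (rad N m) ∧
    sideB N m ∈ quadField (rad N m) ∧ sideC N m ∈ quadField (rad N m) := by
  refine ⟨⟨(3 * N + m ^ 2) / (4 * m * N), 1 / (4 * m * N), ?_⟩,
    ⟨(3 * N + m ^ 2) / (4 * m * N), -1 / (4 * m * N), ?_⟩,
    ⟨(3 * N - m ^ 2) / (2 * m * N), 0, ?_⟩⟩
  · rw [sideA]; push_cast; ring
  · rw [sideB]; push_cast; ring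
  · rw [sideC]; push_cast; ring

/-- The complex numbers with coordinates in `F`. -/
def LatticeMem (F : Subfield ℝ) (z : ℂ) : Prop := ∃ p, CoordMem F p ∧ z = ofCoord p

section LatticeMem

variable {F : Subfield ℝ} {z w : ℂ}

lemma LatticeMem.mul (hz : LatticeMem F z) (hw : LatticeMem F w) : LatticeMem F (z * w) := by
  obtain ⟨p, hp, rfl⟩ := hz
  obtain ⟨q, hq, rfl⟩ := hw
  refine ⟨(p.1 * q.1 - p.2 * q.2, p.1 * q.2 + p.2 * q.1 + p.2 * q.2), ⟨?_, ?_⟩, ?_⟩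
  · exact F.sub_mem (F.mul_mem hp.1 hq.1) (F.mul_mem hp.2 hq.2)
  · exact F.add_mem (F.add_mem (F.mul_mem hp.1 hq.2) (F.mul_mem hp.2 hq.1)) (F.mul_mem hp.2 hq.2)
  · simp only [ofCoord]; push_cast
    linear_combination (p.2 : ℂ) * q.2 * ω_sq

lemma latticeMem_one : LatticeMem F 1 := ⟨(1, 0), ⟨F.one_mem, F.zero_mem⟩, by simp [ofCoord]⟩

lemma latticeMem_ω : LatticeMem F ω := ⟨(0, 1), ⟨F.zero_mem, F.one_mem⟩, by simp [ofCoord]⟩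

lemma latticeMem_conj_ω : LatticeMem F ((starRingEnd ℂ) ω) :=
  ⟨(1, -1), ⟨F.one_mem, F.neg_mem F.one_mem⟩, by simp [ofCoord, conj_ω]; ring⟩

lemma latticeMem_ofReal {x : ℝ} (hx : x ∈ F) : LatticeMem F x :=
  ⟨(x, 0), ⟨hx, F.zero_mem⟩, by simp [ofCoord]⟩

lemma LatticeMem.pow (hz : LatticeMem F z) (n : ℕ) : LatticeMem F (z ^ n) := by
  induction n with
  | zero => simpa using latticeMem_one
  | succ n ih => rw [pow_succ]; exact ih.mul hz

lemma LatticeMem.zpow (hz : LatticeMem F z) (hz' : LatticeMem F z⁻¹) (k : ℤ) :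
    LatticeMem F (z ^ k) := by
  cases k with
  | ofNat n => simpa using hz.pow n
  | negSucc n => rw [zpow_negSucc, ← inv_pow]; exact hz'.pow _

lemma latticeMem_rot {a b c : ℝ} (ha : a ∈ F) (hb : b ∈ F) (hc : c ∈ F) :
    LatticeMem F (rot a b c) :=
  ⟨((b - a) / c, a / c), ⟨F.div_mem (F.sub_mem hb ha) hc, F.div_mem ha hc⟩, by
    rw [rot, conj_ω, ofCoord]; push_cast; ring⟩

lemma latticeMem_rot_inv {a b c : ℝ} (h : IsShape a b c) (ha : a ∈ F) (hb : b ∈ F) (hc : c ∈ F) :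
    LatticeMem F (rot a b c)⁻¹ :=
  ⟨(b / c, -a / c), ⟨F.div_mem hb hc, F.div_mem (F.neg_mem ha) hc⟩, by
    rw [← conj_rot_eq_inv h, conj_rot, ofCoord]; push_cast; ring⟩

lemma coord_ofCoord (p : ℝ × ℝ) : coord (ofCoord p) = p := by
  have : √3 ≠ 0 := by positivity
  ext <;> simp [ofCoord, coord, ω] <;> field_simp
  ring

lemma coord_sub (z w : ℂ) : coord (z - w) = coord z - coord w := by
  ext <;> simp [coord] <;> ring

lemma LatticeMem.coord (hz : LatticeMem F z) : CoordMem F (coord z) := by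
  obtain ⟨p, hp, rfl⟩ := hz
  rwa [coord_ofCoord]

end LatticeMem

/-- If there is a packing with tiles with sides in `F`, of the right area, there is one with
coordinates in `F`: the directions of all edges are products of powers of `ω` and `rot a b c`. -/
theorem exists_packing_mem_of_tiling {N : ℕ} {F : Subfield ℝ} {a b c : ℝ} (h : IsShape a b c)
    (ha : a ∈ F) (hb : b ∈ F) (hc : c ∈ F) {V : Fin N → Fin 3 → ℂ}
    (hcard : (N : ℝ) * (a * b) = 1) (hV : IsPacking a b c V) :
    ∃ U : Fin N → Fin 3 → ℝ × ℝ, ApproxPacking a b c 0 U ∧ ∀ i k, CoordMem F (U i k) := by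
  have hcard' : (Fintype.card (Fin N) : ℝ) * (a * b) = 1 := by rwa [Fintype.card_fin]
  have hU : ApproxPacking a b c 0 (fun i k => coord (V i k)) := by
    rw [← isPacking_iff h]
    simpa only [ofCoord_coord] using hV
  choose g hg h1 h2 using fun i => (hV.tile i).exists_dir h
  have ht := ((isTiling_iff_isPacking h hcard').2 hV).1
  refine exists_packing_mem hU fun i k => ?_
  rw [← coord_sub]
  refine LatticeMem.coord ?_
  have hgi : LatticeMem F (g i) := by
    obtain ⟨k, l, hkl⟩ := inDirGroup_of_tiling h hV.tile ht hg h1 h2 i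
    rw [hkl]
    refine LatticeMem.mul ?_ ?_
    · exact (latticeMem_rot ha hb hc).zpow (latticeMem_rot_inv h ha hb hc) k
    · exact latticeMem_ω.zpow (conj_ω_eq_inv ▸ latticeMem_conj_ω) l
  fin_cases k
  · simpa using latticeMem_ofReal (F := F) F.zero_mem
  · simp only [Fin.mk_one, h1 i, add_sub_cancel_left]
    exact (latticeMem_ofReal ha).mul hgi
  · rcases h2 i with h2 | h2
    · simp only [Fin.reduceFinMk, h2, add_sub_cancel_left]
      exact (latticeMem_ofReal hb).mul (hgi.mul latticeMem_ω)
    · simp only [Fin.reduceFinMk, h2, add_sub_cancel_left]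
      exact (latticeMem_ofReal hb).mul (hgi.mul latticeMem_conj_ω)

/-- Finitely many elements of `ℚ(√R)` have a common denominator. -/
lemma exists_common_den {κ : Type*} [Finite κ] {R : ℕ} (x : κ → ℝ) (hx : ∀ k, x k ∈ quadField R) :
    ∃ (q : ℕ) (y z : κ → ℤ), 0 < q ∧ ∀ k, x k = (y k + z k * √R) / q := by
  classical
  have := Fintype.ofFinite κ
  choose p s h using hx
  let q : ℕ := ∏ k, (p k).den * (s k).den
  have hq : 0 < q := Finset.prod_pos fun k _ => Nat.mul_pos (p k).den_pos (s k).den_pos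
  have hdvd : ∀ k, ∃ t : ℕ, q = (p k).den * (s k).den * t := fun k =>
    Finset.dvd_prod_of_mem (fun k => (p k).den * (s k).den) (Finset.mem_univ k)
  choose t ht using hdvd
  refine ⟨q, fun k => (p k).num * (s k).den * t k, fun k => (s k).num * (p k).den * t k, hq,
    fun k => ?_⟩
  have hq' : (q : ℝ) ≠ 0 := by exact_mod_cast hq.ne'
  have hp0 : ((p k).den : ℝ) ≠ 0 := by exact_mod_cast (p k).den_nz
  have hs0 : ((s k).den : ℝ) ≠ 0 := by exact_mod_cast (s k).den_nz
  have htk : (q : ℝ) = (p k).den * (s k).den * t k := by exact_mod_cast ht k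
  rw [eq_div_iff hq', h k, htk, Rat.cast_def (p k), Rat.cast_def (s k)]
  push_cast
  field_simp

end Tiling

/-! ### Codes, grids and compactness -/

namespace Tiling

open Filter Topology

/-- Real numbers in a natural-number code: the coordinate with index `κ` is made from four digits
of `l` in base `B`, as an element of `ℚ(√R)` with denominator `q + 1`. -/
noncomputable def decodeReal (R q B l κ : ℕ) : ℝ :=
  (((l / B ^ (4 * κ) % B : ℕ) - (l / B ^ (4 * κ + 1) % B : ℕ) : ℝ) +
    ((l / B ^ (4 * κ + 2) % B : ℕ) - (l / B ^ (4 * κ + 3) % B : ℕ) : ℝ) * √R) / (q + 1 : ℕ)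

/-- The `i`-th triangle of a coded configuration. -/
noncomputable def decodeTri (R q B l i : ℕ) (k : Fin 3) : ℝ × ℝ :=
  (decodeReal R q B l (6 * i + 2 * k), decodeReal R q B l (6 * i + 2 * k + 1))

/-- Every finite sequence of digits is the sequence of digits of a number. -/
lemma exists_code {B : ℕ} (hB : 0 < B) (K : ℕ) : ∀ d : ℕ → ℕ, (∀ k, d k < B) →
    ∃ l < B ^ K, ∀ k < K, l / B ^ k % B = d k := by
  induction K with
  | zero => exact fun d _ => ⟨0, by simp, by simp⟩
  | succ K ih =>
    intro d hd
    obtain ⟨l, hl, h⟩ := ih (fun k => d (k + 1)) fun k => hd _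
    refine ⟨B * l + d 0, ?_, fun k hk => ?_⟩
    · rw [pow_succ]
      calc B * l + d 0 < B * l + B := by have := hd 0; omega
        _ = (l + 1) * B := by ring
        _ ≤ B ^ K * B := Nat.mul_le_mul_right _ hl
    · rcases k with _ | k
      · simp [Nat.mod_eq_of_lt (hd 0)]
      · rw [pow_succ', ← Nat.div_div_eq_div_mul, Nat.mul_add_div hB, Nat.div_eq_of_lt (hd 0),
          add_zero, h k (by omega)]

/-- Codes for configurations with given numerators. -/
lemma exists_code_tri {N R q B : ℕ} (hB : 0 < B) (f : Fin N → Fin 3 → Fin 2 → Fin 4 → ℕ)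
    (hf : ∀ i k t s, f i k t s < B) :
    ∃ l < B ^ (24 * N), ∀ (i : Fin N) k, decodeTri R q B l i k =
      (((f i k 0 0 - f i k 0 1 : ℝ) + (f i k 0 2 - f i k 0 3 : ℝ) * √R) / (q + 1 : ℕ),
        ((f i k 1 0 - f i k 1 1 : ℝ) + (f i k 1 2 - f i k 1 3 : ℝ) * √R) / (q + 1 : ℕ)) := by
  let d : ℕ → ℕ := fun x => if h : x / 24 < N then
    f ⟨x / 24, h⟩ ⟨x / 8 % 3, Nat.mod_lt _ (by norm_num)⟩ ⟨x / 4 % 2, Nat.mod_lt _ (by norm_num)⟩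
      ⟨x % 4, Nat.mod_lt _ (by norm_num)⟩ else 0
  obtain ⟨l, hl, h⟩ := exists_code hB (24 * N) d (fun x => by
    simp only [d]; split_ifs
    · exact hf _ _ _ _
    · exact hB)
  refine ⟨l, hl, fun i k => ?_⟩
  have key : ∀ (t : Fin 2) (s : Fin 4),
      l / B ^ (4 * (6 * (i : ℕ) + 2 * k + t) + s) % B = f i k t s := by
    intro t s
    have hi := i.2
    have hk := k.2
    have ht := t.2
    have hs := s.2
    rw [h _ (by omega)]
    have e1 : (4 * (6 * (i : ℕ) + 2 * k + t) + s) / 24 = i := by omega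
    have e2 : (4 * (6 * (i : ℕ) + 2 * k + t) + s) / 8 % 3 = k := by omega
    have e3 : (4 * (6 * (i : ℕ) + 2 * k + t) + s) / 4 % 2 = t := by omega
    have e4 : (4 * (6 * (i : ℕ) + 2 * k + t) + s) % 4 = s := by omega
    simp only [d, e1, hi, dif_pos, e2, e3, e4, Fin.eta]
  have k00 := key 0 0
  have k01 := key 0 1
  have k02 := key 0 2
  have k03 := key 0 3
  have k10 := key 1 0
  have k11 := key 1 1
  have k12 := key 1 2
  have k13 := key 1 3
  simp only [Fin.val_zero, Fin.val_one, Fin.val_two, add_zero, Fin.isValue,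
    show ((3 : Fin 4) : ℕ) = 3 from rfl] at k00 k01 k02 k03 k10 k11 k12 k13
  simp only [decodeTri, decodeReal, k00, k01, k02, k03, k10, k11, k12, k13]

/-- Configurations with coordinates in `ℚ(√R)` have a code. -/
theorem exists_code_of_mem_quadField {N R : ℕ} {U : Fin N → Fin 3 → ℝ × ℝ}
    (hU : ∀ i k, CoordMem (quadField R) (U i k)) :
    ∃ q B l, ∀ (i : Fin N) k, decodeTri R q B l i k = U i k := by
  obtain ⟨q, y, z, hq, h⟩ := exists_common_den (R := R)
    (fun s : Fin N × Fin 3 × Fin 2 => if s.2.2 = 0 then (U s.1 s.2.1).1 else (U s.1 s.2.1).2)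
    (by
      rintro ⟨i, k, t⟩
      dsimp only
      split_ifs
      · exact (hU i k).1
      · exact (hU i k).2)
  obtain ⟨q, rfl⟩ : ∃ q', q = q' + 1 := ⟨q - 1, by omega⟩
  let f : Fin N → Fin 3 → Fin 2 → Fin 4 → ℕ := fun i k t s =>
    ![(y (i, k, t)).toNat, (-y (i, k, t)).toNat, (z (i, k, t)).toNat, (-z (i, k, t)).toNat] s
  obtain ⟨B, hB⟩ : ∃ B, ∀ i k t s, f i k t s < B := by
    refine ⟨(∑ i, ∑ k, ∑ t, ∑ s, f i k t s) + 1, fun i k t s => Nat.lt_succ_of_le ?_⟩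
    calc f i k t s ≤ ∑ s, f i k t s :=
          Finset.single_le_sum (fun _ _ => Nat.zero_le _) (Finset.mem_univ s)
      _ ≤ ∑ t, ∑ s, f i k t s := Finset.single_le_sum (f := fun t => ∑ s, f i k t s)
          (fun _ _ => Nat.zero_le _) (Finset.mem_univ t)
      _ ≤ ∑ k, ∑ t, ∑ s, f i k t s := Finset.single_le_sum (f := fun k => ∑ t, ∑ s, f i k t s)
          (fun _ _ => Nat.zero_le _) (Finset.mem_univ k)
      _ ≤ _ := Finset.single_le_sum (f := fun i => ∑ k, ∑ t, ∑ s, f i k t s)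
          (fun _ _ => Nat.zero_le _) (Finset.mem_univ i)
  obtain ⟨l, -, hl⟩ := exists_code_tri (R := R) (q := q) (B := B + 1) (Nat.succ_pos _) f
    (fun i k t s => (hB i k t s).trans (Nat.lt_succ_self _))
  refine ⟨q, B + 1, l, fun i k => ?_⟩
  rw [hl]
  have hz : ∀ x : ℤ, ((x.toNat : ℝ) - ((-x).toNat : ℝ)) = x := by
    intro x
    exact_mod_cast Int.toNat_sub_toNat_neg x
  have h0 := h (i, k, 0)
  have h1 := h (i, k, 1)
  simp only [if_true, one_ne_zero, if_false] at h0 h1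
  ext
  · rw [h0, ← hz, ← hz]; simp [f]
  · rw [h1, ← hz, ← hz]; simp [f]

lemma abs_mul_sub_mul_le {x y x' y' δ : ℝ} (hx : |x| ≤ 1) (hy' : |y'| ≤ 1)
    (h1 : |x - x'| ≤ δ) (h2 : |y - y'| ≤ δ) : |x * y - x' * y'| ≤ 2 * δ := by
  have : x * y - x' * y' = x * (y - y') + y' * (x - x') := by ring
  rw [this]
  calc |x * (y - y') + y' * (x - x')| ≤ |x| * |y - y'| + |y'| * |x - x'| := by
        rw [← abs_mul, ← abs_mul]; exact abs_add_le _ _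
    _ ≤ 1 * δ + 1 * δ := by gcongr
    _ = 2 * δ := by ring

/-- The exact conditions imply the approximate conditions for a nearby configuration. The error is
largest for the separation condition; the factor `32` is not optimal. -/
theorem ApproxPacking.of_near {ι : Type*} {a b c δ : ℝ} {U U' : ι → Fin 3 → ℝ × ℝ}
    (hU : ApproxPacking a b c 0 U)
    (h0 : ∀ i k, 0 ≤ (U' i k).1 ∧ 0 ≤ (U' i k).2)
    (h1 : ∀ i k, (U' i k).1 ≤ (U i k).1 ∧ (U' i k).2 ≤ (U i k).2)
    (h2 : ∀ i k, (U i k).1 ≤ (U' i k).1 + δ ∧ (U i k).2 ≤ (U' i k).2 + δ) :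
    ApproxPacking a b c (32 * δ) U' := by
  have hbox : ∀ i k, (U i k).1 ≤ 1 ∧ (U i k).2 ≤ 1 ∧ 0 ≤ (U i k).1 ∧ 0 ≤ (U i k).2 := by
    intro i k
    obtain ⟨m1, m2, m3⟩ := hU.mem i k
    exact ⟨by linarith, by linarith, by linarith, by linarith⟩
  have hd : ∀ i k j l, |(U i k - U j l).1| ≤ 1 ∧ |(U i k - U j l).2| ≤ 1 ∧
      |(U' i k - U' j l).1| ≤ 1 ∧ |(U' i k - U' j l).2| ≤ 1 ∧
      |(U i k - U j l).1 - (U' i k - U' j l).1| ≤ δ ∧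
      |(U i k - U j l).2 - (U' i k - U' j l).2| ≤ δ := by
    intro i k j l
    obtain ⟨p1, p2, p3, p4⟩ := hbox i k
    obtain ⟨q1, q2, q3, q4⟩ := hbox j l
    obtain ⟨r1, r2⟩ := h0 i k
    obtain ⟨s1, s2⟩ := h0 j l
    obtain ⟨t1, t2⟩ := h1 i k
    obtain ⟨u1, u2⟩ := h1 j l
    obtain ⟨v1, v2⟩ := h2 i k
    obtain ⟨w1, w2⟩ := h2 j l
    simp only [Prod.fst_sub, Prod.snd_sub, abs_le]
    refine ⟨⟨?_, ?_⟩, ⟨?_, ?_⟩, ⟨?_, ?_⟩, ⟨?_, ?_⟩, ⟨?_, ?_⟩, ⟨?_, ?_⟩⟩ <;> linarith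
  have hnorm : ∀ i k l, |normForm (U i k - U i l) - normForm (U' i k - U' i l)| ≤ 6 * δ := by
    intro i k l
    obtain ⟨d1, d2, d3, d4, d5, d6⟩ := hd i k i l
    have e1 := abs_le.1 (abs_mul_sub_mul_le d1 d3 d5 d5)
    have e2 := abs_le.1 (abs_mul_sub_mul_le d1 d4 d5 d6)
    have e3 := abs_le.1 (abs_mul_sub_mul_le d2 d4 d6 d6)
    unfold normForm
    rw [abs_le]
    constructor <;> linarith [e1.1, e1.2, e2.1, e2.2, e3.1, e3.2]
  have hdet : ∀ i k l j n n', |detForm (U i k - U i l) (U j n - U i n')| ≤ 2 ∧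
      |detForm (U' i k - U' i l) (U' j n - U' i n')| ≤ 2 ∧
      |detForm (U i k - U i l) (U j n - U i n') -
        detForm (U' i k - U' i l) (U' j n - U' i n')| ≤ 4 * δ := by
    intro i k l j n n'
    obtain ⟨d1, d2, d3, d4, d5, d6⟩ := hd i k i l
    obtain ⟨f1, f2, f3, f4, f5, f6⟩ := hd j n i n'
    have hm : ∀ {x y : ℝ}, |x| ≤ 1 → |y| ≤ 1 → |x * y| ≤ 1 := by
      intro x y hx hy
      rw [abs_mul]; exact mul_le_one₀ hx (abs_nonneg _) hy
    have e1 := abs_le.1 (abs_mul_sub_mul_le d1 f4 d5 f6)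
    have e2 := abs_le.1 (abs_mul_sub_mul_le d2 f3 d6 f5)
    have g1 := abs_le.1 (hm d1 f2)
    have g2 := abs_le.1 (hm d2 f1)
    have g3 := abs_le.1 (hm d3 f4)
    have g4 := abs_le.1 (hm d4 f3)
    unfold detForm
    simp only [abs_le]
    refine ⟨⟨?_, ?_⟩, ⟨?_, ?_⟩, ⟨?_, ?_⟩⟩ <;>
      linarith [e1.1, e1.2, e2.1, e2.2, g1.1, g1.2, g2.1, g2.2, g3.1, g3.2, g4.1, g4.2]
  have hδ : ∀ i : ι, 0 ≤ δ := by
    intro i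
    have := (h1 i 0).1
    have := (h2 i 0).1
    linarith
  have hside : ∀ i j e k, sideForm (U' i) e (U' j k) ≤ sideForm (U i) e (U j k) + 32 * δ := by
    intro i j e k
    obtain ⟨a1, a2, a3⟩ := hdet i 1 0 i 2 0
    obtain ⟨b1, b2, b3⟩ := hdet i (e + 1) e j k e
    have := hδ i
    unfold sideForm areaForm
    generalize detForm (U i 1 - U i 0) (U i 2 - U i 0) = A at *
    generalize detForm (U' i 1 - U' i 0) (U' i 2 - U' i 0) = A' at *
    generalize detForm (U i (e + 1) - U i e) (U j k - U i e) = D at *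
    generalize detForm (U' i (e + 1) - U' i e) (U' j k - U' i e) = D' at *
    have h3 : A * D - A' * D' = A * (D - D') + D' * (A - A') := by ring
    have h4 : |A * D - A' * D'| ≤ 16 * δ := by
      rw [h3]
      calc |A * (D - D') + D' * (A - A')| ≤ |A| * |D - D'| + |D'| * |A - A'| := by
            rw [← abs_mul, ← abs_mul]; exact abs_add_le _ _
        _ ≤ 2 * (4 * δ) + 2 * (4 * δ) := by gcongr
        _ = 16 * δ := by ring
    have := (abs_le.1 h4).1
    linarith
  refine ⟨fun i => ?_, fun i k => ?_, fun i j hij => ?_⟩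
  · obtain ⟨t1, t2, t3, t4, t5, t6⟩ := hU.tile i
    have := hδ i
    have n1 := abs_le.1 (hnorm i 1 0)
    have n2 := abs_le.1 (hnorm i 2 0)
    have n3 := abs_le.1 (hnorm i 2 1)
    constructor <;> linarith [n1.1, n1.2, n2.1, n2.2, n3.1, n3.2]
  · obtain ⟨m1, m2, m3⟩ := hU.mem i k
    have := hδ i
    have := h0 i k
    have := h1 i k
    constructor <;> linarith
  · rcases hU.sep i j hij with ⟨e, he⟩ | ⟨e, he⟩
    · exact Or.inl ⟨e, fun k => (hside i j e k).trans (by linarith [he k])⟩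
    · exact Or.inr ⟨e, fun k => (hside j i e k).trans (by linarith [he k])⟩

/-- An exact packing gives an approximate one among the configurations on the grid. -/
theorem exists_grid_of_packing {N : ℕ} {a b c : ℝ} {U : Fin N → Fin 3 → ℝ × ℝ}
    (hU : ApproxPacking a b c 0 U) (R n : ℕ) :
    ∃ l < (n + 2) ^ (24 * N), ApproxPacking a b c (32 / (n + 1 : ℕ))
      (fun i : Fin N => decodeTri R n (n + 2) l i) := by
  let x : Fin N → Fin 3 → Fin 2 → ℝ := fun i k t => if t = 0 then (U i k).1 else (U i k).2
  have hx : ∀ i k t, 0 ≤ x i k t ∧ x i k t ≤ 1 := by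
    intro i k t
    obtain ⟨m1, m2, m3⟩ := hU.mem i k
    simp only [x]; split_ifs <;> constructor <;> linarith
  have hn : (0 : ℝ) < (n + 1 : ℕ) := by positivity
  let f : Fin N → Fin 3 → Fin 2 → Fin 4 → ℕ := fun i k t s =>
    if s = 0 then ⌊x i k t * (n + 1 : ℕ)⌋₊ else 0
  obtain ⟨l, hl, h⟩ := exists_code_tri (R := R) (q := n) (B := n + 2) (by omega) f (by
    intro i k t s
    simp only [f]
    split_ifs
    · have : ⌊x i k t * (n + 1 : ℕ)⌋₊ ≤ n + 1 := by
        apply Nat.floor_le_of_le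
        have := mul_le_mul_of_nonneg_right (hx i k t).2 hn.le
        linarith
      omega
    · omega)
  refine ⟨l, hl, ?_⟩
  have hfl : ∀ i k t, 0 ≤ (⌊x i k t * (n + 1 : ℕ)⌋₊ : ℝ) / (n + 1 : ℕ) ∧
      (⌊x i k t * (n + 1 : ℕ)⌋₊ : ℝ) / (n + 1 : ℕ) ≤ x i k t ∧
      x i k t ≤ (⌊x i k t * (n + 1 : ℕ)⌋₊ : ℝ) / (n + 1 : ℕ) + 1 / (n + 1 : ℕ) := by
    intro i k t
    refine ⟨by positivity, ?_, ?_⟩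
    · rw [div_le_iff₀ hn]; exact Nat.floor_le (mul_nonneg (hx i k t).1 hn.le)
    · rw [← add_div, le_div_iff₀ hn]; exact (Nat.lt_floor_add_one _).le
  have hdec : ∀ i : Fin N, ∀ k, decodeTri R n (n + 2) l i k =
      ((⌊x i k 0 * (n + 1 : ℕ)⌋₊ : ℝ) / (n + 1 : ℕ),
        (⌊x i k 1 * (n + 1 : ℕ)⌋₊ : ℝ) / (n + 1 : ℕ)) := by
    intro i k
    rw [h]; simp [f]
  rw [div_eq_mul_one_div]
  refine ApproxPacking.of_near hU ?_ ?_ ?_ <;> intro i k <;> rw [hdec]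
  · exact ⟨(hfl i k 0).1, (hfl i k 1).1⟩
  · exact ⟨(hfl i k 0).2.1, (hfl i k 1).2.1⟩
  · exact ⟨(hfl i k 0).2.2, (hfl i k 1).2.2⟩

lemma isClosed_approxPacking (ι : Type*) (a b c : ℝ) :
    IsClosed {p : ℝ × (ι → Fin 3 → ℝ × ℝ) | ApproxPacking a b c p.1 p.2} := by
  have h : {p : ℝ × (ι → Fin 3 → ℝ × ℝ) | ApproxPacking a b c p.1 p.2} =
      (⋂ i, {p | ApproxTile a b c p.1 (p.2 i)}) ∩ (⋂ i, ⋂ k, {p | ApproxMem p.1 (p.2 i k)}) ∩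
        ⋂ i, ⋂ j, ⋂ _ : i ≠ j, ({p | ApproxSep p.1 (p.2 i) (p.2 j)} ∪
          {p | ApproxSep p.1 (p.2 j) (p.2 i)}) := by
    ext p
    simp only [Set.mem_ofPred_eq, Set.mem_inter_iff, Set.mem_iInter, Set.mem_union]
    exact ⟨fun ⟨h1, h2, h3⟩ => ⟨⟨h1, h2⟩, h3⟩, fun ⟨⟨h1, h2⟩, h3⟩ => ⟨h1, h2, h3⟩⟩
  have hnorm : ∀ (i : ι) (k l : Fin 3), Continuous
      fun p : ℝ × (ι → Fin 3 → ℝ × ℝ) => normForm (p.2 i k - p.2 i l) := by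
    intro i k l; unfold normForm; fun_prop
  have hsep : ∀ i j, IsClosed {p : ℝ × (ι → Fin 3 → ℝ × ℝ) | ApproxSep p.1 (p.2 i) (p.2 j)} := by
    intro i j
    simp only [ApproxSep, Set.ofPred_exists, Set.ofPred_forall]
    refine isClosed_iUnion_of_finite fun e => isClosed_iInter fun k => isClosed_le ?_ continuous_fst
    unfold sideForm areaForm detForm
    fun_prop
  rw [h]
  refine (IsClosed.inter ?_ ?_).inter ?_
  · refine isClosed_iInter fun i => ?_
    have : {p : ℝ × (ι → Fin 3 → ℝ × ℝ) | ApproxTile a b c p.1 (p.2 i)} =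
        {p | normForm (p.2 i 1 - p.2 i 0) - a * a ≤ p.1} ∩
        {p | a * a - normForm (p.2 i 1 - p.2 i 0) ≤ p.1} ∩
        {p | normForm (p.2 i 2 - p.2 i 0) - b * b ≤ p.1} ∩
        {p | b * b - normForm (p.2 i 2 - p.2 i 0) ≤ p.1} ∩
        {p | normForm (p.2 i 2 - p.2 i 1) - c * c ≤ p.1} ∩
        {p | c * c - normForm (p.2 i 2 - p.2 i 1) ≤ p.1} := by
      ext p
      exact ⟨fun ⟨h1, h2, h3, h4, h5, h6⟩ => ⟨⟨⟨⟨⟨h1, h2⟩, h3⟩, h4⟩, h5⟩, h6⟩,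
        fun ⟨⟨⟨⟨⟨h1, h2⟩, h3⟩, h4⟩, h5⟩, h6⟩ => ⟨h1, h2, h3, h4, h5, h6⟩⟩
    rw [this]
    have h1 := hnorm i
    refine (((((isClosed_le ?_ ?_).inter (isClosed_le ?_ ?_)).inter (isClosed_le ?_ ?_)).inter
      (isClosed_le ?_ ?_)).inter (isClosed_le ?_ ?_)).inter (isClosed_le ?_ ?_) <;> fun_prop
  · refine isClosed_iInter fun i => isClosed_iInter fun k => ?_
    have : {p : ℝ × (ι → Fin 3 → ℝ × ℝ) | ApproxMem p.1 (p.2 i k)} =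
        {p | -(p.2 i k).1 ≤ p.1} ∩ {p | -(p.2 i k).2 ≤ p.1} ∩
        {p | (p.2 i k).1 + (p.2 i k).2 - 1 ≤ p.1} := by
      ext p
      exact ⟨fun ⟨h1, h2, h3⟩ => ⟨⟨h1, h2⟩, h3⟩, fun ⟨⟨h1, h2⟩, h3⟩ => ⟨h1, h2, h3⟩⟩
    rw [this]
    refine ((isClosed_le ?_ ?_).inter (isClosed_le ?_ ?_)).inter (isClosed_le ?_ ?_) <;> fun_prop
  · exact isClosed_iInter fun i => isClosed_iInter fun j => isClosed_iInter fun _ =>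
      (hsep i j).union (hsep j i)

/-- Compactness: approximate packings of arbitrary precision yield an exact packing. -/
theorem exists_packing_of_approx {N : ℕ} {a b c : ℝ} (U : ℕ → Fin N → Fin 3 → ℝ × ℝ)
    (hU : ∀ n, ApproxPacking a b c (32 / (n + 1 : ℕ)) (U n)) :
    ∃ U', ApproxPacking a b c 0 (U' : Fin N → Fin 3 → ℝ × ℝ) := by
  have hb : ∀ n, U n ∈ Metric.closedBall (0 : Fin N → Fin 3 → ℝ × ℝ) 100 := by
    intro n
    have he : (32 : ℝ) / (n + 1 : ℕ) ≤ 32 :=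
      div_le_self (by norm_num) (by push_cast; linarith [n.cast_nonneg (α := ℝ)])
    rw [mem_closedBall_zero_iff, pi_norm_le_iff_of_nonneg (by norm_num)]
    intro i
    rw [pi_norm_le_iff_of_nonneg (by norm_num)]
    intro k
    obtain ⟨m1, m2, m3⟩ := (hU n).mem i k
    rw [Prod.norm_def, max_le_iff, Real.norm_eq_abs, Real.norm_eq_abs, abs_le, abs_le]
    refine ⟨⟨?_, ?_⟩, ⟨?_, ?_⟩⟩ <;> linarith
  obtain ⟨U', -, φ, hφ, hlim⟩ := (isCompact_closedBall _ _).tendsto_subseq hb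
  have he : Tendsto (fun n : ℕ => (32 : ℝ) / (n + 1 : ℕ)) atTop (𝓝 0) :=
    (tendsto_const_div_atTop_nhds_zero_nat 32).comp (tendsto_add_atTop_nat 1)
  have := (isClosed_approxPacking (Fin N) a b c).mem_of_tendsto
    ((he.comp hφ.tendsto_atTop).prodMk_nhds hlim) (Eventually.of_forall fun n => hU (φ n))
  exact ⟨U', this⟩

end Tiling

/-! ### Primitive recursive arithmetic in a quadratic field -/

namespace Tiling

section Rep

variable {α : Type*} [Primcodable α]

/-- Real-valued functions with values in `ℚ(√R)` whose coefficients and denominators are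
primitive recursive. -/
def Rep (R : α → ℕ) (φ : α → ℝ) : Prop :=
  ∃ g₁ h₁ g₂ h₂ d : α → ℕ, Primrec g₁ ∧ Primrec h₁ ∧ Primrec g₂ ∧ Primrec h₂ ∧ Primrec d ∧
    ∀ a, φ a = ((g₁ a - h₁ a : ℝ) + (g₂ a - h₂ a : ℝ) * √(R a)) / (d a + 1 : ℕ)

variable {R : α → ℕ} {φ ψ : α → ℝ}

lemma primrec_add {f g : α → ℕ} (hf : Primrec f) (hg : Primrec g) : Primrec fun a => f a + g a :=
  Primrec.nat_add.comp hf hg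

lemma primrec_mul {f g : α → ℕ} (hf : Primrec f) (hg : Primrec g) : Primrec fun a => f a * g a :=
  Primrec.nat_mul.comp hf hg

lemma primrec_sub {f g : α → ℕ} (hf : Primrec f) (hg : Primrec g) : Primrec fun a => f a - g a :=
  Primrec.nat_sub.comp hf hg

lemma primrec_pow {f g : α → ℕ} (hf : Primrec f) (hg : Primrec g) : Primrec fun a => f a ^ g a := by
  have h : Primrec₂ ((· ^ ·) : ℕ → ℕ → ℕ) := by
    refine (Primrec.nat_rec (f := fun _ : ℕ => 1) (g := fun x p => p.2 * x) (Primrec.const 1)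
      (primrec_mul (Primrec.snd.comp Primrec.snd) Primrec.fst).to₂).of_eq fun x n => ?_
    induction n with
    | zero => simp
    | succ n ih => simp only [pow_succ] at ih ⊢; rw [ih]
  exact h.comp hf hg

lemma rep_natCast {f : α → ℕ} (hf : Primrec f) : Rep R fun a => (f a : ℝ) :=
  ⟨f, fun _ => 0, fun _ => 0, fun _ => 0, fun _ => 0, hf, Primrec.const _, Primrec.const _,
    Primrec.const _, Primrec.const _, by simp⟩

lemma rep_sqrt : Rep R fun a => √(R a) :=
  ⟨fun _ => 0, fun _ => 0, fun _ => 1, fun _ => 0, fun _ => 0, Primrec.const _, Primrec.const _,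
    Primrec.const _, Primrec.const _, Primrec.const _, by simp⟩

lemma Rep.neg (hφ : Rep R φ) : Rep R fun a => -φ a := by
  obtain ⟨g₁, h₁, g₂, h₂, d, pg₁, ph₁, pg₂, ph₂, pd, h⟩ := hφ
  refine ⟨h₁, g₁, h₂, g₂, d, ph₁, pg₁, ph₂, pg₂, pd, fun a => ?_⟩
  dsimp only
  rw [h]; ring

lemma Rep.add (hφ : Rep R φ) (hψ : Rep R ψ) : Rep R fun a => φ a + ψ a := by
  obtain ⟨g₁, h₁, g₂, h₂, d, pg₁, ph₁, pg₂, ph₂, pd, h⟩ := hφ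
  obtain ⟨g₁', h₁', g₂', h₂', d', pg₁', ph₁', pg₂', ph₂', pd', h'⟩ := hψ
  have q := Primrec.succ.comp pd
  have q' := Primrec.succ.comp pd'
  refine ⟨fun a => g₁ a * (d' a + 1) + g₁' a * (d a + 1),
    fun a => h₁ a * (d' a + 1) + h₁' a * (d a + 1),
    fun a => g₂ a * (d' a + 1) + g₂' a * (d a + 1),
    fun a => h₂ a * (d' a + 1) + h₂' a * (d a + 1),
    fun a => d a * d' a + d a + d' a,
    primrec_add (primrec_mul pg₁ q') (primrec_mul pg₁' q),
    primrec_add (primrec_mul ph₁ q') (primrec_mul ph₁' q),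
    primrec_add (primrec_mul pg₂ q') (primrec_mul pg₂' q),
    primrec_add (primrec_mul ph₂ q') (primrec_mul ph₂' q),
    primrec_add (primrec_add (primrec_mul pd pd') pd) pd', fun a => ?_⟩
  dsimp only
  rw [h, h', show d a * d' a + d a + d' a + 1 = (d a + 1) * (d' a + 1) by ring]
  have e1 : ((d a + 1 : ℕ) : ℝ) ≠ 0 := by positivity
  have e2 : ((d' a + 1 : ℕ) : ℝ) ≠ 0 := by positivity
  push_cast at *
  field_simp
  ring

lemma Rep.mul (hR : Primrec R) (hφ : Rep R φ) (hψ : Rep R ψ) : Rep R fun a => φ a * ψ a := by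
  obtain ⟨g₁, h₁, g₂, h₂, d, pg₁, ph₁, pg₂, ph₂, pd, h⟩ := hφ
  obtain ⟨g₁', h₁', g₂', h₂', d', pg₁', ph₁', pg₂', ph₂', pd', h'⟩ := hψ
  refine ⟨fun a => g₁ a * g₁' a + h₁ a * h₁' a + R a * (g₂ a * g₂' a + h₂ a * h₂' a),
    fun a => g₁ a * h₁' a + h₁ a * g₁' a + R a * (g₂ a * h₂' a + h₂ a * g₂' a),
    fun a => g₁ a * g₂' a + h₁ a * h₂' a + (g₂ a * g₁' a + h₂ a * h₁' a),
    fun a => g₁ a * h₂' a + h₁ a * g₂' a + (g₂ a * h₁' a + h₂ a * g₁' a),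
    fun a => d a * d' a + d a + d' a,
    primrec_add (primrec_add (primrec_mul pg₁ pg₁') (primrec_mul ph₁ ph₁'))
      (primrec_mul hR (primrec_add (primrec_mul pg₂ pg₂') (primrec_mul ph₂ ph₂'))),
    primrec_add (primrec_add (primrec_mul pg₁ ph₁') (primrec_mul ph₁ pg₁'))
      (primrec_mul hR (primrec_add (primrec_mul pg₂ ph₂') (primrec_mul ph₂ pg₂'))),
    primrec_add (primrec_add (primrec_mul pg₁ pg₂') (primrec_mul ph₁ ph₂'))
      (primrec_add (primrec_mul pg₂ pg₁') (primrec_mul ph₂ ph₁')),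
    primrec_add (primrec_add (primrec_mul pg₁ ph₂') (primrec_mul ph₁ pg₂'))
      (primrec_add (primrec_mul pg₂ ph₁') (primrec_mul ph₂ pg₁')),
    primrec_add (primrec_add (primrec_mul pd pd') pd) pd', fun a => ?_⟩
  dsimp only
  rw [h, h', show d a * d' a + d a + d' a + 1 = (d a + 1) * (d' a + 1) by ring, div_mul_div_comm,
    Nat.cast_mul]
  congr 1
  have := Real.mul_self_sqrt (Nat.cast_nonneg (α := ℝ) (R a))
  push_cast
  linear_combination ((g₂ a - h₂ a : ℝ) * (g₂' a - h₂' a)) * this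

lemma Rep.sub (hφ : Rep R φ) (hψ : Rep R ψ) : Rep R fun a => φ a - ψ a := by
  simpa only [sub_eq_add_neg] using hφ.add hψ.neg

lemma Rep.div_nat {f : α → ℕ} (hφ : Rep R φ) (hf : Primrec f) : Rep R fun a => φ a / f a := by
  obtain ⟨g₁, h₁, g₂, h₂, d, pg₁, ph₁, pg₂, ph₂, pd, h⟩ := hφ
  -- `1 - (1 - f a)` is `0` if `f a = 0` and `1` otherwise
  have ps : Primrec fun a => 1 - (1 - f a) :=
    primrec_sub (Primrec.const 1) (primrec_sub (Primrec.const 1) hf)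
  refine ⟨fun a => g₁ a * (1 - (1 - f a)), fun a => h₁ a * (1 - (1 - f a)),
    fun a => g₂ a * (1 - (1 - f a)), fun a => h₂ a * (1 - (1 - f a)),
    fun a => (d a + 1) * f a - 1, primrec_mul pg₁ ps, primrec_mul ph₁ ps, primrec_mul pg₂ ps,
    primrec_mul ph₂ ps,
    primrec_sub (primrec_mul (Primrec.succ.comp pd) hf) (Primrec.const 1), fun a => ?_⟩
  dsimp only
  rw [h]
  rcases (f a).eq_zero_or_pos with h0 | h0
  · simp [h0]
  · have e1 : 1 - (1 - f a) = 1 := by omega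
    have e2 : (d a + 1) * f a - 1 + 1 = (d a + 1) * f a :=
      Nat.sub_add_cancel (Nat.mul_pos (Nat.succ_pos _) h0)
    rw [e1, e2, Nat.cast_mul, div_div]
    simp

/-- The sign of a function with values in `ℚ(√R)` can be decided. -/
lemma Rep.nonpos (hR : Primrec R) (hφ : Rep R φ) : PrimrecPred fun a => φ a ≤ 0 := by
  obtain ⟨g₁, h₁, g₂, h₂, d, pg₁, ph₁, pg₂, ph₂, pd, h⟩ := hφ
  have q₁ : Primrec fun a => g₁ a * g₁ a + h₁ a * h₁ a + R a * (2 * (g₂ a * h₂ a)) :=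
    primrec_add (primrec_add (primrec_mul pg₁ pg₁) (primrec_mul ph₁ ph₁))
      (primrec_mul hR (primrec_mul (Primrec.const 2) (primrec_mul pg₂ ph₂)))
  have q₂ : Primrec fun a => R a * (g₂ a * g₂ a + h₂ a * h₂ a) + 2 * (g₁ a * h₁ a) :=
    primrec_add (primrec_mul hR (primrec_add (primrec_mul pg₂ pg₂) (primrec_mul ph₂ ph₂)))
      (primrec_mul (Primrec.const 2) (primrec_mul pg₁ ph₁))
  have key : PrimrecPred fun a =>
      (g₁ a ≤ h₁ a ∧ g₂ a ≤ h₂ a) ∨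
      (g₁ a ≤ h₁ a ∧ h₂ a ≤ g₂ a ∧ R a * (g₂ a * g₂ a + h₂ a * h₂ a) + 2 * (g₁ a * h₁ a) ≤
        g₁ a * g₁ a + h₁ a * h₁ a + R a * (2 * (g₂ a * h₂ a))) ∨
      (h₁ a ≤ g₁ a ∧ g₂ a ≤ h₂ a ∧ g₁ a * g₁ a + h₁ a * h₁ a + R a * (2 * (g₂ a * h₂ a)) ≤
        R a * (g₂ a * g₂ a + h₂ a * h₂ a) + 2 * (g₁ a * h₁ a)) :=
    ((Primrec.nat_le.comp pg₁ ph₁).and (Primrec.nat_le.comp pg₂ ph₂)).or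
      (((Primrec.nat_le.comp pg₁ ph₁).and
        ((Primrec.nat_le.comp ph₂ pg₂).and (Primrec.nat_le.comp q₂ q₁))).or
      ((Primrec.nat_le.comp ph₁ pg₁).and
        ((Primrec.nat_le.comp pg₂ ph₂).and (Primrec.nat_le.comp q₁ q₂))))
  refine key.of_eq fun a => ?_
  rw [h, div_le_iff₀ (by positivity), zero_mul]
  have hr0 : 0 ≤ √(R a) := Real.sqrt_nonneg _
  have hr := Real.mul_self_sqrt (Nat.cast_nonneg (α := ℝ) (R a))
  rify
  generalize √(R a) = r at *
  generalize (R a : ℝ) = ρ at *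
  generalize (g₁ a : ℝ) = a₁ at *
  generalize (h₁ a : ℝ) = b₁ at *
  generalize (g₂ a : ℝ) = a₂ at *
  generalize (h₂ a : ℝ) = b₂ at *
  subst hr
  constructor
  · rintro (⟨h1, h2⟩ | ⟨h1, h2, h3⟩ | ⟨h1, h2, h3⟩)
    · have := mul_nonneg (sub_nonneg.2 h2) hr0
      linarith
    · have : ((a₂ - b₂) * r) ^ 2 ≤ (b₁ - a₁) ^ 2 := by linarith
      have := abs_le_of_sq_le_sq this (by linarith)
      linarith [le_abs_self ((a₂ - b₂) * r)]
    · have : (a₁ - b₁) ^ 2 ≤ ((b₂ - a₂) * r) ^ 2 := by linarith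
      have := abs_le_of_sq_le_sq this (mul_nonneg (by linarith) hr0)
      linarith [le_abs_self (a₁ - b₁)]
  · intro h0
    rcases le_total a₁ b₁ with h1 | h1
    · rcases le_total a₂ b₂ with h2 | h2
      · exact Or.inl ⟨h1, h2⟩
      · refine Or.inr (Or.inl ⟨h1, h2, ?_⟩)
        have h3 : (a₂ - b₂) * r ≤ b₁ - a₁ := by linarith
        have := mul_self_le_mul_self (mul_nonneg (by linarith) hr0) h3
        linarith
    · rcases le_total a₂ b₂ with h2 | h2
      · refine Or.inr (Or.inr ⟨h1, h2, ?_⟩)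
        have h3 : a₁ - b₁ ≤ (b₂ - a₂) * r := by linarith
        have := mul_self_le_mul_self (by linarith) h3
        linarith
      · have := mul_nonneg (sub_nonneg.2 h2) hr0
        -- both summands vanish
        have e1 : a₁ = b₁ := by linarith
        have e2 : (a₂ - b₂) * r = 0 := by linarith
        refine Or.inr (Or.inl ⟨h1.antisymm (by linarith) |>.symm ▸ le_rfl, h2, ?_⟩)
        have : ((a₂ - b₂) * r) ^ 2 = 0 := by rw [e2]; ring
        rw [e1]
        linarith

lemma Rep.le (hR : Primrec R) (hφ : Rep R φ) (hψ : Rep R ψ) : PrimrecPred fun a => φ a ≤ ψ a :=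
  ((hφ.sub hψ).nonpos hR).of_eq fun a => by rw [sub_nonpos]

lemma Rep.eq (hR : Primrec R) (hφ : Rep R φ) (hψ : Rep R ψ) : PrimrecPred fun a => φ a = ψ a :=
  ((hφ.le hR hψ).and (hψ.le hR hφ)).of_eq fun a => by rw [le_antisymm_iff]

/-- Points whose coordinates are `Rep`. -/
def RepPt (R : α → ℕ) (p : α → ℝ × ℝ) : Prop := Rep R (fun a => (p a).1) ∧ Rep R fun a => (p a).2

variable {p q : α → ℝ × ℝ}

lemma RepPt.sub (hp : RepPt R p) (hq : RepPt R q) : RepPt R fun a => p a - q a :=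
  ⟨hp.1.sub hq.1, hp.2.sub hq.2⟩

lemma RepPt.normForm (hR : Primrec R) (hp : RepPt R p) : Rep R fun a => normForm (p a) :=
  ((hp.1.mul hR hp.1).add (hp.1.mul hR hp.2)).add (hp.2.mul hR hp.2)

lemma RepPt.detForm (hR : Primrec R) (hp : RepPt R p) (hq : RepPt R q) :
    Rep R fun a => detForm (p a) (q a) :=
  (hp.1.mul hR hq.2).sub (hp.2.mul hR hq.1)

end Rep

section Quantifiers

variable {α : Type*} [Primcodable α]

lemma primrecPred_forall_lt {N : α → ℕ} {P : α → ℕ → Prop} (hN : Primrec N)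
    (hP : PrimrecPred fun x : α × ℕ => P x.1 x.2) : PrimrecPred fun a => ∀ i < N a, P a i := by
  have h : PrimrecRel fun (i : ℕ) (a : α) => P a i :=
    hP.comp (Primrec.pair Primrec.snd Primrec.fst)
  exact (h.forall_mem_list.comp (Primrec.list_range.comp hN) Primrec.id).of_eq fun a => by simp

lemma primrecPred_exists_lt {N : α → ℕ} {P : α → ℕ → Prop} (hN : Primrec N)
    (hP : PrimrecPred fun x : α × ℕ => P x.1 x.2) : PrimrecPred fun a => ∃ i < N a, P a i := by
  have h : PrimrecRel fun (i : ℕ) (a : α) => P a i :=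
    hP.comp (Primrec.pair Primrec.snd Primrec.fst)
  exact (h.exists_mem_list.comp (Primrec.list_range.comp hN) Primrec.id).of_eq fun a => by simp

lemma primrecPred_forall_fin {P : Fin 3 → α → Prop} (h : ∀ k, PrimrecPred (P k)) :
    PrimrecPred fun a => ∀ k, P k a :=
  ((h 0).and ((h 1).and (h 2))).of_eq fun a => by simp [Fin.forall_fin_succ]

lemma primrecPred_exists_fin {P : Fin 3 → α → Prop} (h : ∀ k, PrimrecPred (P k)) :
    PrimrecPred fun a => ∃ k, P k a :=
  ((h 0).or ((h 1).or (h 2))).of_eq fun a => by simp [Fin.exists_fin_succ]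

end Quantifiers

end Tiling

/-! ### Deciding whether there is a packing -/

namespace Tiling

/-- The coded configuration is a packing by tiles with parameters `N`, `m`, up to an
error `e / (q + 1)`. -/
def CodedPacking (N m q B l e : ℕ) : Prop :=
  ApproxPacking (sideA N m) (sideB N m) (sideC N m) ((e : ℝ) / (q + 1 : ℕ))
    (fun i : Fin N => decodeTri (rad N m) q B l i)

/-- The parameters `N`, `m` belong to a tile with angles that are not rational multiples of `π`;
that the `120`-th power is enough to see this is `rot_side_root_iff`. -/
def IsIrrationalParam (N m : ℕ) : Prop :=
  0 < m ∧ m ^ 2 ≤ N ∧ rot (sideA N m) (sideB N m) (sideC N m) ^ 120 ≠ 1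

/-- The coordinates of the `n`-th power of a complex number with coordinates `p`. -/
def powCoord (p : ℝ × ℝ) : ℕ → ℝ × ℝ
  | 0 => (1, 0)
  | n + 1 => ((powCoord p n).1 * p.1 - (powCoord p n).2 * p.2,
      (powCoord p n).1 * p.2 + (powCoord p n).2 * p.1 + (powCoord p n).2 * p.2)

lemma ofCoord_powCoord (p : ℝ × ℝ) (n : ℕ) : ofCoord (powCoord p n) = ofCoord p ^ n := by
  induction n with
  | zero => simp [powCoord, ofCoord]
  | succ n ih =>
    rw [pow_succ, ← ih]
    simp only [powCoord, ofCoord]; push_cast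
    linear_combination -((powCoord p n).2 : ℂ) * p.2 * ω_sq

lemma rot_pow_eq_one_iff {a b c : ℝ} (h : IsShape a b c) (n : ℕ) :
    rot a b c ^ n = 1 ↔ powCoord (b - a, a) n = powCoord (c, 0) n := by
  have hc : (c : ℂ) ≠ 0 := by exact_mod_cast h.pos_c.ne'
  have h1 : rot a b c = ofCoord (b - a, a) / ofCoord (c, 0) := by
    simp only [rot, conj_ω, ofCoord]; push_cast; simp; ring
  have h2 : ofCoord (c, 0) ≠ 0 := by simpa [ofCoord] using hc
  rw [h1, div_pow, div_eq_one_iff_eq (pow_ne_zero _ h2), ← ofCoord_powCoord, ← ofCoord_powCoord]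
  exact (Function.LeftInverse.injective coord_ofCoord).eq_iff

section Primrec

variable {α : Type*} [Primcodable α]

lemma Rep.congr {R : α → ℕ} {φ ψ : α → ℝ} (hφ : Rep R φ) (h : ∀ a, φ a = ψ a) : Rep R ψ :=
  (funext h : φ = ψ) ▸ hφ

lemma RepPt.powCoord {R : α → ℕ} (hR : Primrec R) {p : α → ℝ × ℝ} (hp : RepPt R p) (n : ℕ) :
    RepPt R fun a => powCoord (p a) n := by
  induction n with
  | zero =>
    exact ⟨(rep_natCast (Primrec.const 1)).congr fun a => by simp [Tiling.powCoord],
      (rep_natCast (Primrec.const 0)).congr fun a => by simp [Tiling.powCoord]⟩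
  | succ n ih =>
    exact ⟨(ih.1.mul hR hp.1).sub (ih.2.mul hR hp.2),
      ((ih.1.mul hR hp.2).add (ih.2.mul hR hp.1)).add (ih.2.mul hR hp.2)⟩

variable {N m q B l e : α → ℕ}

lemma primrec_rad (hN : Primrec N) (hm : Primrec m) : Primrec fun a => rad (N a) (m a) := by
  have h2 := primrec_pow hm (Primrec.const 2)
  exact primrec_mul (primrec_sub (primrec_mul (Primrec.const 9) hN) h2) (primrec_sub hN h2)

lemma rep_side (hN : Primrec N) (hm : Primrec m) :
    Rep (fun a => rad (N a) (m a)) (fun a => sideA (N a) (m a)) ∧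
      Rep (fun a => rad (N a) (m a)) (fun a => sideB (N a) (m a)) ∧
      Rep (fun a => rad (N a) (m a)) (fun a => sideC (N a) (m a)) := by
  have h2 := primrec_pow hm (Primrec.const 2)
  have h3 := primrec_mul (Primrec.const 3) hN
  have h4 := primrec_mul (primrec_mul (Primrec.const 4) hm) hN
  have h5 := primrec_mul (primrec_mul (Primrec.const 2) hm) hN
  refine ⟨(((rep_natCast (primrec_add h3 h2)).add rep_sqrt).div_nat h4).congr fun a => ?_,
    (((rep_natCast (primrec_add h3 h2)).sub rep_sqrt).div_nat h4).congr fun a => ?_,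
    (((rep_natCast h3).sub (rep_natCast h2)).div_nat h5).congr fun a => ?_⟩
  · simp only [sideA]; push_cast; rfl
  · simp only [sideB]; push_cast; rfl
  · simp only [sideC]; push_cast; rfl

lemma rep_decodeReal {R κ : α → ℕ} (hq : Primrec q) (hB : Primrec B) (hl : Primrec l)
    (hκ : Primrec κ) : Rep R fun a => decodeReal (R a) (q a) (B a) (l a) (κ a) := by
  have hd : ∀ s, Rep R fun a => ((l a / B a ^ (4 * κ a + s) % B a : ℕ) : ℝ) := fun s =>
    rep_natCast (Primrec.nat_mod.comp (Primrec.nat_div.comp hl (primrec_pow hB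
      (primrec_add (primrec_mul (Primrec.const 4) hκ) (Primrec.const s)))) hB)
  have hd' : ∀ s, Primrec fun a => l a / B a ^ (4 * κ a + s) % B a := fun s =>
    Primrec.nat_mod.comp (Primrec.nat_div.comp hl (primrec_pow hB
      (primrec_add (primrec_mul (Primrec.const 4) hκ) (Primrec.const s)))) hB
  refine Rep.div_nat ?_ (Primrec.succ.comp hq)
  refine ((hd 0).sub (hd 1)).add ?_
  exact ⟨_, _, _, _, _, Primrec.const 0, Primrec.const 0, hd' 2, hd' 3, Primrec.const 0,
    fun a => by simp⟩

lemma repPt_decodeTri {R i : α → ℕ} (hq : Primrec q) (hB : Primrec B) (hl : Primrec l)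
    (hi : Primrec i) (k : Fin 3) :
    RepPt R fun a => decodeTri (R a) (q a) (B a) (l a) (i a) k := by
  have h6 := primrec_add (primrec_mul (Primrec.const 6) hi) (Primrec.const (2 * (k : ℕ)))
  exact ⟨rep_decodeReal hq hB hl h6, rep_decodeReal hq hB hl (primrec_add h6 (Primrec.const 1))⟩

lemma primrecPred_approxTile {R : α → ℕ} (hR : Primrec R) {x y z ε : α → ℝ} (hx : Rep R x)
    (hy : Rep R y) (hz : Rep R z) (hε : Rep R ε) {u : α → Fin 3 → ℝ × ℝ}
    (hu : ∀ k, RepPt R fun a => u a k) :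
    PrimrecPred fun a => ApproxTile (x a) (y a) (z a) (ε a) (u a) := by
  have n : ∀ k l, Rep R fun a => normForm (u a k - u a l) := fun k l =>
    ((hu k).sub (hu l)).normForm hR
  have x2 := hx.mul hR hx
  have y2 := hy.mul hR hy
  have z2 := hz.mul hR hz
  refine (((((n 1 0).sub x2).le hR hε).and ((x2.sub (n 1 0)).le hR hε)).and
    (((((n 2 0).sub y2).le hR hε).and ((y2.sub (n 2 0)).le hR hε)).and
    ((((n 2 1).sub z2).le hR hε).and ((z2.sub (n 2 1)).le hR hε)))).of_eq fun a => ?_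
  exact ⟨fun ⟨⟨h1, h2⟩, ⟨h3, h4⟩, h5, h6⟩ => ⟨h1, h2, h3, h4, h5, h6⟩,
    fun ⟨h1, h2, h3, h4, h5, h6⟩ => ⟨⟨h1, h2⟩, ⟨h3, h4⟩, h5, h6⟩⟩

lemma primrecPred_approxMem {R : α → ℕ} (hR : Primrec R) {ε : α → ℝ} (hε : Rep R ε)
    {p : α → ℝ × ℝ} (hp : RepPt R p) : PrimrecPred fun a => ApproxMem (ε a) (p a) := by
  have h1 : Rep R fun _ => (1 : ℝ) := (rep_natCast (Primrec.const 1)).congr fun a => by simp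
  refine ((hp.1.neg.le hR hε).and ((hp.2.neg.le hR hε).and
    (((hp.1.add hp.2).sub h1).le hR hε))).of_eq fun a => ?_
  exact ⟨fun ⟨h1, h2, h3⟩ => ⟨h1, h2, h3⟩, fun ⟨h1, h2, h3⟩ => ⟨h1, h2, h3⟩⟩

lemma primrecPred_approxSep {R : α → ℕ} (hR : Primrec R) {ε : α → ℝ} (hε : Rep R ε)
    {u v : α → Fin 3 → ℝ × ℝ} (hu : ∀ k, RepPt R fun a => u a k)
    (hv : ∀ k, RepPt R fun a => v a k) : PrimrecPred fun a => ApproxSep (ε a) (u a) (v a) := by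
  have harea : Rep R fun a => areaForm (u a) :=
    ((hu 1).sub (hu 0)).detForm hR ((hu 2).sub (hu 0))
  exact primrecPred_exists_fin fun j => primrecPred_forall_fin fun k =>
    (harea.mul hR (((hu (j + 1)).sub (hu j)).detForm hR ((hv k).sub (hu j)))).le hR hε

/-- Whether a coded configuration is an approximate packing can be decided. -/
theorem primrecPred_codedPacking (hN : Primrec N) (hm : Primrec m) (hq : Primrec q)
    (hB : Primrec B) (hl : Primrec l) (he : Primrec e) :
    PrimrecPred fun a => CodedPacking (N a) (m a) (q a) (B a) (l a) (e a) := by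
  have p1 : Primrec (Prod.fst : α × ℕ → α) := Primrec.fst
  have p2 : Primrec fun x : (α × ℕ) × ℕ => x.1.1 := Primrec.fst.comp Primrec.fst
  have hi : Primrec fun x : (α × ℕ) × ℕ => x.1.2 := Primrec.snd.comp Primrec.fst
  have hR1 := primrec_rad (hN.comp p1) (hm.comp p1)
  have hR2 := primrec_rad (hN.comp p2) (hm.comp p2)
  obtain ⟨rA, rB, rC⟩ := rep_side (hN.comp p1) (hm.comp p1)
  have ε1 : Rep (fun x : α × ℕ => rad (N x.1) (m x.1))
      fun x => ((e x.1 : ℕ) : ℝ) / (q x.1 + 1 : ℕ) :=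
    (rep_natCast (he.comp p1)).div_nat (Primrec.succ.comp (hq.comp p1))
  have ε2 : Rep (fun x : (α × ℕ) × ℕ => rad (N x.1.1) (m x.1.1))
      fun x => ((e x.1.1 : ℕ) : ℝ) / (q x.1.1 + 1 : ℕ) :=
    (rep_natCast (he.comp p2)).div_nat (Primrec.succ.comp (hq.comp p2))
  have u1 := fun k => repPt_decodeTri (R := fun x : α × ℕ => rad (N x.1) (m x.1))
    (hq.comp p1) (hB.comp p1) (hl.comp p1) Primrec.snd k
  have u2 := fun k => repPt_decodeTri (R := fun x : (α × ℕ) × ℕ => rad (N x.1.1) (m x.1.1))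
    (hq.comp p2) (hB.comp p2) (hl.comp p2) hi k
  have v2 := fun k => repPt_decodeTri (R := fun x : (α × ℕ) × ℕ => rad (N x.1.1) (m x.1.1))
    (hq.comp p2) (hB.comp p2) (hl.comp p2) Primrec.snd k
  let u : α → ℕ → Fin 3 → ℝ × ℝ := fun a i =>
    decodeTri (rad (N a) (m a)) (q a) (B a) (l a) i
  let ε : α → ℝ := fun a => (e a : ℝ) / (q a + 1 : ℕ)
  have t1 := primrecPred_forall_lt (P := fun a i =>
    ApproxTile (sideA (N a) (m a)) (sideB (N a) (m a)) (sideC (N a) (m a)) (ε a) (u a i)) hN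
    (primrecPred_approxTile hR1 rA rB rC ε1 u1)
  have t2 := primrecPred_forall_lt (P := fun a i => ∀ k, ApproxMem (ε a) (u a i k)) hN
    (primrecPred_forall_fin fun k => primrecPred_approxMem hR1 ε1 (u1 k))
  have t3 := primrecPred_forall_lt (P := fun a i => ∀ j < N a,
      i = j ∨ ApproxSep (ε a) (u a i) (u a j) ∨ ApproxSep (ε a) (u a j) (u a i)) hN
    (primrecPred_forall_lt (P := fun (x : α × ℕ) j =>
      x.2 = j ∨ ApproxSep (ε x.1) (u x.1 x.2) (u x.1 j) ∨ ApproxSep (ε x.1) (u x.1 j) (u x.1 x.2))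
    (hN.comp p1) ((Primrec.eq.comp hi Primrec.snd).or
      ((primrecPred_approxSep hR2 ε2 u2 v2).or (primrecPred_approxSep hR2 ε2 v2 u2))))
  refine (t1.and (t2.and t3)).of_eq fun a => ?_
  constructor
  · rintro ⟨h1, h2, h3⟩
    refine ⟨fun i => h1 i i.2, fun i => h2 i i.2, fun i j hij => ?_⟩
    exact (h3 i i.2 j j.2).resolve_left fun h => hij (Fin.ext h)
  · rintro ⟨h1, h2, h3⟩
    refine ⟨fun i hi => h1 ⟨i, hi⟩, fun i hi => h2 ⟨i, hi⟩, fun i hi j hj => ?_⟩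
    by_cases h : i = j
    · exact Or.inl h
    · exact Or.inr (h3 ⟨i, hi⟩ ⟨j, hj⟩ fun h' => h (congrArg Fin.val h'))

theorem primrecPred_isIrrationalParam (hN : Primrec N) (hm : Primrec m) :
    PrimrecPred fun a => IsIrrationalParam (N a) (m a) := by
  have hR := primrec_rad hN hm
  obtain ⟨rA, rB, rC⟩ := rep_side hN hm
  have r0 : Rep (fun a => rad (N a) (m a)) fun _ => (0 : ℝ) :=
    (rep_natCast (Primrec.const 0)).congr fun a => by simp
  have hl : RepPt (fun a => rad (N a) (m a)) fun a =>
      (sideB (N a) (m a) - sideA (N a) (m a), sideA (N a) (m a)) := ⟨rB.sub rA, rA⟩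
  have hr : RepPt (fun a => rad (N a) (m a)) fun a => (sideC (N a) (m a), (0 : ℝ)) := ⟨rC, r0⟩
  have hpow := ((hl.powCoord hR 120).1.eq hR (hr.powCoord hR 120).1).and
    ((hl.powCoord hR 120).2.eq hR (hr.powCoord hR 120).2)
  refine ((Primrec.nat_lt.comp (Primrec.const 0) hm).and
    ((Primrec.nat_le.comp (primrec_pow hm (Primrec.const 2)) hN).and hpow.not)).of_eq fun a => ?_
  unfold IsIrrationalParam
  refine and_congr_right fun h1 => and_congr_right fun h2 => not_congr ?_
  rw [rot_pow_eq_one_iff (isShape_side h1 h2).1, Prod.ext_iff]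

end Primrec

/-- There is an admissible tile with `N` copies of which the unit triangle can be packed. -/
def Tileable (N : ℕ) : Prop :=
  ∃ m, IsIrrationalParam N m ∧ ∃ U : Fin N → Fin 3 → ℝ × ℝ,
    ApproxPacking (sideA N m) (sideB N m) (sideC N m) 0 U

/-- `n` is the code of a packing. -/
def PackingCode (N n : ℕ) : Prop :=
  IsIrrationalParam N n.unpair.1 ∧ CodedPacking N n.unpair.1 n.unpair.2.unpair.1
    n.unpair.2.unpair.2.unpair.1 n.unpair.2.unpair.2.unpair.2 0

/-- For all possible tiles, approximate packings are ruled out by searching a grid of mesh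
at least `1 / n`. -/
def NoPackingBound (N n : ℕ) : Prop :=
  ∀ m < N + 1, ¬ IsIrrationalParam N m ∨ ∃ k < n, ∀ l < (k + 2) ^ (24 * N),
    ¬ CodedPacking N m k (k + 2) l 32

theorem tileable_iff_exists_code (N : ℕ) : Tileable N ↔ ∃ n, PackingCode N n := by
  constructor
  · rintro ⟨m, hm, U, hU⟩
    obtain ⟨hs, hcard⟩ := isShape_side hm.1 hm.2.1
    obtain ⟨fA, fB, fC⟩ := side_mem_quadField N m
    obtain ⟨U', hU', hF⟩ :=
      exists_packing_mem_of_tiling hs fA fB fC hcard ((isPacking_iff hs U).2 hU)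
    obtain ⟨q, B, l, h⟩ := exists_code_of_mem_quadField hF
    refine ⟨Nat.pair m (Nat.pair q (Nat.pair B l)), ?_⟩
    simp only [PackingCode, Nat.unpair_pair, hm, true_and, CodedPacking]
    have : (fun i : Fin N => decodeTri (rad N m) q B l i) = U' := by
      ext i k : 2
      exact h i k
    rw [this]
    simpa using hU'
  · rintro ⟨n, hn, h⟩
    refine ⟨_, hn, fun i => decodeTri (rad N n.unpair.1) n.unpair.2.unpair.1
      n.unpair.2.unpair.2.unpair.1 n.unpair.2.unpair.2.unpair.2 i, ?_⟩
    simpa [CodedPacking] using h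

theorem not_tileable_iff (N : ℕ) : ¬ Tileable N ↔ ∃ n, NoPackingBound N n := by
  constructor
  · intro h
    have h1 : ∀ m, IsIrrationalParam N m → ∃ k, ∀ l < (k + 2) ^ (24 * N),
        ¬ CodedPacking N m k (k + 2) l 32 := by
      intro m hm
      by_contra hcon
      push Not at hcon
      choose l _ hl using hcon
      exact h ⟨m, hm, exists_packing_of_approx
        (fun n (i : Fin N) => decodeTri (rad N m) n (n + 2) (l n) i) fun n => hl n⟩
    choose! k hk using h1
    refine ⟨(Finset.range (N + 1)).sup k + 1, fun m hm => ?_⟩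
    by_cases h2 : IsIrrationalParam N m
    · exact Or.inr ⟨k m, Nat.lt_succ_of_le (Finset.le_sup (Finset.mem_range.2 hm)), hk m h2⟩
    · exact Or.inl h2
  · rintro ⟨n, hn⟩ ⟨m, hm, U, hU⟩
    have hmN : m < N + 1 := by
      have := hm.2.1
      have := Nat.le_self_pow (two_ne_zero) m
      omega
    rcases hn m hmN with h | ⟨k, -, h⟩
    · exact h hm
    · obtain ⟨l, hl, h'⟩ := exists_grid_of_packing hU (rad N m) k
      exact h l hl (by simpa [CodedPacking] using h')

lemma primrecPred_packingCode : PrimrecPred fun x : ℕ × ℕ => PackingCode x.1 x.2 := by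
  have u : Primrec fun x : ℕ × ℕ => x.2.unpair := Primrec.unpair.comp Primrec.snd
  have u' : Primrec fun x : ℕ × ℕ => x.2.unpair.2.unpair :=
    Primrec.unpair.comp (Primrec.snd.comp u)
  have u'' : Primrec fun x : ℕ × ℕ => x.2.unpair.2.unpair.2.unpair :=
    Primrec.unpair.comp (Primrec.snd.comp u')
  exact (primrecPred_isIrrationalParam Primrec.fst (Primrec.fst.comp u)).and
    (primrecPred_codedPacking Primrec.fst (Primrec.fst.comp u) (Primrec.fst.comp u')
      (Primrec.fst.comp u'') (Primrec.snd.comp u'') (Primrec.const 0))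

lemma primrecPred_noPackingBound : PrimrecPred fun x : ℕ × ℕ => NoPackingBound x.1 x.2 := by
  refine primrecPred_forall_lt (Primrec.succ.comp Primrec.fst) ?_
  refine (primrecPred_isIrrationalParam (Primrec.fst.comp Primrec.fst) Primrec.snd).not.or ?_
  refine primrecPred_exists_lt (Primrec.snd.comp Primrec.fst) ?_
  have p1 : Primrec fun x : (((ℕ × ℕ) × ℕ) × ℕ) => x.1.1.1 :=
    Primrec.fst.comp (Primrec.fst.comp Primrec.fst)
  have pN : Primrec fun x : (((ℕ × ℕ) × ℕ) × ℕ) × ℕ => x.1.1.1.1 := p1.comp Primrec.fst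
  have pm : Primrec fun x : (((ℕ × ℕ) × ℕ) × ℕ) × ℕ => x.1.1.2 :=
    Primrec.snd.comp (Primrec.fst.comp Primrec.fst)
  have pk : Primrec fun x : (((ℕ × ℕ) × ℕ) × ℕ) × ℕ => x.1.2 := Primrec.snd.comp Primrec.fst
  refine primrecPred_forall_lt (primrec_pow (primrec_add Primrec.snd (Primrec.const 2))
    (primrec_mul (Primrec.const 24) p1)) ?_
  exact (primrecPred_codedPacking pN pm pk (primrec_add pk (Primrec.const 2)) Primrec.snd
    (Primrec.const 32)).not

/-- A set of natural numbers for which both membership and non-membership are witnessed by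
a computable relation is computable. -/
lemma computablePred_of_witnesses {p : ℕ → Prop} {P Q : ℕ → ℕ → Prop}
    (hP : PrimrecPred fun x : ℕ × ℕ => P x.1 x.2) (hQ : PrimrecPred fun x : ℕ × ℕ => Q x.1 x.2)
    (h1 : ∀ N, p N ↔ ∃ n, P N n) (h2 : ∀ N, ¬ p N ↔ ∃ n, Q N n) : ComputablePred p := by
  classical
  have hex : ∀ N, ∃ n, P N n ∨ Q N n := by
    intro N
    by_cases h : p N
    · obtain ⟨n, hn⟩ := (h1 N).1 h; exact ⟨n, Or.inl hn⟩
    · obtain ⟨n, hn⟩ := (h2 N).1 h; exact ⟨n, Or.inr hn⟩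
  have hfind := Computable.find (P := fun N n => P N n ∨ Q N n)
    (hP.or hQ).computablePred hex
  have hdec : Computable fun N => decide (P N (Nat.find (hex N))) :=
    hP.decide.to_comp.comp (Computable.id.pair hfind)
  refine hdec.computablePred.of_eq fun N => ⟨fun h => (h1 N).2 ⟨_, h⟩, fun h => ?_⟩
  exact (Nat.find_spec (hex N)).resolve_right fun hq => (h2 N).2 ⟨_, hq⟩ h

theorem computablePred_tileable : ComputablePred Tileable :=
  computablePred_of_witnesses primrecPred_packingCode primrecPred_noPackingBound
    tileable_iff_exists_code not_tileable_iff

end Tiling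

/-! ### Triangles in the plane and in the frame of an equilateral triangle -/

namespace Tiling

lemma affineIndependent_iff_area₂_ne_zero (V : Fin 3 → ℂ) :
    AffineIndependent ℝ V ↔ area₂ V ≠ 0 := by
  have hcomb : ∀ w : Fin 3 → ℝ, ∑ k, w k = 0 →
      Finset.univ.weightedVSub V w = ∑ k, (w k : ℂ) * V k := fun w hw => by
    rw [Finset.univ.weightedVSub_eq_linear_combination hw]; simp
  rw [affineIndependent_iff_of_fintype]
  constructor
  · intro h h0
    have hx : ∀ x k, edgeForm V k x = 0 := by
      intro x k
      have hs : ∑ k, edgeForm V (k + 1) x = 0 := by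
        rw [← h0, Fin.sum_univ_three]; simp [edgeForm, area₂, cross]; ring
      have hv : ∑ k, (edgeForm V (k + 1) x : ℂ) * V k = 0 := by
        have h0' : (V 1 - V 0).re * (V 2 - V 0).im - (V 1 - V 0).im * (V 2 - V 0).re = 0 := h0
        simp only [Complex.sub_re, Complex.sub_im] at h0'
        apply Complex.ext
        · simp [Fin.sum_univ_three, edgeForm, cross]
          linear_combination x.re * h0'
        · simp [Fin.sum_univ_three, edgeForm, cross]
          linear_combination x.im * h0'
      simpa using h _ hs (by rw [hcomb _ hs, hv]) (k - 1)
    have h1 : V 1 = V 0 := by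
      have e1 := hx (V 0 + 1) 0
      have e2 := hx (V 0 + Complex.I) 0
      simp [edgeForm, cross] at e1 e2
      apply Complex.ext <;> linarith
    have hw := h ![1, -1, 0] (by simp [Fin.sum_univ_three]) (by
      rw [hcomb _ (by simp [Fin.sum_univ_three])]; simp [Fin.sum_univ_three, h1]) 0
    simp at hw
  · intro h w hw hw' k
    rw [hcomb w hw] at hw'
    have e1 := bary_sum h (fun _ => 1 / 3) (by simp)
    have e2 := bary_sum h (fun k => 1 / 3 + w k) (by simp [Finset.sum_add_distrib, hw])
    have : ∑ k, (((1 / 3 + w k : ℝ)) : ℂ) * V k = ∑ k, ((1 / 3 : ℝ) : ℂ) * V k := by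
      push_cast
      simp only [add_mul, Finset.sum_add_distrib, hw', add_zero]
    rw [this, e1] at e2
    have := congrFun e2 k
    linarith

lemma mem_setInterior_iff_bary (S : Affine.Triangle ℝ ℂ) (I : Set ℝ) (x : ℂ) :
    x ∈ S.setInterior I ↔ ∀ k, bary S.points x k ∈ I := by
  have hV := (affineIndependent_iff_area₂_ne_zero S.points).1 S.independent
  have h := sum_bary hV x
  have hx : Finset.univ.affineCombination ℝ S.points (bary S.points x) = x := by
    rw [Finset.affineCombination_eq_linear_combination _ _ _ h]
    simpa only [Complex.real_smul] using sum_bary_mul hV x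
  rw [← Affine.Simplex.affineCombination_mem_setInterior_iff (s := S) h, hx]

lemma bary_lt_one_of_pos {w : Fin 3 → ℝ} (hw : ∑ k, w k = 1) (h : ∀ k, 0 < w k) (k : Fin 3) :
    w k < 1 := by
  rw [Fin.sum_univ_three] at hw
  have h0 := h 0
  have h1 := h 1
  have h2 := h 2
  fin_cases k <;> simp only [Fin.zero_eta, Fin.mk_one, Fin.reduceFinMk] <;> linarith

lemma bary_le_one_of_nonneg {w : Fin 3 → ℝ} (hw : ∑ k, w k = 1) (h : ∀ k, 0 ≤ w k) (k : Fin 3) :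
    w k ≤ 1 := by
  rw [← hw]
  exact Finset.single_le_sum (fun i _ => h i) (Finset.mem_univ k)

lemma interior_eq_openTri (S : Affine.Triangle ℝ ℂ) : S.interior = openTri S.points := by
  have hV := (affineIndependent_iff_area₂_ne_zero S.points).1 S.independent
  ext x
  rw [Affine.Simplex.interior, mem_setInterior_iff_bary, mem_openTri_iff_bary hV]
  exact ⟨fun h k => (h k).1, fun h k => ⟨h k, bary_lt_one_of_pos (sum_bary hV x) h k⟩⟩

lemma closedInterior_eq_closedTri (S : Affine.Triangle ℝ ℂ) :
    S.closedInterior = closedTri S.points := by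
  have hV := (affineIndependent_iff_area₂_ne_zero S.points).1 S.independent
  ext x
  rw [Affine.Simplex.closedInterior, mem_setInterior_iff_bary, mem_closedTri_iff_bary hV]
  exact ⟨fun h k => (h k).1, fun h k => ⟨h k, bary_le_one_of_nonneg (sum_bary hV x) h k⟩⟩

/-- A similarity from the complex plane that maps the unit triangle to the triangle `ABC`
with side `X`. -/
structure Frame (ABC : Triangle) where
  /-- The side of the triangle. -/
  X : ℝ
  /-- The similarity. -/
  map : ℂ ≃ᵃ[ℝ] Plane
  X_pos : 0 < X
  dist_map : ∀ z w, dist (map z) (map w) = X * ‖z - w‖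
  map_unitTri : ∀ k, map (unitTri k) = ABC.points k

/-- The linear map sending `1` to `u` and `ω` to `v`. -/
noncomputable def coordMap (u v : Plane) : ℂ →ₗ[ℝ] Plane where
  toFun z := (coord z).1 • u + (coord z).2 • v
  map_add' z w := by
    have : coord (z + w) = coord z + coord w := by ext <;> simp [coord] <;> ring
    rw [this, Prod.fst_add, Prod.snd_add, add_smul, add_smul]; abel
  map_smul' r z := by
    have : coord (r • z) = r • coord z := by ext <;> simp [coord] <;> ring
    rw [this]; simp [mul_smul]

lemma norm_coordMap {u v : Plane} {X : ℝ} (hX : 0 ≤ X) (hu : ‖u‖ = X) (hv : ‖v‖ = X)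
    (huv : ‖u - v‖ = X) (z : ℂ) : ‖coordMap u v z‖ = X * ‖z‖ := by
  have h1 := norm_sub_sq_real u v
  rw [hu, hv, huv] at h1
  have h2 : ‖z‖ ^ 2 = normForm (coord z) := by rw [← norm_ofCoord_sq, ofCoord_coord]
  have h3 : ‖coordMap u v z‖ ^ 2 = (X * ‖z‖) ^ 2 := by
    change ‖(coord z).1 • u + (coord z).2 • v‖ ^ 2 = _
    rw [norm_add_sq_real, norm_smul, norm_smul, inner_smul_left, inner_smul_right, mul_pow, mul_pow,
      mul_pow, h2, hu, hv, Real.norm_eq_abs, Real.norm_eq_abs, sq_abs, sq_abs, normForm]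
    simp only [conj_trivial]
    linear_combination (coord z).1 * (coord z).2 * h1
  exact (sq_eq_sq₀ (norm_nonneg _) (by positivity)).1 h3

/-- Every equilateral triangle has a frame. -/
theorem nonempty_frame {ABC : Triangle} (h : ABC.Equilateral) : Nonempty (Frame ABC) := by
  obtain ⟨X, hX⟩ := h
  set u := ABC.points 1 -ᵥ ABC.points 0
  set v := ABC.points 2 -ᵥ ABC.points 0
  have hu : ‖u‖ = X := by rw [← hX 1 0 (by decide), dist_eq_norm_vsub]
  have hv : ‖v‖ = X := by rw [← hX 2 0 (by decide), dist_eq_norm_vsub]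
  have huv : ‖u - v‖ = X := by
    rw [← hX 1 2 (by decide), dist_eq_norm_vsub, vsub_sub_vsub_cancel_right]
  have hX0 : 0 < X := by
    rw [← hu, norm_pos_iff, vsub_ne_zero]
    exact ABC.independent.injective.ne (by decide)
  have hn := norm_coordMap hX0.le hu hv huv
  have hinj : Function.Injective (coordMap u v) := by
    rw [injective_iff_map_eq_zero]
    intro z hz
    have := hn z
    rw [hz, norm_zero] at this
    simpa [hX0.ne'] using this.symm
  let e : ℂ ≃ₗ[ℝ] Plane := (coordMap u v).linearEquivOfInjective hinj (by simp)
  have he : ∀ z, e z = coordMap u v z := fun z => rfl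
  have hmap : ∀ z, (e.toAffineEquiv.trans (AffineEquiv.vaddConst ℝ (ABC.points 0))) z =
      coordMap u v z +ᵥ ABC.points 0 := fun z => rfl
  refine ⟨⟨X, e.toAffineEquiv.trans (AffineEquiv.vaddConst ℝ (ABC.points 0)), hX0, ?_, ?_⟩⟩
  · intro z w
    rw [hmap, hmap, dist_vadd_cancel_right, dist_eq_norm, ← map_sub, hn]
  · intro k
    have h0 : coord 0 = (0, 0) := by simp [coord]
    have h1 : coord 1 = (1, 0) := by simp [coord]
    have h2 : coord ω = (0, 1) := by
      have := coord_ofCoord (0, 1)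
      simpa [ofCoord] using this
    rw [hmap]
    change ((coord (unitTri k)).1 • u + (coord (unitTri k)).2 • v) +ᵥ ABC.points 0 = _
    fin_cases k <;> simp [unitTri, h0, h1, h2, u, v]

end Tiling

/-! ### Tiles and their sides -/

namespace Tiling

/-- `T` has sides `a`, `b`, `c`; the labels `τ 0`, `τ 1`, `τ 2` play the role of the labels
`0`, `1`, `2` in `IsTile`. -/
def HasSides (T : Triangle) (a b c : ℝ) : Prop :=
  ∃ τ : Equiv.Perm (Fin 3), dist (T.points (τ 1)) (T.points (τ 0)) = a ∧
    dist (T.points (τ 2)) (T.points (τ 0)) = b ∧ dist (T.points (τ 2)) (T.points (τ 1)) = c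

lemma HasSides.triCongruent {T T' : Triangle} {a b c : ℝ} (h : HasSides T a b c)
    (h' : HasSides T' a b c) : TriCongruent T T' := by
  obtain ⟨τ, h1, h2, h3⟩ := h
  obtain ⟨τ', h1', h2', h3'⟩ := h'
  refine ⟨τ'.symm.trans τ, ?_⟩
  rw [← Congruent.index_equiv τ', congruent_iff_dist_eq]
  intro i j
  simp only [Function.comp_apply, Equiv.trans_apply, Equiv.symm_apply_apply]
  fin_cases i <;> fin_cases j <;>
    simp only [Fin.zero_eta, Fin.mk_one, Fin.reduceFinMk, dist_self] <;>
    first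
      | rw [h1, h1'] | rw [h2, h2'] | rw [h3, h3']
      | rw [dist_comm, h1, dist_comm, h1'] | rw [dist_comm, h2, dist_comm, h2']
      | rw [dist_comm, h3, dist_comm, h3']

lemma HasSides.of_triCongruent {T T' : Triangle} {a b c : ℝ} (h : HasSides T a b c)
    (h' : TriCongruent T' T) : HasSides T' a b c := by
  obtain ⟨τ, h1, h2, h3⟩ := h
  obtain ⟨σ, hσ⟩ := h'
  rw [congruent_iff_dist_eq] at hσ
  exact ⟨τ.trans σ, (hσ _ _).trans h1, (hσ _ _).trans h2, (hσ _ _).trans h3⟩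

/-- The angle of a triangle in terms of the sides. -/
lemma angle_eq_arccos_dist {p q r : Plane} (hp : p ≠ q) (hr : r ≠ q) :
    ∠ p q r = Real.arccos ((dist p q ^ 2 + dist r q ^ 2 - dist r p ^ 2) /
      (2 * dist p q * dist r q)) := by
  have h := EuclideanGeometry.law_cos p q r
  have h1 := dist_pos.2 hp
  have h2 := dist_pos.2 hr
  rw [← Real.arccos_cos (angle_nonneg p q r) (angle_le_pi p q r)]
  congr 1
  rw [eq_div_iff (by positivity), dist_comm r p]
  linear_combination h

/-- The angle `π / 3` is characterized by the law of cosines. -/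
lemma angle_eq_pi_div_three_iff {p q r : Plane} (hp : p ≠ q) (hr : r ≠ q) :
    ∠ p q r = Real.pi / 3 ↔
      dist r p ^ 2 = dist p q ^ 2 + dist r q ^ 2 - dist p q * dist r q := by
  have h := EuclideanGeometry.law_cos p q r
  rw [dist_comm p r] at h
  have h1 := dist_pos.2 hp
  have h2 := dist_pos.2 hr
  constructor
  · intro h3
    rw [h3, Real.cos_pi_div_three] at h
    linear_combination h
  · intro h3
    refine Real.injOn_cos ⟨angle_nonneg _ _ _, angle_le_pi _ _ _⟩
      ⟨by positivity, by linarith [Real.pi_pos]⟩ ?_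
    rw [Real.cos_pi_div_three]
    have : dist p q * dist r q * (∠ p q r).cos = dist p q * dist r q * (1 / 2) := by linarith
    exact mul_left_cancel₀ (by positivity) this

lemma IsShape.angle_eq {a b c : ℝ} (h : IsShape a b c) {x : Fin 3 → Plane}
    (ha : dist (x 1) (x 0) = a) (hb : dist (x 2) (x 0) = b) (hc : dist (x 2) (x 1) = c) :
    ∠ (x 1) (x 2) (x 0) = Real.arccos ((2 * b - a) / (2 * c)) := by
  have h1 := h.pos_b
  have h2 := h.pos_c
  rw [angle_eq_arccos_dist, dist_comm (x 1) (x 2), dist_comm (x 0) (x 2), dist_comm (x 0) (x 1),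
    ha, hb, hc]
  · congr 1
    rw [div_eq_div_iff (by positivity) (by positivity)]
    linear_combination 2 * c * h.law
  · rw [← dist_pos, dist_comm, hc]; exact h2
  · rw [← dist_pos, dist_comm, hb]; exact h1

/-- The angle condition in terms of the sides. The two sides at the angle `π / 3` may be
taken in any order since the remaining angles are commensurable with `π` together. -/
theorem hasIrrationalSixtyAngles_iff (T : Triangle) :
    HasIrrationalSixtyAngles T ↔ ∃ a b c, IsShape a b c ∧ b ≤ a ∧
      (∀ n : ℕ, 0 < n → rot a b c ^ n ≠ 1) ∧ HasSides T a b c := by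
  have hinj := T.independent.injective
  constructor
  · rintro ⟨A, B, C, hAB, hBC, hCA, hC, hA⟩
    have main : ∀ A B C : Fin 3, A ≠ B → B ≠ C → C ≠ A →
        ∠ (T.points A) (T.points C) (T.points B) = Real.pi / 3 →
        Irrational (∠ (T.points B) (T.points A) (T.points C) / Real.pi) →
        dist (T.points A) (T.points C) ≤ dist (T.points B) (T.points C) →
        ∃ a b c, IsShape a b c ∧ b ≤ a ∧
          (∀ n : ℕ, 0 < n → rot a b c ^ n ≠ 1) ∧ HasSides T a b c := by
      intro A B C hAB hBC hCA hC hA hle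
      rw [angle_eq_pi_div_three_iff (hinj.ne hCA.symm) (hinj.ne hBC)] at hC
      have hs : IsShape (dist (T.points B) (T.points C)) (dist (T.points A) (T.points C))
          (dist (T.points A) (T.points B)) :=
        ⟨dist_pos.2 (hinj.ne hBC), dist_pos.2 (hinj.ne hCA.symm), dist_pos.2 (hinj.ne hAB), by
          rw [dist_comm (T.points A) (T.points B)]; linear_combination hC⟩
      have hτ : Function.Bijective ![C, B, A] := by
        rw [Fintype.bijective_iff_injective_and_card]
        refine ⟨?_, rfl⟩
        intro i j
        fin_cases i <;> fin_cases j <;> simp [hAB, hBC, hCA, hAB.symm, hBC.symm, hCA.symm]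
      refine ⟨_, _, _, hs, hle, (irrational_iff_rot hs).1 ?_, Equiv.ofBijective _ hτ, rfl, rfl, rfl⟩
      rw [← hs.angle_eq (x := ![T.points C, T.points B, T.points A]) rfl rfl rfl]
      exact hA
    rcases le_total (dist (T.points A) (T.points C)) (dist (T.points B) (T.points C)) with h | h
    · exact main A B C hAB hBC hCA hC hA h
    · refine main B A C hAB.symm hCA.symm hBC.symm (by rw [angle_comm, hC]) ?_ h
      have hsum := angle_add_angle_add_angle_eq_pi (T.points C) (hinj.ne hAB.symm)
      rw [angle_comm (T.points B) (T.points C), hC] at hsum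
      have hπ := Real.pi_pos.ne'
      have : ∠ (T.points A) (T.points B) (T.points C) / Real.pi =
          ((2 / 3 : ℚ) : ℝ) - ∠ (T.points B) (T.points A) (T.points C) / Real.pi := by
        rw [angle_comm (T.points B)]
        push_cast
        field_simp
        linarith
      rw [this]
      exact hA.ratCast_sub _
  · rintro ⟨a, b, c, hs, -, hroot, τ, ha, hb, hc⟩
    refine ⟨τ 2, τ 1, τ 0, τ.injective.ne (by decide), τ.injective.ne (by decide),
      τ.injective.ne (by decide), ?_, ?_⟩
    · rw [angle_eq_pi_div_three_iff (hinj.ne (τ.injective.ne (by decide)))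
        (hinj.ne (τ.injective.ne (by decide))), dist_comm (T.points (τ 1)) (T.points (τ 2)),
        ha, hb, hc, hs.law]
      ring
    · have := hs.angle_eq (x := fun k => T.points (τ k)) ha hb hc
      rw [this]
      exact (irrational_iff_rot hs).2 hroot

lemma IsShape.mul {a b c X : ℝ} (h : IsShape a b c) (hX : 0 < X) :
    IsShape (X * a) (X * b) (X * c) :=
  ⟨mul_pos hX h.pos_a, mul_pos hX h.pos_b, mul_pos hX h.pos_c, by
    linear_combination X ^ 2 * h.law⟩

lemma rot_mul {X : ℝ} (hX : X ≠ 0) (a b c : ℝ) : rot (X * a) (X * b) (X * c) = rot a b c := by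
  have : (X : ℂ) ≠ 0 := by exact_mod_cast hX
  rw [rot, rot]
  push_cast
  rw [mul_assoc, ← mul_sub, mul_div_mul_left _ _ this]

namespace Frame

variable {ABC : Triangle} (φ : Frame ABC)

/-- The triangle `T`, seen in the frame. -/
noncomputable def pullback (T : Triangle) : Affine.Triangle ℝ ℂ :=
  Affine.Simplex.map T (φ.map.symm : Plane →ᵃ[ℝ] ℂ) φ.map.symm.injective

lemma map_pullback (T : Triangle) (k : Fin 3) : φ.map ((φ.pullback T).points k) = T.points k :=
  φ.map.apply_symm_apply _

lemma image_setInterior_pullback (T : Triangle) (I : Set ℝ) :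
    φ.map '' (φ.pullback T).setInterior I = T.setInterior I := by
  have h : (φ.pullback T).setInterior I = φ.map.symm '' T.setInterior I :=
    Affine.Simplex.setInterior_map I T (f := (φ.map.symm : Plane →ᵃ[ℝ] ℂ)) φ.map.symm.injective
  rw [h, ← Set.image_comp]
  convert Set.image_id _
  ext x
  simp

/-- If the vertices of `T`, in any order, are the images of `V 0`, `V 1`, `V 2`, then `T` is the
image of the triangle `V`. -/
lemma eq_image {T : Triangle} {V : Fin 3 → ℂ} (τ : Equiv.Perm (Fin 3))
    (h : ∀ k, φ.map (V k) = T.points (τ k)) :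
    T.interior = φ.map '' openTri V ∧ T.closedInterior = φ.map '' closedTri V ∧ area₂ V ≠ 0 := by
  have hV : (φ.pullback (T.reindex τ.symm)).points = V := by
    ext k
    apply φ.map.injective
    rw [map_pullback, h]
    simp
  refine ⟨?_, ?_, ?_⟩
  · rw [← T.interior_reindex τ.symm, Affine.Simplex.interior, ← φ.image_setInterior_pullback,
      ← Affine.Simplex.interior, interior_eq_openTri, hV]
  · rw [← T.closedInterior_reindex τ.symm, Affine.Simplex.closedInterior,
      ← φ.image_setInterior_pullback, ← Affine.Simplex.closedInterior,
      closedInterior_eq_closedTri, hV]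
  · rw [← affineIndependent_iff_area₂_ne_zero, ← hV]
    exact (φ.pullback (T.reindex τ.symm)).independent

/-- Tilings of a triangle and tilings of the unit triangle correspond to each other. -/
theorem nTiles_iff {N : ℕ} {T : Triangle} {a b c : ℝ}
    (hT : HasSides T (φ.X * a) (φ.X * b) (φ.X * c)) :
    NTiles N T ABC ↔ ∃ V : Fin N → Fin 3 → ℂ, IsTiling unitTri V ∧ ∀ i, IsTile a b c (V i) := by
  obtain ⟨-, hABC, hABC'⟩ := φ.eq_image (V := unitTri) (Equiv.refl _) φ.map_unitTri
  have hdist : ∀ {z w : ℂ} {d : ℝ}, dist (φ.map z) (φ.map w) = φ.X * d ↔ ‖z - w‖ = d := by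
    intro z w d
    rw [φ.dist_map, mul_right_inj' φ.X_pos.ne']
  constructor
  · rintro ⟨t, ht, hcov, hdis⟩
    choose τ ha hb hc using fun i => hT.of_triCongruent (ht i)
    have hV : ∀ i k, φ.map (φ.map.symm ((t i).points (τ i k))) = (t i).points (τ i k) := by simp
    have key := fun i => φ.eq_image (τ i) (hV i)
    refine ⟨fun i k => φ.map.symm ((t i).points (τ i k)),
      ⟨hABC', fun i => (key i).2.2, ?_, fun i j hij => ?_⟩, fun i => ⟨?_, ?_, ?_⟩⟩
    · apply φ.map.injective.image_injective
      rw [Set.image_iUnion, ← hABC, ← hcov]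
      exact Set.iUnion_congr fun i => (key i).2.1.symm
    · have h := hdis hij
      simp only [(key _).1] at h
      exact (Set.disjoint_image_iff φ.map.injective).1 h
    · rw [← hdist, hV, hV, ha]
    · rw [← hdist, hV, hV, hb]
    · rw [← hdist, hV, hV, hc]
  · rintro ⟨V, hV, htile⟩
    let t : Fin N → Triangle := fun i => Affine.Simplex.map
      ⟨V i, (affineIndependent_iff_area₂_ne_zero _).2 (hV.area_ne' i)⟩ φ.map.toAffineMap
        φ.map.injective
    have ht : ∀ i k, φ.map (V i k) = (t i).points (Equiv.refl _ k) := fun i k => rfl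
    have key := fun i => φ.eq_image (Equiv.refl _) (ht i)
    refine ⟨t, fun i => HasSides.triCongruent ?_ hT, ?_, fun i j hij => ?_⟩
    · exact ⟨Equiv.refl _, hdist.2 (htile i).len_a, hdist.2 (htile i).len_b,
        hdist.2 (htile i).len_c⟩
    · rw [hABC, ← hV.cover, Set.image_iUnion]
      exact Set.iUnion_congr fun i => (key i).2.1
    · simp only [(key _).1]
      exact (Set.disjoint_image_iff φ.map.injective).2 (hV.disj hij)

lemma exists_hasSides {a b c : ℝ} (hs : IsShape a b c) {V : Fin 3 → ℂ} (hV : IsTile a b c V) :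
    ∃ T : Triangle, HasSides T (φ.X * a) (φ.X * b) (φ.X * c) :=
  ⟨Affine.Simplex.map ⟨V, (affineIndependent_iff_area₂_ne_zero _).2 (hV.area₂_ne_zero hs)⟩
      φ.map.toAffineMap φ.map.injective, Equiv.refl _,
    (φ.dist_map _ _).trans (congrArg (φ.X * ·) hV.len_a),
    (φ.dist_map _ _).trans (congrArg (φ.X * ·) hV.len_b),
    (φ.dist_map _ _).trans (congrArg (φ.X * ·) hV.len_c)⟩

/-- If a tile with an irrational angle tiles the triangle, its sides are determined by `N` and a
positive integer `m`. -/
theorem exists_param {N : ℕ} {T : Triangle} (hT : HasIrrationalSixtyAngles T)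
    (h : NTiles N T ABC) : ∃ m, IsIrrationalParam N m ∧
      HasSides T (φ.X * sideA N m) (φ.X * sideB N m) (φ.X * sideC N m) := by
  obtain ⟨a', b', c', hs', hba, hroot, hsides⟩ := (hasIrrationalSixtyAngles_iff T).1 hT
  have hX := φ.X_pos
  obtain ⟨a, rfl⟩ : ∃ a, a' = φ.X * a := ⟨a' / φ.X, by field_simp⟩
  obtain ⟨b, rfl⟩ : ∃ b, b' = φ.X * b := ⟨b' / φ.X, by field_simp⟩
  obtain ⟨c, rfl⟩ : ∃ c, c' = φ.X * c := ⟨c' / φ.X, by field_simp⟩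
  rw [rot_mul hX.ne'] at hroot
  have hs : IsShape a b c := by
    have := hs'.mul (inv_pos.2 hX)
    simpa only [inv_mul_cancel_left₀ hX.ne'] using this
  obtain ⟨V, hV, htile⟩ := (φ.nTiles_iff hsides).1 h
  have hN := card_mul_area hs htile hV
  rw [Fintype.card_fin] at hN
  obtain ⟨M, hM⟩ := exists_int_mul_perimeter hs htile hV hroot
  have hper : 0 < a + b + c := by linarith [hs.pos_a, hs.pos_b, hs.pos_c]
  have hM0 : 0 < M := by
    have : (0 : ℝ) < M := pos_of_mul_pos_left (by rw [hM]; norm_num) hper.le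
    exact_mod_cast this
  lift M to ℕ using hM0.le with m
  rw [Int.cast_natCast] at hM
  have hm : 0 < m := by exact_mod_cast hM0
  obtain ⟨hle, rfl, rfl, rfl⟩ := sides_eq hs (le_of_mul_le_mul_left hba hX) hN hM
  exact ⟨m, ⟨hm, hle, (rot_side_root_iff hm hle).1 hroot⟩, hsides⟩

theorem tileable_iff (φ : Frame ABC) (N : ℕ) :
    Tileable N ↔ ∃ T : Triangle, HasIrrationalSixtyAngles T ∧ NTiles N T ABC := by
  constructor
  · rintro ⟨m, hm, U, hU⟩
    obtain ⟨hs, hcard⟩ := isShape_side hm.1 hm.2.1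
    obtain ⟨hV, htile⟩ := (isTiling_iff_isPacking hs (by rwa [Fintype.card_fin])).2
      ((isPacking_iff hs U).2 hU)
    have hN : 0 < N := lt_of_lt_of_le (pow_pos hm.1 2) hm.2.1
    obtain ⟨T, hT⟩ := φ.exists_hasSides hs (htile ⟨0, hN⟩)
    have hle : sideB N m ≤ sideA N m :=
      div_le_div_of_nonneg_right (by linarith [Real.sqrt_nonneg (rad N m)]) (by positivity)
    refine ⟨T, (hasIrrationalSixtyAngles_iff T).2 ⟨_, _, _, hs.mul φ.X_pos,
      mul_le_mul_of_nonneg_left hle φ.X_pos.le, ?_, hT⟩, (φ.nTiles_iff hT).2 ⟨_, hV, htile⟩⟩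
    rw [rot_mul φ.X_pos.ne']
    exact (rot_side_root_iff hm.1 hm.2.1).2 hm.2.2
  · rintro ⟨T, hT, h⟩
    obtain ⟨m, hm, hsides⟩ := φ.exists_param hT h
    obtain ⟨hs, hcard⟩ := isShape_side hm.1 hm.2.1
    obtain ⟨V, hV⟩ := (φ.nTiles_iff hsides).1 h
    have hp := (isTiling_iff_isPacking hs (by rwa [Fintype.card_fin])).1 hV
    refine ⟨m, hm, fun i k => coord (V i k), (isPacking_iff hs _).1 ?_⟩
    simpa only [ofCoord_coord] using hp

end Frame

end Tiling

theorem mainTheorem6 :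
    (∀ (N : ℕ) (ABC : Tiling.Triangle), ABC.Equilateral →
      ∃ S : Finset Tiling.Triangle, (S.card : ℝ) ≤ Real.sqrt (3 * (N : ℝ)) ∧
        ∀ T : Tiling.Triangle, Tiling.HasIrrationalSixtyAngles T → Tiling.NTiles N T ABC →
          ∃ T' ∈ S, Tiling.TriCongruent T' T ∧ Tiling.NTiles N T' ABC) ∧
    (∃ p : ℕ → Prop, ComputablePred p ∧
      ∀ (N : ℕ) (ABC : Tiling.Triangle), ABC.Equilateral →
        (p N ↔ ∃ T : Tiling.Triangle,
          Tiling.HasIrrationalSixtyAngles T ∧ Tiling.NTiles N T ABC)) := by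
  classical
  constructor
  · intro N ABC hABC
    obtain ⟨φ⟩ := Tiling.nonempty_frame hABC
    let good : ℕ → Tiling.Triangle → Prop := fun m T =>
      Tiling.HasSides T (φ.X * Tiling.sideA N m) (φ.X * Tiling.sideB N m)
        (φ.X * Tiling.sideC N m) ∧ Tiling.NTiles N T ABC
    have : Nonempty Tiling.Triangle := ⟨ABC⟩
    choose! f hf using fun (m : ℕ) (h : ∃ T, good m T) => h
    -- `m` lies between `1` and `√N`, which bounds the number of tiles
    refine ⟨({m ∈ Finset.Icc 1 N.sqrt | ∃ T, good m T}).image f, ?_, fun T hT h => ?_⟩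
    · have h1 : (({m ∈ Finset.Icc 1 N.sqrt | ∃ T, good m T}).image f).card ≤ N.sqrt :=
        Finset.card_image_le.trans ((Finset.card_filter_le _ _).trans (by simp))
      refine Real.le_sqrt_of_sq_le ?_
      have h2 : (({m ∈ Finset.Icc 1 N.sqrt | ∃ T, good m T}).image f).card ^ 2 ≤ 3 * N :=
        (Nat.pow_le_pow_left h1 2).trans ((Nat.sqrt_le' N).trans (by omega))
      exact_mod_cast h2
    · obtain ⟨m, hm, hsides⟩ := φ.exists_param hT h
      have hg : ∃ T, good m T := ⟨T, hsides, h⟩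
      have hmem : m ∈ Finset.Icc 1 N.sqrt := Finset.mem_Icc.2 ⟨hm.1, Nat.le_sqrt'.2 hm.2.1⟩
      exact ⟨f m, Finset.mem_image_of_mem f (Finset.mem_filter.2 ⟨hmem, hg⟩),
        (hf m hg).1.triCongruent hsides, (hf m hg).2⟩
  · refine ⟨Tiling.Tileable, Tiling.computablePred_tileable, fun N ABC hABC => ?_⟩
    obtain ⟨φ⟩ := Tiling.nonempty_frame hABC
    exact φ.tileable_iff N
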